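/- **Setting.** Let $d\in\{1,2\}$ and $\langle\xi\rangle=(1+|\xi|^2)^{1/2}$. For a symbol $G:\mathbb R^d\to\mathbb R$, the Fourier multiplier $\mathrm G=G(D)$ is defined by $\widehat{\mathrm G[u]}(\xi)=G(\xi)\widehat u(\xi)$. A pair $(\mathrm G_1,\mathrm G_2)$ is *admissible* if $G_k\in L^\infty(\mathbb R^d)$ and $\langle\cdot\rangle\nabla G_k\in L^\infty(\mathbb R^d)^d$ for $k=1,2$ (gradients in the sense of distributions), and $G_1(\xi)>0$, $|G_2(\xi)|\le G_1(\xi)$ for all $\xi\in\mathbb R^d$. For $s\ge0$, let $|f|_{H^s}=|(1-\Delta)^{s/2}f|_{L^2}$ and let $X^s=X^s(\mathbb R^d)$ be the space of pairs $U=(\zeta,v)$ of tempered distributions on $\mathbb R^d$ ($\zeta$ scalar, $v$ with $d$ components) whose Fourier transforms are locally integrable functions and for which $$|U|_{X^s}:=|\zeta|_{H^s}+|\mathrm G_1[v]|_{H^s}<\infty .$$ For $\epsilon>0$, $\underline U=(\underline\zeta,\underline v)$ and $j\in\{1,\dots,d\}$, define $A_j(\underline U)$ on pairs $W=(\eta,w)$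 by $$A_j(\underline U)[W]=\Big(\epsilon\,\mathrm G_2\big[\mathrm G_2[\underline v_j]\,\eta\big]+\mathrm G_1^2[w_j]+\epsilon\,\mathrm G_2\big[\underline\zeta\,\mathrm G_2[w_j]\big],\ \ \eta\,e_j+\epsilon\,\mathrm G_2[\underline v_j]\,\mathrm G_2[w]\Big),$$ where $e_j$ is the $j$-th vector of the canonical basis. For $\tau>0$ and a normed space $X$, elements of $W^{1,\infty}([0,\tau],X)$ are identified with their continuous representatives, and $|f|_{W^{1,\infty}_tX}=|f|_{L^\infty_tX}+|\partial_tf|_{L^\infty_tX}$. **Proposition.** Let $t_0>d/2$ and $M\geq 0$. There is a function $\kappa:\mathbb R^2\to(0,\infty)$, non-decreasing in each argument, depending only on $d,t_0,M$, and for every $s\ge0$ there are functions $\lambda,\nu:\mathbb R^4\to(0,\infty)$, non-decreasing in each argument, depending only on $d,t_0,M,s$, such that the following holds. Let $(\mathrm G_1,\mathrm G_2)$ be admissible with $|G_k|_{L^\infty}\le M$ and $|\langle\cdot\rangle\nabla G_k|_{L^\infty}\le M$ for $k=1,2$. Let $\epsilon\in(0,1]$, $T>0$, $h_{\min}>0$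 and $$\underline U=(\underline\zeta,\underline v)\in W^{1,\infty}([0,T/\epsilon],X^{t_0})\cap L^\infty([0,T/\epsilon],X^{\max(t_0+1,s)})$$ be such that, for all $t\in[0,T/\epsilon]$, the functions $\underline\zeta(t,\cdot)$ and $\mathrm G_2[\underline v_j](t,\cdot)$, $1\le j\le d$, are real-valued (as is the case if $\underline\zeta$, $\underline v$ are real-valued and $G_2$ is even), and $$1+\epsilon\,\underline\zeta(t,x)\ge h_{\min}\qquad\text{for all }(t,x)\in[0,T/\epsilon]\times\mathbb R^d .$$ Let $R\in L^\infty([0,T/\epsilon],X^s)$, and let $U\in W^{1,\infty}([0,T/\epsilon],X^s)\cap L^\infty([0,T/\epsilon],X^{s+1})$ satisfy, for almost every $t\in[0,T/\epsilon]$, $$\partial_tU+\sum_{j=1}^dA_j(\underline U)[\partial_jU]=\epsilon R .$$ Then for every $t\in[0,T/\epsilon]$, $$|U(t)|_{X^s}\le\kappa_0\,e^{\epsilon\lambda_st}\,|U(0)|_{X^s}+\epsilon\,\nu_s\int_0^t|R(t')|_{X^s}\,dt',$$ where $\kappa_0=\kappa\big(\tfrac1{h_{\min}},|\underline U(0)|_{X^{t_0}}\big)$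 and $$\lambda_s=\lambda\Big(\tfrac1{h_{\min}},T,|\underline U|_{W^{1,\infty}_tX^{t_0}},|\underline U|_{L^\infty_tX^{\max(t_0+1,s)}}\Big),\qquad \nu_s=\nu\Big(\tfrac1{h_{\min}},T,|\underline U|_{W^{1,\infty}_tX^{t_0}},|\underline U|_{L^\infty_tX^{\max(t_0+1,s)}}\Big).$$ -/

import Mathlib

open MeasureTheory Set
open scoped SchwartzMap FourierTransform LineDeriv ContDiff ENNReal

noncomputable section

namespace WhithamBoussinesq

/-- The physical (and the frequency) space `ℝ^d`, with its Euclidean norm. -/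
abbrev Space (d : ℕ) := EuclideanSpace ℝ (Fin d)

/-- Vectors of `ℂ^d`, with the Hermitian norm. -/
abbrev CVec (d : ℕ) := EuclideanSpace ℂ (Fin d)

/-- Pairs `U = (ζ, v)` of a scalar tempered distribution and a `d`-dimensional vector of tempered
distributions on `ℝ^d`. -/
abbrev State (d : ℕ) := 𝓢'(Space d, ℂ) × 𝓢'(Space d, CVec d)

/-- The Japanese bracket `⟨ξ⟩ = (1 + |ξ|²)^{1/2}`. -/
def bracket {d : ℕ} (ξ : Space d) : ℝ := Real.sqrt (1 + ‖ξ‖ ^ 2)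

section Symbols

/-- `g` is the gradient of `G` in the sense of distributions. -/
def IsWeakGradient {d : ℕ} (G : Space d → ℝ) (g : Space d → Space d) : Prop :=
  ∀ φ : Space d → ℝ, ContDiff ℝ ∞ φ → HasCompactSupport φ → ∀ m : Space d,
    ∫ ξ, G ξ * fderiv ℝ φ ξ m = - ∫ ξ, inner ℝ (g ξ) m * φ ξ

/-- `G` and `⟨·⟩ ∇G` belong to `L^∞(ℝ^d)`, both with norm at most `M`. -/
structure SymbolBound {d : ℕ} (G : Space d → ℝ) (M : ℝ) : Prop where
  aestronglyMeasurable : AEStronglyMeasurable G volume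
  bound : ∀ᵐ ξ, |G ξ| ≤ M
  gradient : ∃ g : Space d → Space d, AEStronglyMeasurable g volume ∧ IsWeakGradient G g ∧
    ∀ᵐ ξ, bracket ξ * ‖g ξ‖ ≤ M

/-- Admissible pairs of Fourier multipliers, in terms of their symbols. -/
structure IsAdmissible {d : ℕ} (G₁ G₂ : Space d → ℝ) : Prop where
  bounded₁ : ∃ M, SymbolBound G₁ M
  bounded₂ : ∃ M, SymbolBound G₂ M
  pos : ∀ ξ, 0 < G₁ ξ
  le : ∀ ξ, |G₂ ξ| ≤ G₁ ξ

end Symbols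

section Fourier

variable {d : ℕ} {F : Type*} [NormedAddCommGroup F] [InnerProductSpace ℂ F] [CompleteSpace F]

/-- The Fourier transform of the tempered distribution `u` (in Mathlib's normalization, with
kernel `e^{-2πi x·ξ}`) is the locally integrable function `w`. As compactly supported test
functions are dense in the Schwartz space, `w` determines `u`; conversely `u` determines `w` up to
a null set. -/
def HasFourierFun (u : 𝓢'(Space d, F)) (w : Space d → F) : Prop :=
  LocallyIntegrable w volume ∧
    ∀ φ : 𝓢(Space d, ℂ), HasCompactSupport (φ : Space d → ℂ) → (𝓕 u) φ = ∫ ξ, φ ξ • w ξ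

/-- The function `ξ ↦ ⟨2πξ⟩^s G(2πξ) w(ξ)`. If `w` is the Fourier transform of `u` then this is the
Fourier transform of `Λ^s G(D) u`, where `Λ^s = (1 - Δ)^{s/2}`: with the kernel `e^{-2πi x·ξ}`,
the operator `m(D)` (with `D = -i∇`) is the multiplication by `m(2πξ)` in Fourier variables. -/
def weighted (G : Space d → ℝ) (s : ℝ) (w : Space d → F) : Space d → F := fun ξ ↦
  ((bracket ((2 * Real.pi) • ξ) ^ s * G ((2 * Real.pi) • ξ) : ℝ) : ℂ) • w ξ

/-- `G(D) u ∈ H^s(ℝ^d)`. -/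
def MemHs (G : Space d → ℝ) (s : ℝ) (u : 𝓢'(Space d, F)) : Prop :=
  ∃ w : Space d → F, HasFourierFun u w ∧ MemLp (weighted G s w) 2 volume

open Classical in
/-- The Fourier transform of `Λ^s G(D) u`, as an element of `L²`, when `G(D) u ∈ H^s`
(and `0` otherwise). By Plancherel its norm is `|G(D) u|_{H^s}`. -/
def lift (G : Space d → ℝ) (s : ℝ) (u : 𝓢'(Space d, F)) : Lp F 2 (volume : Measure (Space d)) :=
  if h : MemHs G s u then h.choose_spec.2.toLp _ else 0

/-- The Fourier multiplier `G(D)`, defined on the tempered distributions `u` such that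
`ξ ↦ G(ξ) û(ξ)` is in `L²` (and `0` otherwise). -/
def mult (G : Space d → ℝ) (u : 𝓢'(Space d, F)) : 𝓢'(Space d, F) :=
  ((𝓕⁻ (lift G 0 u) : Lp F 2 (volume : Measure (Space d))) : 𝓢'(Space d, F))

open Classical in
/-- A tempered distribution that is given by an `L²` function, as an element of `L²`
(`0` for the other distributions). -/
def toL2 (u : 𝓢'(Space d, F)) : Lp F 2 (volume : Measure (Space d)) :=
  if h : ∃ f : Lp F 2 (volume : Measure (Space d)), (f : 𝓢'(Space d, F)) = u then h.choose else 0

/-- The pointwise product of a scalar `L²` function and an `L²` function, which is an `L¹`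
function. -/
def prod (a : 𝓢'(Space d, ℂ)) (u : 𝓢'(Space d, F)) : 𝓢'(Space d, F) :=
  ((toL2 a • toL2 u : Lp F 1 (volume : Measure (Space d))) : 𝓢'(Space d, F))

/-- The distribution is given by a real-valued `L²` function. -/
def IsRealValued (a : 𝓢'(Space d, ℂ)) : Prop := ∀ᵐ x, (toL2 a x).im = 0

end Fourier

section System

variable {d : ℕ}

/-- The `j`-th component of a vector-valued distribution. -/
def comp (j : Fin d) (v : 𝓢'(Space d, CVec d)) : 𝓢'(Space d, ℂ) :=
  PointwiseConvergenceCLM.postcomp _ (EuclideanSpace.proj j : CVec d →L[ℂ] ℂ) v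

/-- The vector-valued distribution with `j`-th component `a` and all others `0`. -/
def single (j : Fin d) (a : 𝓢'(Space d, ℂ)) : 𝓢'(Space d, CVec d) :=
  PointwiseConvergenceCLM.postcomp _
    (ContinuousLinearMap.toSpanSingleton ℂ (EuclideanSpace.single j (1 : ℂ) : CVec d)) a

/-- The partial derivative `∂_j` of both components of a state. -/
def partialD (j : Fin d) (U : State d) : State d :=
  (∂_{(EuclideanSpace.single j (1 : ℝ) : Space d)} U.1,
    ∂_{(EuclideanSpace.single j (1 : ℝ) : Space d)} U.2)

/-- The operator `A_j(Ū)` of the system: for `Ū = (ζ̄, v̄)` and `W = (η, w)`,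
`A_j(Ū)[W] = (ε G₂[G₂[v̄_j] η] + G₁²[w_j] + ε G₂[ζ̄ G₂[w_j]], η e_j + ε G₂[v̄_j] G₂[w])`. -/
def opA (ε : ℝ) (G₁ G₂ : Space d → ℝ) (Ubar : State d) (j : Fin d) (W : State d) : State d :=
  ((ε : ℂ) • mult G₂ (prod (mult G₂ (comp j Ubar.2)) W.1)
      + mult G₁ (mult G₁ (comp j W.2))
      + (ε : ℂ) • mult G₂ (prod Ubar.1 (mult G₂ (comp j W.2))),
    single j W.1 + (ε : ℂ) • prod (mult G₂ (comp j Ubar.2)) (mult G₂ W.2))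

/-- `U ∈ X^s(ℝ^d)`. -/
def MemX (G₁ : Space d → ℝ) (s : ℝ) (U : State d) : Prop :=
  MemHs (fun _ ↦ 1) s U.1 ∧ MemHs G₁ s U.2

/-- The norm `|U|_{X^s} = |ζ|_{H^s} + |G₁[v]|_{H^s}`, for `U ∈ X^s(ℝ^d)`. -/
def normX (G₁ : Space d → ℝ) (s : ℝ) (U : State d) : ℝ :=
  ‖lift (fun _ ↦ 1) s U.1‖ + ‖lift G₁ s U.2‖

/-- Lebesgue measure on the time interval `[0, τ]`. -/
abbrev timeMeasure (τ : ℝ) : Measure ℝ := volume.restrict (Icc 0 τ)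

/-- `U ∈ L^∞([0, τ], X^s(ℝ^d))` (Bochner measurable and essentially bounded; `U ↦ (lift 1 s ζ,
lift G₁ s v)` is an isometry from `X^s` to `L² × L²`). -/
structure MemLinfX (G₁ : Space d → ℝ) (s τ : ℝ) (U : ℝ → State d) : Prop where
  mem : ∀ᵐ t ∂timeMeasure τ, MemX G₁ s (U t)
  memLp_fst : MemLp (fun t ↦ lift (fun _ ↦ 1) s (U t).1) ∞ (timeMeasure τ)
  memLp_snd : MemLp (fun t ↦ lift G₁ s (U t).2) ∞ (timeMeasure τ)

/-- The norm of `L^∞([0, τ], X^s(ℝ^d))`. -/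
def normLinfX (G₁ : Space d → ℝ) (s τ : ℝ) (U : ℝ → State d) : ℝ :=
  (eLpNorm (fun t ↦ normX G₁ s (U t)) ∞ (timeMeasure τ)).toReal

/-- `U ∈ W^{1,∞}([0, τ], X^s(ℝ^d))` with `∂_t U = dU`, where `U` is the continuous representative:
`U, dU ∈ L^∞([0, τ], X^s)` and `U(t) = U(0) + ∫₀ᵗ dU` in `X^s` for all `t ∈ [0, τ]`. -/
structure MemW1infX (G₁ : Space d → ℝ) (s τ : ℝ) (U dU : ℝ → State d) : Prop where
  mem : ∀ t ∈ Icc 0 τ, MemX G₁ s (U t)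
  memLinf : MemLinfX G₁ s τ U
  memLinf_deriv : MemLinfX G₁ s τ dU
  eq_fst : ∀ t ∈ Icc 0 τ, lift (fun _ ↦ 1) s (U t).1
    = lift (fun _ ↦ 1) s (U 0).1 + ∫ r in (0 : ℝ)..t, lift (fun _ ↦ 1) s (dU r).1
  eq_snd : ∀ t ∈ Icc 0 τ, lift G₁ s (U t).2
    = lift G₁ s (U 0).2 + ∫ r in (0 : ℝ)..t, lift G₁ s (dU r).2

/-- The norm of `W^{1,∞}([0, τ], X^s(ℝ^d))`, where `dU = ∂_t U`. -/
def normW1infX (G₁ : Space d → ℝ) (s τ : ℝ) (U dU : ℝ → State d) : ℝ :=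
  normLinfX G₁ s τ U + normLinfX G₁ s τ dU

/-- The coefficients of the operators `A_j(Ū)`, that is the functions `ζ̄` and `G₂[v̄_j]`, are
real-valued. -/
def HasRealCoefficients (G₂ : Space d → ℝ) (Ubar : State d) : Prop :=
  IsRealValued Ubar.1 ∧ ∀ j, IsRealValued (mult G₂ (comp j Ubar.2))

/-- Non-cavitation: `1 + ε ζ̄(x) ≥ h` for almost all `x` (equivalently for all `x`, if `ζ̄` is
continuous). -/
def NonCavitation (ε h : ℝ) (Ubar : State d) : Prop :=
  ∀ᵐ x, h ≤ 1 + ε * (toL2 Ubar.1 x).re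

/-- `U` (with time derivative `dU`) satisfies `∂_t U + ∑_j A_j(Ū)[∂_j U] = ε R` for almost all
times in `[0, τ]`, as an equality of tempered distributions. -/
def SolvesLinearized (ε : ℝ) (G₁ G₂ : Space d → ℝ) (τ : ℝ) (Ubar U dU R : ℝ → State d) : Prop :=
  ∀ᵐ t ∂timeMeasure τ,
    dU t + ∑ j, opA ε G₁ G₂ (Ubar t) j (partialD j (U t)) = (ε : ℂ) • R t

end System

end WhithamBoussinesq

end

noncomputable section

set_option linter.unusedSectionVars false

namespace WhithamBoussinesq

/-! ### Scalar inequalities behind the commutator with `Λ^s` -/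

section RealInequalities

/-! The estimate is a symmetrizer argument carried out in L² on the Fourier side. The unknowns are
`Z`, the transform of `Λ^s ζ`, and `V k`, the transform of `Λ^s G₁[v_k]`. With `m = G₂ / G₁`, a
symbol of modulus at most one, the transform of `Λ^s G₂[v_k]` is `m (V k)`. Applying `Λ^s` to the
first equation and `Λ^s G₁` to the second gives a system for `(Z, V)` in which coefficients act by
convolution, up to bounded commutators `[Λ^s, a] ∂_j Λ^{-s}`.

The energy is `‖Z‖² + ∑ k, (‖V k‖² + ε (m V k, ζ̄ m V k))`. It is coercive (`le_energy`) because `‖V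
k‖² - ‖m V k‖²` is nonnegative and `1 + ε ζ̄` is bounded below. In its derivative
(`SystemOps.energy_rate`) the terms of order one, `(Z, G₁ ∂_k V k) + (V k, G₁ ∂_k Z)`, cancel
exactly, which leaves a growth rate proportional to `ε`. The terms with `ζ̄` in the first equation
cancel those produced by the weight, up to `∂_k ζ̄`. Each transport term equals its own opposite up
to derivatives of coefficients and commutators `[G_i, a] ∂_j`. Differentiating the weight in time
adds a term in `∂_t ζ̄`.

All these remainders are integral operators with kernel `k(ξ,η) a(ξ-η)`. They are bounded on L² as
soon as `|k|` is at most a multiple of `⟨ξ-η⟩^σ (⟨ξ-η⟩^{-t₀} + ⟨η⟩^{-t₀})` and `a` is the transform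
of an `H^σ` function (`KerBound.eLpNorm_lintegral_le`); here `σ = max (t₀+1) s`. For `[G, a] ∂_j`
this rests on `|G ξ - G η| ⟨η⟩ ≤ 4 M ⟨ξ-η⟩` (`SymbolBound.exists_full_set`), for `Λ^s` on
`exists_abs_rpow_sub_rpow_mul_le`.

Symmetry, commutation and coercivity of the coefficients are read in physical variables, where they
are multiplications by real functions (`fourierInv_coefOp`). Since `U` has one derivative to spare
for almost every time, no regularization in space is needed: the energy is Lipschitz in time, and a
Grönwall argument for its square root (`sqrt_le_of_ae_deriv_le`) concludes, the bound `ε t ≤ T`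
absorbing the exponential in front of the source. -/

theorem one_le_rpow_mul_add {δ y σ t₀ : ℝ} (hδ : 1 ≤ δ) (hy : 1 ≤ y) (hσ : t₀ ≤ σ) :
    1 ≤ δ ^ σ * (δ ^ (-t₀) + y ^ (-t₀)) := by
  have h1 : 1 ≤ δ ^ σ * δ ^ (-t₀) := by
    rw [← Real.rpow_add (by linarith)]
    exact Real.one_le_rpow hδ (by linarith)
  have h2 : 0 ≤ δ ^ σ * y ^ (-t₀) := by positivity
  linarith

theorem le_rpow_mul_add {δ y σ t₀ : ℝ} (hδ : 1 ≤ δ) (hy : 1 ≤ y) (hσ : t₀ + 1 ≤ σ) :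
    δ ≤ δ ^ σ * (δ ^ (-t₀) + y ^ (-t₀)) := by
  have h1 : δ ≤ δ ^ σ * δ ^ (-t₀) := by
    rw [← Real.rpow_add (by linarith)]
    exact Real.self_le_rpow_of_one_le hδ (by linarith)
  have h2 : 0 ≤ δ ^ σ * y ^ (-t₀) := by positivity
  linarith

/-- The power function is Lipschitz near `1`. -/
theorem exists_abs_rpow_sub_one_le (s : ℝ) :
    ∃ C, 0 ≤ C ∧ ∀ t ∈ Icc (1 / 2 : ℝ) (3 / 2), |t ^ s - 1| ≤ C * |t - 1| := by
  have hcd : ContDiffOn ℝ 1 (fun t : ℝ ↦ t ^ s) (Icc (1 / 2 : ℝ) (3 / 2)) := by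
    intro t ht
    exact (Real.contDiffAt_rpow_const_of_ne (by linarith [ht.1])).contDiffWithinAt
  obtain ⟨K, hK⟩ := hcd.exists_lipschitzOnWith (by decide) (convex_Icc _ _) isCompact_Icc
  refine ⟨K, K.2, fun t ht ↦ ?_⟩
  have := hK.dist_le_mul t ht 1 (by norm_num)
  simpa [Real.dist_eq] using this

/-- If `y` dominates `δ`, then `x / y` is close to one and the increment of the power costs only
`δ`, which is paid for by `δ ^ (-t₀)` because the exponent is at least `t₀ + 1`. Otherwise `x` and
`y` are both at most a multiple of `δ`, there is nothing to gain from the difference, and the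
missing powers are taken from `y ^ (-t₀)`. The two terms of the weight thus correspond to the two
frequency regimes. -/
theorem exists_abs_rpow_sub_rpow_mul_le (s t₀ : ℝ) (hs : 0 ≤ s) :
    ∃ C, 0 ≤ C ∧ ∀ x y δ : ℝ, 1 ≤ x → 1 ≤ y → 1 ≤ δ → |x - y| ≤ δ →
      |x ^ s - y ^ s| * y ≤
        C * (δ ^ max (t₀ + 1) s * (δ ^ (-t₀) + y ^ (-t₀))) * y ^ s := by
  obtain ⟨C₁, hC₁, h₁⟩ := exists_abs_rpow_sub_one_le s
  set σ := max (t₀ + 1) s with hσ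
  have hσ1 : t₀ + 1 ≤ σ := le_max_left _ _
  have hσ2 : s ≤ σ := le_max_right _ _
  set C₂ : ℝ := (3 ^ s + 2 ^ s) * 2 ^ (σ - s) with hC₂
  have hC₂0 : 0 ≤ C₂ := by positivity
  refine ⟨C₁ + C₂, by positivity, fun x y δ hx hy hδ hxy ↦ ?_⟩
  have hx0 : 0 < x := by linarith
  have hy0 : 0 < y := by linarith
  have hδ0 : 0 < δ := by linarith
  set W := δ ^ σ * (δ ^ (-t₀) + y ^ (-t₀)) with hW
  have hW0 : 0 ≤ W := by positivity
  have hWδ : δ ≤ W := le_rpow_mul_add hδ hy hσ1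
  rcases le_or_gt (2 * δ) y with hc | hc
  · have hxy' := abs_le.1 hxy
    have hmem : x / y ∈ Icc (1 / 2 : ℝ) (3 / 2) := by
      constructor
      · rw [le_div_iff₀ hy0]; linarith
      · rw [div_le_iff₀ hy0]; linarith
    have h2 := h₁ _ hmem
    rw [Real.div_rpow hx0.le hy0.le] at h2
    have e1 : |x ^ s - y ^ s| = |x ^ s / y ^ s - 1| * y ^ s := by
      have : x ^ s - y ^ s = (x ^ s / y ^ s - 1) * y ^ s := by
        field_simp
      rw [this, abs_mul, abs_of_pos (Real.rpow_pos_of_pos hy0 s)]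
    have e2 : |x / y - 1| * y = |x - y| := by
      have : x - y = (x / y - 1) * y := by field_simp
      rw [this, abs_mul, abs_of_pos hy0]
    calc |x ^ s - y ^ s| * y = |x ^ s / y ^ s - 1| * (y * y ^ s) := by rw [e1]; ring
      _ ≤ C₁ * |x / y - 1| * (y * y ^ s) := by gcongr
      _ = C₁ * (|x / y - 1| * y) * y ^ s := by ring
      _ ≤ C₁ * W * y ^ s := by
        rw [e2]
        gcongr
        exact hxy.trans hWδ
      _ ≤ (C₁ + C₂) * W * y ^ s := by gcongr; linarith
  · have hx3 : x ≤ 3 * δ := by linarith [(abs_le.1 hxy).2]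
    have h2 : |x ^ s - y ^ s| ≤ (3 ^ s + 2 ^ s) * δ ^ s := by
      have a1 : x ^ s ≤ 3 ^ s * δ ^ s := by
        rw [← Real.mul_rpow (by norm_num) hδ0.le]
        exact Real.rpow_le_rpow hx0.le hx3 hs
      have a2 : y ^ s ≤ 2 ^ s * δ ^ s := by
        rw [← Real.mul_rpow (by norm_num) hδ0.le]
        exact Real.rpow_le_rpow hy0.le hc.le hs
      have a3 : 0 ≤ x ^ s := by positivity
      have a4 : 0 ≤ y ^ s := by positivity
      rw [abs_le]
      constructor <;> nlinarith
    have h3 : δ ^ s * y ≤ 2 ^ (σ - s) * W * y ^ s := by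
      -- This is `y ≤ 2 δ` raised to the nonnegative power `σ - s`, used to trade powers of `y` for
      -- powers of `δ`.
      have a1 : 1 ≤ 2 ^ (σ - s) * δ ^ (σ - s) * y ^ (s - σ) := by
        rw [← Real.mul_rpow (by norm_num) hδ0.le, ← neg_sub σ s, Real.rpow_neg hy0.le,
          ← div_eq_mul_inv, one_le_div (by positivity)]
        exact Real.rpow_le_rpow hy0.le hc.le (by linarith)
      have a2 : y ^ (s - σ) * y ≤ y ^ (s - t₀) := by
        nth_rewrite 2 [← Real.rpow_one y]
        rw [← Real.rpow_add hy0]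
        exact Real.rpow_le_rpow_of_exponent_le hy (by linarith)
      have a3 : δ ^ σ * y ^ (-t₀) ≤ W := by
        rw [hW]; gcongr; linarith [Real.rpow_pos_of_pos hδ0 (-t₀)]
      calc δ ^ s * y ≤ δ ^ s * y * (2 ^ (σ - s) * δ ^ (σ - s) * y ^ (s - σ)) :=
            le_mul_of_one_le_right (by positivity) a1
        _ = 2 ^ (σ - s) * (δ ^ s * δ ^ (σ - s)) * (y ^ (s - σ) * y) := by ring
        _ ≤ 2 ^ (σ - s) * (δ ^ s * δ ^ (σ - s)) * y ^ (s - t₀) := by gcongr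
        _ = 2 ^ (σ - s) * (δ ^ σ * y ^ (-t₀)) * y ^ s := by
          rw [← Real.rpow_add hδ0, sub_eq_add_neg s t₀, Real.rpow_add hy0]
          ring_nf
        _ ≤ 2 ^ (σ - s) * W * y ^ s := by gcongr
    calc |x ^ s - y ^ s| * y ≤ (3 ^ s + 2 ^ s) * δ ^ s * y := by gcongr
      _ = (3 ^ s + 2 ^ s) * (δ ^ s * y) := by ring
      _ ≤ (3 ^ s + 2 ^ s) * (2 ^ (σ - s) * W * y ^ s) := by gcongr
      _ = C₂ * W * y ^ s := by rw [hC₂]; ring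
      _ ≤ (C₁ + C₂) * W * y ^ s := by gcongr; linarith

end RealInequalities

/-! ### The Japanese bracket and the symbol of `∂_j` -/

section Bracket

variable {d : ℕ}

theorem one_le_bracket (ξ : Space d) : 1 ≤ bracket ξ := by
  rw [bracket, Real.one_le_sqrt]
  nlinarith [sq_nonneg ‖ξ‖]

theorem norm_le_bracket (ξ : Space d) : ‖ξ‖ ≤ bracket ξ :=
  Real.le_sqrt_of_sq_le (by linarith)

theorem continuous_bracket : Continuous (bracket : Space d → ℝ) := by
  unfold bracket; fun_prop

theorem bracket_le_add (ξ η : Space d) : bracket ξ ≤ bracket η + ‖ξ - η‖ := by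
  have h1 : ‖ξ‖ ≤ ‖η‖ + ‖ξ - η‖ := by
    simpa using norm_add_le η (ξ - η)
  have h2 := norm_le_bracket η
  have h3 : bracket η ^ 2 = 1 + ‖η‖ ^ 2 := Real.sq_sqrt (by positivity)
  rw [bracket, Real.sqrt_le_left (by linarith [one_le_bracket η, norm_nonneg (ξ - η)])]
  nlinarith [norm_nonneg ξ, norm_nonneg η, norm_nonneg (ξ - η)]

theorem abs_bracket_sub_le (ξ η : Space d) : |bracket ξ - bracket η| ≤ ‖ξ - η‖ := by
  rw [abs_le]
  have h := bracket_le_add η ξ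
  rw [norm_sub_rev] at h
  constructor <;> linarith [bracket_le_add ξ η]

/-- The Japanese bracket in Mathlib's frequency variable. -/
def jb (ξ : Space d) : ℝ := bracket ((2 * Real.pi) • ξ)

theorem one_le_jb (ξ : Space d) : 1 ≤ jb ξ := one_le_bracket _

theorem jb_pos (ξ : Space d) : 0 < jb ξ := zero_lt_one.trans_le (one_le_jb ξ)

theorem continuous_jb : Continuous (jb : Space d → ℝ) :=
  continuous_bracket.comp (continuous_const_smul _)

theorem abs_jb_sub_le (ξ η : Space d) : |jb ξ - jb η| ≤ jb (ξ - η) := by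
  refine (abs_bracket_sub_le _ _).trans ?_
  rw [← smul_sub]
  exact norm_le_bracket _

theorem continuous_jb_rpow (r : ℝ) : Continuous (fun ξ : Space d ↦ jb ξ ^ r) :=
  continuous_jb.rpow_const fun ξ ↦ Or.inl (jb_pos ξ).ne'

/-- The square is integrable because `2 t₀ > d`; this is the Fourier form of the embedding of
`H^{t₀}` into bounded functions. -/
theorem memLp_jb_rpow_neg {t₀ : ℝ} (ht₀ : (d : ℝ) / 2 < t₀) :
    MemLp (fun ξ : Space d ↦ jb ξ ^ (-t₀)) 2 volume := by
  rw [memLp_two_iff_integrable_sq (continuous_jb_rpow _).aestronglyMeasurable]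
  have h1 : Integrable (fun ξ : Space d ↦ (1 + ‖ξ‖ ^ 2) ^ (-(2 * t₀) / 2)) volume :=
    integrable_rpow_neg_one_add_norm_sq (by simp; linarith)
  have h2 := h1.comp_smul (R := 2 * Real.pi) (by positivity)
  refine h2.congr (Filter.Eventually.of_forall fun ξ ↦ ?_)
  have h0 : (0 : ℝ) ≤ 1 + ‖(2 * Real.pi) • ξ‖ ^ 2 := by positivity
  simp only [jb, bracket]
  generalize 1 + ‖(2 * Real.pi) • ξ‖ ^ 2 = X at h0
  rw [Real.sqrt_eq_rpow, ← Real.rpow_mul h0, ← Real.rpow_natCast, ← Real.rpow_mul h0]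
  congr 1
  push_cast
  ring

/-- The symbol of the partial derivative `∂_j`. -/
def dsym (j : Fin d) (ξ : Space d) : ℂ := 2 * Real.pi * Complex.I * (ξ j : ℂ)

theorem continuous_dsym (j : Fin d) : Continuous (dsym j) := by
  unfold dsym; fun_prop

theorem norm_dsym_le (j : Fin d) (ξ : Space d) : ‖dsym j ξ‖ ≤ jb ξ := by
  have h1 : ‖ξ j‖ ≤ ‖ξ‖ := PiLp.norm_apply_le ξ j
  have h2 := norm_le_bracket ((2 * Real.pi) • ξ)
  rw [norm_smul] at h2
  refine le_trans ?_ h2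
  have h3 : ‖dsym j ξ‖ = ‖(2 * Real.pi : ℝ)‖ * ‖ξ j‖ := by
    simp [dsym]
  rw [h3]
  gcongr

theorem dsym_sub (j : Fin d) (ξ η : Space d) : dsym j (ξ - η) = dsym j ξ - dsym j η := by
  simp [dsym]; ring

theorem conj_dsym (j : Fin d) (ξ : Space d) : (starRingEnd ℂ) (dsym j ξ) = -dsym j ξ := by
  simp [dsym, map_ofNat]

end Bracket

/-! ### Weak gradients and increments of symbols -/

section WeakGradient

variable {d : ℕ}

open Convolution ContinuousLinearMap Topology

/-- Mollification turns a weak gradient into a gradient. -/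
theorem IsWeakGradient.hasFDerivAt_convolution {G : Space d → ℝ} {g : Space d → Space d}
    (h : IsWeakGradient G g) (hG : LocallyIntegrable G volume) {f : Space d → ℝ}
    (hf : ContDiff ℝ ∞ f) (hfc : HasCompactSupport f) (x : Space d) :
    ∃ L : Space d →L[ℝ] ℝ, HasFDerivAt (f ⋆[lsmul ℝ ℝ, volume] G) L x ∧
      ∀ m, L m = ∫ t, inner ℝ (g t) m * f (x - t) := by
  refine ⟨_, hfc.hasFDerivAt_convolution_left (lsmul ℝ ℝ) (hf.of_le (by simp)) hG x, fun m ↦ ?_⟩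
  have hfd : Continuous (fderiv ℝ f) := hf.continuous_fderiv (by simp)
  have hψ : ContDiff ℝ ∞ (fun t ↦ f (x - t)) := hf.comp (contDiff_const.sub contDiff_id)
  have hψc : HasCompactSupport (fun t ↦ f (x - t)) :=
    hfc.comp_homeomorph (Homeomorph.subLeft x)
  -- The test function is the reflected translate of `f`; the sign from the reflection cancels the
  -- one in the definition of the weak gradient.
  have key := h _ hψ hψc m
  have hfder : ∀ t, fderiv ℝ (fun t ↦ f (x - t)) t m = -(fderiv ℝ f (x - t) m) := by
    intro t
    have h1 : HasFDerivAt f (fderiv ℝ f (x - t)) (x - t) :=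
      (hf.differentiable (by simp) (x - t)).hasFDerivAt
    have h2 := h1.comp t ((hasFDerivAt_id t).const_sub x)
    rw [show (fun t ↦ f (x - t)) = f ∘ HSub.hSub x from rfl, h2.fderiv]
    simp
  simp only [hfder, mul_neg, integral_neg, neg_inj] at key
  rw [← key, ← convolution_flip, convolution_def]
  rw [integral_apply]
  · simp [ContinuousLinearMap.flip_apply, precompL_apply, mul_comm]
  · have := ((hfc.fderiv ℝ).convolutionExists_left ((lsmul ℝ ℝ).precompL (Space d)) hfd hG x)
    exact (this.integrable_swap)

/-- A function with a weak gradient that is bounded by `K` near the segment `[η, ξ]` has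
increment at most `K |ξ - η|`, for Lebesgue points `ξ`, `η`. -/
theorem IsWeakGradient.exists_full_set {G : Space d → ℝ} {g : Space d → Space d}
    (h : IsWeakGradient G g) (hG : LocallyIntegrable G volume) :
    ∃ S : Set (Space d), (∀ᵐ ξ, ξ ∈ S) ∧ ∀ ξ ∈ S, ∀ η ∈ S, ∀ K : ℝ, 
      (∀ x ∈ segment ℝ η ξ, ∀ᵐ t, t ∈ Metric.ball x (1 / 2) → ‖g t‖ ≤ K) →
      |G ξ - G η| ≤ K * ‖ξ - η‖ := by
  -- The ratio two between the radii is what the differentiation theorem for bump convolutions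
  -- needs; an outer radius at most `1/2` makes each mollification see only the ball on which `g` is
  -- controlled.
  let φ : ℕ → ContDiffBump (0 : Space d) := fun n ↦
    { rIn := 1 / (4 * ((n : ℝ) + 1)), rOut := 1 / (2 * ((n : ℝ) + 1)), rIn_pos := by positivity,
      rIn_lt_rOut := by
        apply one_div_lt_one_div_of_lt (by positivity)
        have : (0 : ℝ) ≤ n := n.cast_nonneg
        linarith }
  have hφ : Filter.Tendsto (fun n ↦ (φ n).rOut) Filter.atTop (𝓝 0) := by
    have h1 := (tendsto_one_div_add_atTop_nhds_zero_nat (𝕜 := ℝ)).const_mul (1 / 2)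
    rw [mul_zero] at h1
    refine h1.congr fun n ↦ ?_
    change (1 : ℝ) / 2 * (1 / ((n : ℝ) + 1)) = 1 / (2 * ((n : ℝ) + 1))
    rw [one_div_mul_one_div]
  have hφ' : ∀ᶠ n in Filter.atTop, (φ n).rOut ≤ 2 * (φ n).rIn := by
    refine Filter.Eventually.of_forall fun n ↦ ?_
    change (1 : ℝ) / (2 * ((n : ℝ) + 1)) ≤ 2 * (1 / (4 * ((n : ℝ) + 1)))
    have : (0 : ℝ) < (n : ℝ) + 1 := by positivity
    apply le_of_eq
    field_simp
    norm_num
  have hr : ∀ n, (φ n).rOut ≤ 1 / 2 := by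
    intro n
    change (1 : ℝ) / (2 * ((n : ℝ) + 1)) ≤ 1 / 2
    apply one_div_le_one_div_of_le (by norm_num)
    have : (0 : ℝ) ≤ n := n.cast_nonneg
    linarith
  refine ⟨_, ContDiffBump.ae_convolution_tendsto_right_of_locallyIntegrable hφ hφ' hG,
    fun ξ hξ η hη K hK ↦ ?_⟩
  have hlim := ((Filter.Tendsto.sub hξ hη).abs)
  refine le_of_tendsto hlim (Filter.Eventually.of_forall fun n ↦ ?_)
  set f := (φ n).normed volume with hf
  have hfs : ContDiff ℝ ∞ f := (φ n).contDiff_normed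
  have hfc : HasCompactSupport f := (φ n).hasCompactSupport_normed
  choose L hL hLm using fun x ↦ h.hasFDerivAt_convolution hG hfs hfc x
  have hbound : ∀ x ∈ segment ℝ η ξ, ‖L x‖ ≤ K := by
    intro x hx
    -- The ball has positive measure, so the almost everywhere bound on `g` holds at some point of
    -- it.
    have hK0 : 0 ≤ K := by
      have : (volume.restrict (Metric.ball x (1 / 2 : ℝ))) ≠ 0 := by
        rw [Ne, Measure.restrict_eq_zero]
        exact (Metric.measure_ball_pos _ _ (by norm_num)).ne'
      have h1 := (ae_restrict_iff' (μ := volume) Metric.isOpen_ball.measurableSet).2 (hK x hx)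
      have : (ae (volume.restrict (Metric.ball x (1 / 2 : ℝ)))).NeBot := ae_neBot.2 this
      obtain ⟨t, ht⟩ := h1.exists
      exact (norm_nonneg _).trans ht
    refine ContinuousLinearMap.opNorm_le_bound _ hK0 fun m ↦ ?_
    rw [hLm]
    have hint : Integrable f := hfs.continuous.integrable_of_hasCompactSupport hfc
    have h1 : ∫ t, K * ‖m‖ * f (x - t) = K * ‖m‖ := by
      rw [integral_const_mul, integral_sub_left_eq_self f volume x, hf,
        ContDiffBump.integral_normed, mul_one]
    rw [← h1]
    refine norm_integral_le_of_norm_le ((hint.comp_sub_left x).const_mul _) ?_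
    filter_upwards [hK x hx] with t ht
    have hf0 : 0 ≤ f (x - t) := (φ n).nonneg_normed _
    rw [norm_mul, Real.norm_of_nonneg hf0]
    by_cases hmem : t ∈ Metric.ball x (1 / 2)
    · gcongr
      exact (norm_inner_le_norm _ _).trans (by gcongr; exact ht hmem)
    · have : f (x - t) = 0 := by
        have h2 : x - t ∉ Function.support f := by
          rw [hf, (φ n).support_normed_eq]
          intro h3
          apply hmem
          rw [mem_ball_zero_iff] at h3
          rw [Metric.mem_ball, dist_comm, dist_eq_norm]
          exact h3.trans_le (hr n)
        simpa using h2
      simp [this]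
  have := (convex_segment η ξ).norm_image_sub_le_of_norm_hasFDerivWithin_le
    (fun x _ ↦ (hL x).hasFDerivWithinAt) hbound (left_mem_segment ℝ η ξ) (right_mem_segment ℝ η ξ)
  simpa using this

theorem SymbolBound.locallyIntegrable {G : Space d → ℝ} {M : ℝ} (h : SymbolBound G M) :
    LocallyIntegrable G volume := by
  have : MemLp G ∞ volume := memLp_top_of_bound h.aestronglyMeasurable M h.bound
  exact this.locallyIntegrable le_top

theorem SymbolBound.nonneg {G : Space d → ℝ} {M : ℝ} (h : SymbolBound G M) : 0 ≤ M := by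
  obtain ⟨ξ, hξ⟩ := h.bound.exists
  exact (abs_nonneg _).trans hξ

/-- When `ξ` is close to `η` relative to `‖η‖`, the segment stays far from the origin, where the
gradient is at most `3 M / ⟨η⟩`, and the mean value inequality applies. When it is far, `⟨η⟩ ≤ 2
⟨ξ-η⟩` and the bound `2 M` on the increment suffices, whence the constant `4 M`. -/
theorem SymbolBound.exists_full_set {G : Space d → ℝ} {M : ℝ} (h : SymbolBound G M) :
    ∃ S : Set (Space d), (∀ᵐ ξ, ξ ∈ S) ∧ ∀ ξ ∈ S, ∀ η ∈ S,
      |G ξ - G η| * bracket η ≤ 4 * M * bracket (ξ - η) := by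
  obtain ⟨g, -, hg, hgb⟩ := h.gradient
  obtain ⟨S, hS, hS'⟩ := hg.exists_full_set h.locallyIntegrable
  refine ⟨S ∩ {ξ | |G ξ| ≤ M}, ?_, fun ξ hξ η hη ↦ ?_⟩
  · filter_upwards [hS, h.bound] with ξ h1 h2 using ⟨h1, h2⟩
  have hM := h.nonneg
  have hb1 := one_le_bracket η
  have hb2 := one_le_bracket (ξ - η)
  have hbn := norm_le_bracket (ξ - η)
  rcases le_or_gt (‖ξ - η‖) (‖η‖ / 2) with hc | hc
  · have key := hS' ξ hξ.1 η hη.1 (3 * M / bracket η) (by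
      intro x hx
      filter_upwards [hgb] with t ht htx
      have h1 : ‖x - η‖ ≤ ‖ξ - η‖ := by
        have := norm_sub_le_of_mem_segment hx
        simpa using this
      have h2 : ‖η‖ ≤ ‖x‖ + ‖x - η‖ := by
        rw [norm_sub_rev]; simpa using norm_add_le x (η - x)
      have h3 : ‖x‖ ≤ ‖t‖ + 1 / 2 := by
        rw [Metric.mem_ball, dist_comm, dist_eq_norm] at htx
        have := norm_add_le t (x - t)
        rw [add_sub_cancel] at this
        linarith
      have h4 : ‖η‖ ≤ 2 * ‖t‖ + 1 := by linarith
      have h5 : bracket η ≤ 3 * bracket t := by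
        have h6 : bracket t ^ 2 = 1 + ‖t‖ ^ 2 := Real.sq_sqrt (by positivity)
        have h7 := one_le_bracket t
        rw [bracket, Real.sqrt_le_left (by positivity)]
        nlinarith [norm_nonneg η, norm_nonneg t, sq_nonneg (‖t‖ - 1)]
      rw [le_div_iff₀ (by positivity)]
      calc ‖g t‖ * bracket η ≤ ‖g t‖ * (3 * bracket t) := by gcongr
        _ = 3 * (bracket t * ‖g t‖) := by ring
        _ ≤ 3 * M := by gcongr)
    calc |G ξ - G η| * bracket η ≤ 3 * M / bracket η * ‖ξ - η‖ * bracket η := by gcongr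
      _ = 3 * M * ‖ξ - η‖ := by field_simp
      _ ≤ 4 * M * bracket (ξ - η) := by gcongr; norm_num
  · have h1 : |G ξ - G η| ≤ 2 * M := by
      have := abs_sub (G ξ) (G η)
      have h1 : |G ξ| ≤ M := hξ.2
      have h2 : |G η| ≤ M := hη.2
      linarith
    have h2 : bracket η ≤ 2 * bracket (ξ - η) := by
      have h6 : bracket (ξ - η) ^ 2 = 1 + ‖ξ - η‖ ^ 2 := Real.sq_sqrt (by positivity)
      rw [bracket, Real.sqrt_le_left (by positivity)]
      nlinarith [norm_nonneg η, norm_nonneg (ξ - η)]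
    calc |G ξ - G η| * bracket η ≤ 2 * M * (2 * bracket (ξ - η)) := by gcongr
      _ = _ := by ring

end WeakGradient

/-! ### Symbols in the frequency variable normalized by `2π` -/

section ScaledSymbols

variable {d : ℕ}

/-- A symbol in Mathlib's frequency variable. -/
def scaled (G : Space d → ℝ) (ξ : Space d) : ℝ := G ((2 * Real.pi) • ξ)

theorem quasiMeasurePreserving_two_pi_smul :
    Measure.QuasiMeasurePreserving (fun ξ : Space d ↦ (2 * Real.pi) • ξ) volume volume := by
  refine ⟨by fun_prop, ?_⟩
  rw [Measure.map_addHaar_smul _ (by positivity)]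
  exact Measure.smul_absolutelyContinuous

theorem SymbolBound.aestronglyMeasurable_scaled {G : Space d → ℝ} {M : ℝ} (h : SymbolBound G M) :
    AEStronglyMeasurable (scaled G) volume :=
  h.aestronglyMeasurable.comp_quasiMeasurePreserving quasiMeasurePreserving_two_pi_smul

theorem SymbolBound.scaled_bound {G : Space d → ℝ} {M : ℝ} (h : SymbolBound G M) :
    ∀ᵐ ξ, |scaled G ξ| ≤ M :=
  quasiMeasurePreserving_two_pi_smul.ae h.bound

theorem SymbolBound.scaled_exists_full_set {G : Space d → ℝ} {M : ℝ} (h : SymbolBound G M) :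
    ∃ S : Set (Space d), (∀ᵐ ξ, ξ ∈ S) ∧ ∀ ξ ∈ S, ∀ η ∈ S,
      |scaled G ξ - scaled G η| * jb η ≤ 4 * M * jb (ξ - η) := by
  obtain ⟨S, hS, hS'⟩ := h.exists_full_set
  refine ⟨_, quasiMeasurePreserving_two_pi_smul.ae hS, fun ξ hξ η hη ↦ ?_⟩
  have := hS' _ hξ _ hη
  rwa [← smul_sub] at this

end ScaledSymbols

/-! ### L² bounds for integral operators with weighted kernels -/

section KernelOperators

variable {d : ℕ}

theorem aemeasurable_comp_sub {p : Space d → ℝ≥0∞} (hp : AEMeasurable p volume) :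
    AEMeasurable (fun z : Space d × Space d ↦ p (z.1 - z.2)) (volume.prod volume) :=
  hp.comp_quasiMeasurePreserving (quasiMeasurePreserving_sub volume volume)

theorem aemeasurable_comp_const_sub {p : Space d → ℝ≥0∞} (hp : AEMeasurable p volume)
    (ξ : Space d) : AEMeasurable (fun η ↦ p (ξ - η)) volume :=
  hp.comp_quasiMeasurePreserving (quasiMeasurePreserving_sub_left volume ξ)

theorem lintegral_const_sub (p : Space d → ℝ≥0∞) (ξ : Space d) :
    ∫⁻ η, p (ξ - η) = ∫⁻ η, p η :=
  lintegral_sub_left_eq_self p ξ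

theorem eLpNorm_two_sq (p : Space d → ℝ≥0∞) : eLpNorm p 2 volume ^ 2 = ∫⁻ ξ, p ξ ^ 2 := by
  rw [eLpNorm_eq_lintegral_rpow_enorm_toReal (by norm_num) (by norm_num), ← ENNReal.rpow_natCast,
    ← ENNReal.rpow_mul]
  simp

/-- Cauchy–Schwarz for the measure with density `p`, obtained by splitting `p q` as `p^{1/2} ·
p^{1/2} q`. -/
theorem sq_lintegral_mul_le {p q : Space d → ℝ≥0∞} (hp : AEMeasurable p volume)
    (hq : AEMeasurable q volume) :
    (∫⁻ η, p η * q η) ^ 2 ≤ (∫⁻ η, p η) * ∫⁻ η, p η * q η ^ 2 := by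
  have h := ENNReal.lintegral_mul_le_Lp_mul_Lq volume Real.HolderConjugate.two_two
    (hp.pow_const (1 / 2 : ℝ)) ((hp.pow_const (1 / 2 : ℝ)).mul hq)
  have e1 : ∀ x : ℝ≥0∞, x ^ (1 / 2 : ℝ) * x ^ (1 / 2 : ℝ) = x := fun x ↦ by
    rw [← ENNReal.rpow_add_of_nonneg _ _ (by norm_num) (by norm_num)]; norm_num
  have e2 : ∀ x : ℝ≥0∞, (x ^ (1 / 2 : ℝ)) ^ (2 : ℝ) = x := fun x ↦ by
    rw [← ENNReal.rpow_mul]; norm_num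
  simp only [Pi.mul_apply, ← mul_assoc, e1, ENNReal.mul_rpow_of_nonneg _ _ (zero_le_two (α := ℝ)),
    e2] at h
  calc (∫⁻ η, p η * q η) ^ 2 ≤ ((∫⁻ η, p η) ^ (1 / 2 : ℝ) *
        (∫⁻ η, p η * q η ^ (2 : ℝ)) ^ (1 / 2 : ℝ)) ^ 2 := by gcongr
    _ = _ := by
      rw [mul_pow]
      simp only [← ENNReal.rpow_natCast, Nat.cast_ofNat, e2]

/-- Young's inequality `L¹ * L² ⊂ L²`, for functions with values in `[0, ∞]`. -/
theorem eLpNorm_lconvolution_le {p q : Space d → ℝ≥0∞} (hp : AEMeasurable p volume)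
    (hq : AEMeasurable q volume) :
    eLpNorm (fun ξ ↦ ∫⁻ η, p (ξ - η) * q η) 2 volume ≤ (∫⁻ η, p η) * eLpNorm q 2 volume := by
  rw [← ENNReal.pow_le_pow_left_iff (two_ne_zero), eLpNorm_two_sq, mul_pow, eLpNorm_two_sq]
  calc ∫⁻ ξ, (∫⁻ η, p (ξ - η) * q η) ^ 2
      ≤ ∫⁻ ξ, (∫⁻ η, p η) * ∫⁻ η, p (ξ - η) * q η ^ 2 := by
        refine lintegral_mono fun ξ ↦ ?_
        have := sq_lintegral_mul_le (aemeasurable_comp_const_sub hp ξ) hq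
        rwa [lintegral_const_sub] at this
    _ = (∫⁻ η, p η) * ∫⁻ ξ, ∫⁻ η, p (ξ - η) * q η ^ 2 := by
        rw [lintegral_const_mul'']
        exact ((aemeasurable_comp_sub hp).mul (hq.comp_snd.pow_const 2)).lintegral_prod_right'
    _ = (∫⁻ η, p η) * ∫⁻ η, ∫⁻ ξ, p (ξ - η) * q η ^ 2 := by
        rw [lintegral_lintegral_swap]
        exact (aemeasurable_comp_sub hp).mul (hq.comp_snd.pow_const 2)
    _ = (∫⁻ η, p η) * ∫⁻ η, (∫⁻ ξ, p ξ) * q η ^ 2 := by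
        congr 1
        refine lintegral_congr fun η ↦ ?_
        rw [lintegral_mul_const'', lintegral_sub_right_eq_self p η]
        exact hp.comp_quasiMeasurePreserving
          (measurePreserving_sub_right volume η).quasiMeasurePreserving
    _ = (∫⁻ η, p η) ^ 2 * ∫⁻ η, q η ^ 2 := by
        rw [lintegral_const_mul'' _ (hq.pow_const 2), sq, mul_assoc]

theorem lconvolution_comm (p q : Space d → ℝ≥0∞) (ξ : Space d) :
    ∫⁻ η, p (ξ - η) * q η = ∫⁻ η, q (ξ - η) * p η := by
  rw [← lintegral_const_sub _ ξ]
  simp [mul_comm]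

theorem lintegral_mul_le_eLpNorm {p q : Space d → ℝ≥0∞} (hp : AEMeasurable p volume)
    (hq : AEMeasurable q volume) :
    ∫⁻ η, p η * q η ≤ eLpNorm p 2 volume * eLpNorm q 2 volume := by
  have h := ENNReal.lintegral_mul_le_Lp_mul_Lq volume Real.HolderConjugate.two_two hp hq
  rw [eLpNorm_eq_lintegral_rpow_enorm_toReal (by norm_num) (by norm_num),
    eLpNorm_eq_lintegral_rpow_enorm_toReal (by norm_num) (by norm_num)]
  simpa using h

/-- The operator with kernel `k(ξ, η) a(ξ - η)`. -/
def kerOp (k : Space d → Space d → ℂ) (a f : Space d → ℂ) (ξ : Space d) : ℂ :=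
  ∫ η, k ξ η * a (ξ - η) * f η

/-- The weight that controls the kernels of the operators. -/
def kerWeight (t₀ σ : ℝ) (ξ η : Space d) : ℝ :=
  jb (ξ - η) ^ σ * (jb (ξ - η) ^ (-t₀) + jb η ^ (-t₀))

/-- The kernel `k` is measurable and bounded by `C` times the weight. -/
structure KerBound (t₀ σ C : ℝ) (k : Space d → Space d → ℂ) : Prop where
  nonneg : 0 ≤ C
  meas : AEStronglyMeasurable (Function.uncurry k) (volume.prod volume)
  bound : ∀ᵐ z : Space d × Space d ∂(volume.prod volume),
    ‖k z.1 z.2‖ ≤ C * kerWeight t₀ σ z.1 z.2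

/-- `a` is in the weighted space `L²(⟨·⟩^{2σ})`. -/
def MemW (σ : ℝ) (a : Space d → ℂ) : Prop := MemLp (fun ξ ↦ ((jb ξ ^ σ : ℝ) : ℂ) * a ξ) 2 volume

/-- The norm of `⟨·⟩^{-t₀}` in `L²`. -/
def weightNorm (d : ℕ) (t₀ : ℝ) : ℝ :=
  (eLpNorm (fun ξ : Space d ↦ jb ξ ^ (-t₀)) 2 volume).toReal

theorem weightNorm_nonneg (t₀ : ℝ) : 0 ≤ weightNorm d t₀ := ENNReal.toReal_nonneg

theorem enorm_jb_rpow (r : ℝ) (ξ : Space d) : ‖jb ξ ^ r‖ₑ = ENNReal.ofReal (jb ξ ^ r) :=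
  Real.enorm_of_nonneg (Real.rpow_nonneg (jb_pos ξ).le _)

theorem MemW.aestronglyMeasurable {σ : ℝ} {a : Space d → ℂ} (ha : MemW σ a) :
    AEStronglyMeasurable a volume := by
  have h1 : AEStronglyMeasurable (fun ξ : Space d ↦ ((jb ξ ^ (-σ) : ℝ) : ℂ)) volume :=
    (Complex.continuous_ofReal.comp (continuous_jb_rpow _)).aestronglyMeasurable
  refine (h1.mul ha.1).congr (Filter.Eventually.of_forall fun ξ ↦ ?_)
  simp only [Pi.mul_apply]
  rw [← mul_assoc, ← Complex.ofReal_mul, ← Real.rpow_add (jb_pos ξ), neg_add_cancel]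
  simp

variable {t₀ σ C : ℝ} {k : Space d → Space d → ℂ} {a f : Space d → ℂ}

theorem KerBound.aestronglyMeasurable_integrand (hk : KerBound t₀ σ C k)
    (ha : AEStronglyMeasurable a volume) (hf : AEStronglyMeasurable f volume) :
    AEStronglyMeasurable (fun z : Space d × Space d ↦ k z.1 z.2 * a (z.1 - z.2) * f z.2)
      (volume.prod volume) :=
  (hk.meas.mul (ha.comp_quasiMeasurePreserving (quasiMeasurePreserving_sub volume volume))).mul
    hf.comp_snd

/-- The weight `⟨·⟩^σ` is absorbed into `a`, giving `A` in L². For the first term of the kernel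
weight, `⟨·⟩^{-t₀} A` is in L¹ by Cauchy–Schwarz and is convolved with `f` in L²; for the second,
`⟨·⟩^{-t₀} f` is in L¹ and is convolved with `A` in L². Young's inequality gives the same bound
twice, hence the factor 2. The absolute values are inside the integral, so that integrability
follows as well. -/
theorem KerBound.eLpNorm_lintegral_le (ht₀ : (d : ℝ) / 2 < t₀) (hk : KerBound t₀ σ C k)
    (ha : MemW σ a) (hf : MemLp f 2 volume) :
    eLpNorm (fun ξ ↦ ∫⁻ η, ‖k ξ η * a (ξ - η) * f η‖ₑ) 2 volume ≤
      ENNReal.ofReal (2 * C * weightNorm d t₀) *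
        eLpNorm (fun ξ ↦ ((jb ξ ^ σ : ℝ) : ℂ) * a ξ) 2 volume * eLpNorm f 2 volume := by
  set A : Space d → ℝ≥0∞ := fun ξ ↦ ‖((jb ξ ^ σ : ℝ) : ℂ) * a ξ‖ₑ with hA
  set F : Space d → ℝ≥0∞ := fun ξ ↦ ‖f ξ‖ₑ with hF
  set w : Space d → ℝ≥0∞ := fun ξ ↦ ‖jb ξ ^ (-t₀)‖ₑ with hw
  have hAm : AEMeasurable A volume := ha.1.enorm
  have hFm : AEMeasurable F volume := hf.1.enorm
  have hwm : AEMeasurable w volume := (memLp_jb_rpow_neg ht₀).1.enorm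
  have hpt : ∀ᵐ ξ, ∀ᵐ η, ‖k ξ η * a (ξ - η) * f η‖ₑ ≤
      ENNReal.ofReal C * ((w (ξ - η) * A (ξ - η)) * F η + A (ξ - η) * (w η * F η)) := by
    filter_upwards [Measure.ae_ae_of_ae_prod hk.bound] with ξ hξ
    filter_upwards [hξ] with η hη
    have h1 : ‖k ξ η‖ₑ ≤ ENNReal.ofReal C * (‖jb (ξ - η) ^ σ‖ₑ * (w (ξ - η) + w η)) := by
      rw [← ofReal_norm, hw]
      simp only [enorm_jb_rpow]
      have p1 := Real.rpow_nonneg (jb_pos (ξ - η)).le (-t₀)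
      have p2 := Real.rpow_nonneg (jb_pos η).le (-t₀)
      have p3 := Real.rpow_nonneg (jb_pos (ξ - η)).le σ
      rw [← ENNReal.ofReal_add p1 p2, ← ENNReal.ofReal_mul p3, ← ENNReal.ofReal_mul hk.nonneg]
      exact ENNReal.ofReal_le_ofReal hη
    have h2 : A (ξ - η) = ‖jb (ξ - η) ^ σ‖ₑ * ‖a (ξ - η)‖ₑ := by
      rw [hA]
      simp only [enorm_mul]
      congr 1
      rw [← ofReal_norm, Complex.norm_real, ofReal_norm]
    rw [enorm_mul, enorm_mul, h2]
    calc ‖k ξ η‖ₑ * ‖a (ξ - η)‖ₑ * ‖f η‖ₑ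
        ≤ ENNReal.ofReal C * (‖jb (ξ - η) ^ σ‖ₑ * (w (ξ - η) + w η)) * ‖a (ξ - η)‖ₑ * F η := by
          gcongr
      _ = _ := by ring
  have hm1 : AEMeasurable (fun ξ ↦ ∫⁻ η, (w (ξ - η) * A (ξ - η)) * F η) volume :=
    ((aemeasurable_comp_sub (hwm.mul hAm)).mul hFm.comp_snd).lintegral_prod_right'
  have hm2 : AEMeasurable (fun ξ ↦ ∫⁻ η, A (ξ - η) * (w η * F η)) volume :=
    ((aemeasurable_comp_sub hAm).mul (hwm.mul hFm).comp_snd).lintegral_prod_right'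
  have hwn : eLpNorm w 2 volume = ENNReal.ofReal (weightNorm d t₀) := by
    rw [weightNorm, ENNReal.ofReal_toReal (memLp_jb_rpow_neg ht₀).2.ne, hw, eLpNorm_enorm]
  have hAn : eLpNorm A 2 volume = eLpNorm (fun ξ ↦ ((jb ξ ^ σ : ℝ) : ℂ) * a ξ) 2 volume :=
    eLpNorm_enorm _
  have hFn : eLpNorm F 2 volume = eLpNorm f 2 volume := eLpNorm_enorm _
  have h1 : eLpNorm (fun ξ ↦ ∫⁻ η, (w (ξ - η) * A (ξ - η)) * F η) 2 volume ≤
      eLpNorm w 2 volume * eLpNorm A 2 volume * eLpNorm F 2 volume :=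
    (eLpNorm_lconvolution_le (hwm.mul hAm) hFm).trans (by
      gcongr; exact lintegral_mul_le_eLpNorm hwm hAm)
  have h2 : eLpNorm (fun ξ ↦ ∫⁻ η, A (ξ - η) * (w η * F η)) 2 volume ≤
      eLpNorm w 2 volume * eLpNorm A 2 volume * eLpNorm F 2 volume := by
    simp_rw [lconvolution_comm A (fun η ↦ w η * F η)]
    refine (eLpNorm_lconvolution_le (hwm.mul hFm) hAm).trans ?_
    calc _ ≤ eLpNorm w 2 volume * eLpNorm F 2 volume * eLpNorm A 2 volume := by
          gcongr; exact lintegral_mul_le_eLpNorm hwm hFm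
      _ = _ := by ring
  calc eLpNorm (fun ξ ↦ ∫⁻ η, ‖k ξ η * a (ξ - η) * f η‖ₑ) 2 volume
      ≤ ENNReal.ofReal C * eLpNorm (fun ξ ↦ (∫⁻ η, (w (ξ - η) * A (ξ - η)) * F η) +
          ∫⁻ η, A (ξ - η) * (w η * F η)) 2 volume := by
        refine (eLpNorm_le_nnreal_smul_eLpNorm_of_ae_le_mul' (c := C.toNNReal) ?_ 2).trans_eq
          (by rw [ENNReal.smul_def]; rfl)
        filter_upwards [hpt] with ξ hξ
        simp only [enorm_eq_self]
        have hmm : AEMeasurable (fun η ↦ (w (ξ - η) * A (ξ - η)) * F η) volume :=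
          (aemeasurable_comp_const_sub (hwm.mul hAm) ξ).mul hFm
        change _ ≤ ENNReal.ofReal C * _
        rw [← lintegral_add_left' hmm, ← lintegral_const_mul' _ _ ENNReal.ofReal_ne_top]
        exact lintegral_mono_ae hξ
    _ ≤ ENNReal.ofReal C * (eLpNorm w 2 volume * eLpNorm A 2 volume * eLpNorm F 2 volume +
          eLpNorm w 2 volume * eLpNorm A 2 volume * eLpNorm F 2 volume) := by
        gcongr
        refine (eLpNorm_add_le hm1.aestronglyMeasurable hm2.aestronglyMeasurable
          (by norm_num)).trans (add_le_add h1 h2)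
    _ = _ := by
        rw [hwn, hAn, hFn, ENNReal.ofReal_mul (by linarith [hk.nonneg]),
          ENNReal.ofReal_mul (by norm_num)]
        simp only [ENNReal.ofReal_ofNat]
        ring

theorem KerBound.aestronglyMeasurable_kerOp (hk : KerBound t₀ σ C k)
    (ha : MemW σ a) (hf : MemLp f 2 volume) : AEStronglyMeasurable (kerOp k a f) volume :=
  (hk.aestronglyMeasurable_integrand ha.aestronglyMeasurable hf.1).integral_prod_right'

/-- The integral of the absolute value has finite L² norm as a function of `ξ`, hence is finite for
almost every `ξ`. -/
theorem KerBound.ae_integrable (ht₀ : (d : ℝ) / 2 < t₀) (hk : KerBound t₀ σ C k)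
    (ha : MemW σ a) (hf : MemLp f 2 volume) :
    ∀ᵐ ξ, Integrable (fun η ↦ k ξ η * a (ξ - η) * f η) volume := by
  have hm := hk.aestronglyMeasurable_integrand ha.aestronglyMeasurable hf.1
  have h1 := hk.eLpNorm_lintegral_le ht₀ ha hf
  have h2 : eLpNorm (fun ξ ↦ ∫⁻ η, ‖k ξ η * a (ξ - η) * f η‖ₑ) 2 volume < ⊤ :=
    h1.trans_lt (ENNReal.mul_lt_top (ENNReal.mul_lt_top ENNReal.ofReal_lt_top ha.2) hf.2)
  have h3 : ∀ᵐ ξ, (∫⁻ η, ‖k ξ η * a (ξ - η) * f η‖ₑ) ^ 2 < ⊤ := by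
    refine ae_lt_top' (hm.enorm.lintegral_prod_right'.pow_const 2) ?_
    rw [← eLpNorm_two_sq]
    exact ENNReal.pow_ne_top h2.ne
  filter_upwards [h3, hm.prodMk_left] with ξ hξ hξm
  refine ⟨hξm, ?_⟩
  rw [hasFiniteIntegral_iff_enorm]
  by_contra hcon
  rw [not_lt, top_le_iff] at hcon
  rw [hcon] at hξ
  simp at hξ

theorem KerBound.eLpNorm_kerOp_le (ht₀ : (d : ℝ) / 2 < t₀) (hk : KerBound t₀ σ C k)
    (ha : MemW σ a) (hf : MemLp f 2 volume) :
    eLpNorm (kerOp k a f) 2 volume ≤ ENNReal.ofReal (2 * C * weightNorm d t₀) *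
        eLpNorm (fun ξ ↦ ((jb ξ ^ σ : ℝ) : ℂ) * a ξ) 2 volume * eLpNorm f 2 volume := by
  refine le_trans ?_ (hk.eLpNorm_lintegral_le ht₀ ha hf)
  refine eLpNorm_mono_enorm fun ξ ↦ ?_
  rw [enorm_eq_self]
  exact enorm_integral_le_lintegral_enorm _

theorem KerBound.memLp_kerOp (ht₀ : (d : ℝ) / 2 < t₀) (hk : KerBound t₀ σ C k)
    (ha : MemW σ a) (hf : MemLp f 2 volume) : MemLp (kerOp k a f) 2 volume :=
  ⟨hk.aestronglyMeasurable_kerOp ha hf, (hk.eLpNorm_kerOp_le ht₀ ha hf).trans_lt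
    (ENNReal.mul_lt_top (ENNReal.mul_lt_top ENNReal.ofReal_lt_top ha.2) hf.2)⟩

end KernelOperators

/-! ### The energy identity in an abstract Hilbert space -/

section HilbertEnergy

variable {H : Type*} [NormedAddCommGroup H] [InnerProductSpace ℂ H]

/-- The real part of the inner product. -/
def rinner (x y : H) : ℝ := (inner ℂ x y).re

theorem rinner_comm (x y : H) : rinner x y = rinner y x := inner_re_symm (𝕜 := ℂ) x y

theorem rinner_add_right (x y z : H) : rinner x (y + z) = rinner x y + rinner x z := by
  simp [rinner]

theorem rinner_sub_right (x y z : H) : rinner x (y - z) = rinner x y - rinner x z := by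
  simp [rinner]

theorem rinner_smul_right (x y : H) (c : ℝ) : rinner x ((c : ℂ) • y) = c * rinner x y := by
  simp [rinner]

theorem rinner_sum_right {ι : Type*} (s : Finset ι) (x : H) (f : ι → H) :
    rinner x (∑ i ∈ s, f i) = ∑ i ∈ s, rinner x (f i) := by
  simp [rinner]

theorem abs_rinner_le (x y : H) : |rinner x y| ≤ ‖x‖ * ‖y‖ :=
  (Complex.abs_re_le_norm _).trans (norm_inner_le_norm x y)

theorem abs_rinner_le_of_le {x y : H} {a b : ℝ} (hx : ‖x‖ ≤ a) (hy : ‖y‖ ≤ b) :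
    |rinner x y| ≤ a * b :=
  (abs_rinner_le x y).trans (mul_le_mul hx hy (norm_nonneg _) ((norm_nonneg _).trans hx))

/-- Symmetry of a bounded operator. -/
def IsSymm (A : H →L[ℂ] H) : Prop := ∀ x y, inner ℂ (A x) y = inner ℂ x (A y)

theorem IsSymm.rinner {A : H →L[ℂ] H} (h : IsSymm A) (x y : H) :
    rinner (A x) y = rinner x (A y) := by
  simp [WhithamBoussinesq.rinner, h x y]

/-- An (unbounded) skew-symmetric operator, given by its graph. -/
def IsSkewGraph (S : H → H → Prop) : Prop :=
  ∀ ⦃f f' h h'⦄, S f f' → S h h' → rinner f h' = -rinner f' h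

/-- The bounded operator `g` commutes with the unbounded one. -/
def CommGraph (S : H → H → Prop) (g : H →L[ℂ] H) : Prop := ∀ ⦃f f'⦄, S f f' → S (g f) (g f')

/-- Leibniz' rule `D T f = T D f + dT f`. -/
def LeibnizGraph (S : H → H → Prop) (T dT : H →L[ℂ] H) : Prop :=
  ∀ ⦃f f'⦄, S f f' → S (T f) (T f' + dT f)

/-- `K` is the commutator `[g, T] D`. -/
def CommutatorGraph (S : H → H → Prop) (g T K : H →L[ℂ] H) : Prop :=
  ∀ ⦃f f'⦄, S f f' → g (T f') = T (g f') + K f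

variable {S : H → H → Prop} {g g₁ g₂ m T T₀ dT dT₀ K K₀ K₁ : H →L[ℂ] H} {B : ℝ}

theorem norm_apply_le {A : H →L[ℂ] H} {x : H} {r : ℝ} (hA : ‖A‖ ≤ B) (hx : ‖x‖ ≤ r) :
    ‖A x‖ ≤ B * r :=
  (A.le_opNorm x).trans (mul_le_mul hA hx (norm_nonneg _) ((norm_nonneg _).trans hA))

/-- Moving the derivative across by skew-symmetry turns `(f, T g f')` into the opposite of `(f, g T
f')`, up to `dT`; exchanging `g` and `T` costs `K`. So twice the quantity is a sum of bounded terms.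
The same mechanism drives the next two lemmas. -/
theorem abs_rinner_transport_le (hS : IsSkewGraph S) (hg : IsSymm g) (hT : IsSymm T)
    (hSg : CommGraph S g) (hdT : LeibnizGraph S T dT) (hK : CommutatorGraph S g T K)
    (hB : 1 ≤ B) (hgB : ‖g‖ ≤ B) (hdTB : ‖dT‖ ≤ B) (hKB : ‖K‖ ≤ B)
    {f f' : H} (hf : S f f') :
    |rinner f (g (T f'))| ≤ B ^ 2 * ‖f‖ ^ 2 := by
  have h1 := hS (hdT hf) (hSg hf)
  have h2 : rinner f (g (T f')) = rinner f (T (g f')) + rinner f (K f) := by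
    rw [hK hf, rinner_add_right]
  have h3 : rinner (T f) (g f') = rinner f (T (g f')) := hT.rinner _ _
  have h4 : rinner (T f' + dT f) (g f) = rinner f (g (T f')) + rinner (g (dT f)) f := by
    rw [rinner_comm, rinner_add_right, rinner_comm (g f), rinner_comm (g f), ← hg.rinner,
      ← hg.rinner, rinner_comm f]
  have h5 : |rinner f (K f)| ≤ ‖f‖ * (B * ‖f‖) :=
    abs_rinner_le_of_le le_rfl (norm_apply_le hKB le_rfl)
  have h6 : |rinner (g (dT f)) f| ≤ B * (B * ‖f‖) * ‖f‖ :=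
    abs_rinner_le_of_le (norm_apply_le hgB (norm_apply_le hdTB le_rfl)) le_rfl
  have h7 : 2 * rinner f (g (T f')) = rinner f (K f) - rinner (g (dT f)) f := by linarith
  have h8 : B * ‖f‖ ^ 2 ≤ B ^ 2 * ‖f‖ ^ 2 := by
    gcongr; exact le_self_pow₀ hB (by norm_num)
  rw [abs_le] at *
  constructor <;> nlinarith

/-- Here the symbols on the two sides of `T` differ. Commuting `g₁` through `T` merges it with `m`
into the symmetric `g₂`, which reduces the claim to the plain transport term. -/
theorem abs_rinner_transport_le' (hS : IsSkewGraph S) (hg₂ : IsSymm g₂)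
    (hT : IsSymm T) (hSg₂ : CommGraph S g₂) (hSm : CommGraph S m)
    (hdT : LeibnizGraph S T dT) (hK : CommutatorGraph S g₂ T K)
    (hK₁ : CommutatorGraph S g₁ T K₁) (hgm : ∀ x, g₁ (m x) = g₂ x)
    (hB : 1 ≤ B) (hgB : ‖g₂‖ ≤ B) (hmB : ‖m‖ ≤ B) (hdTB : ‖dT‖ ≤ B) (hKB : ‖K‖ ≤ B)
    (hK₁B : ‖K₁‖ ≤ B) {f f' : H} (hf : S f f') :
    |rinner f (g₁ (T (m f')))| ≤ 2 * B ^ 2 * ‖f‖ ^ 2 := by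
  have h2 : rinner f (g₁ (T (m f'))) = rinner f (T (g₂ f')) + rinner f (K₁ (m f)) := by
    rw [hK₁ (hSm hf), rinner_add_right, hgm]
  have h3 : rinner f (T (g₂ f')) = rinner f (g₂ (T f')) - rinner f (K f) := by
    rw [hK hf, rinner_add_right]; ring
  have h4 := hS (hdT hf) (hSg₂ hf)
  have h5 : rinner (T f) (g₂ f') = rinner f (T (g₂ f')) := hT.rinner _ _
  have h6 : rinner (T f' + dT f) (g₂ f) = rinner f (g₂ (T f')) + rinner (g₂ (dT f)) f := by
    rw [rinner_comm, rinner_add_right, rinner_comm (g₂ f), rinner_comm (g₂ f), ← hg₂.rinner,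
      ← hg₂.rinner, rinner_comm f]
  have b1 : |rinner f (K₁ (m f))| ≤ ‖f‖ * (B * (B * ‖f‖)) :=
    abs_rinner_le_of_le le_rfl (norm_apply_le hK₁B (norm_apply_le hmB le_rfl))
  have b2 : |rinner f (K f)| ≤ ‖f‖ * (B * ‖f‖) :=
    abs_rinner_le_of_le le_rfl (norm_apply_le hKB le_rfl)
  have b3 : |rinner (g₂ (dT f)) f| ≤ B * (B * ‖f‖) * ‖f‖ :=
    abs_rinner_le_of_le (norm_apply_le hgB (norm_apply_le hdTB le_rfl)) le_rfl
  have h7 : 2 * rinner f (g₁ (T (m f'))) =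
      -rinner f (K f) - rinner (g₂ (dT f)) f + 2 * rinner f (K₁ (m f)) := by linarith
  have h8 : B * ‖f‖ ^ 2 ≤ B ^ 2 * ‖f‖ ^ 2 := by
    gcongr; exact le_self_pow₀ hB (by norm_num)
  rw [abs_le] at *
  constructor <;> nlinarith

/-- Transport tested against the weight `T₀` of the energy. Since `T` and `T₀` commute, both can be
moved to opposite sides, at the price of one commutator with `g₂` for each. -/
theorem abs_rinner_transport_weighted_le (hS : IsSkewGraph S) (hg₂ : IsSymm g₂)
    (hT : IsSymm T) (hT₀ : IsSymm T₀) (hTT : ∀ x, T₀ (T x) = T (T₀ x))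
    (hSg₂ : CommGraph S g₂)
    (hdT : LeibnizGraph S T dT) (hdT₀ : LeibnizGraph S T₀ dT₀) (hK : CommutatorGraph S g₂ T K)
    (hK₀ : CommutatorGraph S g₂ T₀ K₀) 
    (hB : 1 ≤ B) (hgB : ‖g₂‖ ≤ B) (hTB : ‖T‖ ≤ B) (hT₀B : ‖T₀‖ ≤ B) (hdTB : ‖dT‖ ≤ B)
    (hdT₀B : ‖dT₀‖ ≤ B) (hKB : ‖K‖ ≤ B) (hK₀B : ‖K₀‖ ≤ B) {f f' : H} (hf : S f f') :
    |rinner (g₂ (T f')) (T₀ f)| ≤ 3 * B ^ 3 * ‖f‖ ^ 2 := by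
  have e1 : rinner (g₂ (T f')) (T₀ f) = rinner (T₀ f) (T (g₂ f')) + rinner (T₀ f) (K f) := by
    rw [rinner_comm, hK hf, rinner_add_right]
  have e2 : rinner (T₀ f) (T (g₂ f')) = rinner (T f) (T₀ (g₂ f')) := by
    rw [← hT.rinner, ← hTT, hT₀.rinner]
  have e3 : rinner (T f) (T₀ (g₂ f')) = rinner (T f) (g₂ (T₀ f')) - rinner (T f) (K₀ f) := by
    rw [hK₀ hf, rinner_add_right]; ring
  have e4 := hS (hSg₂ (hdT hf)) (hdT₀ hf)
  have e5 : rinner (g₂ (T f)) (T₀ f' + dT₀ f) =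
      rinner (T f) (g₂ (T₀ f')) + rinner (g₂ (T f)) (dT₀ f) := by
    rw [rinner_add_right, hg₂.rinner]
  have e6 : rinner (g₂ (T f' + dT f)) (T₀ f) =
      rinner (g₂ (T f')) (T₀ f) + rinner (g₂ (dT f)) (T₀ f) := by
    rw [map_add, rinner_comm, rinner_add_right, rinner_comm, rinner_comm (T₀ f)]
  have e7 : 2 * rinner (g₂ (T f')) (T₀ f) = rinner (T₀ f) (K f) - rinner (T f) (K₀ f)
      - rinner (g₂ (T f)) (dT₀ f) - rinner (g₂ (dT f)) (T₀ f) := by linarith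
  have b1 : |rinner (T₀ f) (K f)| ≤ (B * ‖f‖) * (B * ‖f‖) :=
    abs_rinner_le_of_le (norm_apply_le hT₀B le_rfl) (norm_apply_le hKB le_rfl)
  have b2 : |rinner (T f) (K₀ f)| ≤ (B * ‖f‖) * (B * ‖f‖) :=
    abs_rinner_le_of_le (norm_apply_le hTB le_rfl) (norm_apply_le hK₀B le_rfl)
  have b3 : |rinner (g₂ (T f)) (dT₀ f)| ≤ (B * (B * ‖f‖)) * (B * ‖f‖) :=
    abs_rinner_le_of_le (norm_apply_le hgB (norm_apply_le hTB le_rfl))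
      (norm_apply_le hdT₀B le_rfl)
  have b4 : |rinner (g₂ (dT f)) (T₀ f)| ≤ (B * (B * ‖f‖)) * (B * ‖f‖) :=
    abs_rinner_le_of_le (norm_apply_le hgB (norm_apply_le hdTB le_rfl))
      (norm_apply_le hT₀B le_rfl)
  have h8 : B ^ 2 * ‖f‖ ^ 2 ≤ B ^ 3 * ‖f‖ ^ 2 := by
    gcongr ?_ * _
    exact pow_le_pow_right₀ hB (by norm_num)
  rw [abs_le] at *
  constructor <;> nlinarith

/-- The first term comes from the `ζ̄` part of the first equation, the second from the weight of the
energy applied to the gradient of the elevation. Their sum is an exact derivative up to `dT₀`; this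
cancellation dictates the choice of the weight. -/
theorem abs_rinner_coupling_le (hS : IsSkewGraph S) (hg₂ : IsSymm g₂) (hSg₂ : CommGraph S g₂)
    (hdT₀ : LeibnizGraph S T₀ dT₀) (hgB : ‖g₂‖ ≤ B) (hdT₀B : ‖dT₀‖ ≤ B)
    {f f' h h' : H} (hf : S f f') (hh : S h h') :
    |rinner f (g₂ (T₀ h')) + rinner (g₂ f') (T₀ h)| ≤ B ^ 2 * (‖f‖ * ‖h‖) := by
  have e1 := hS (hSg₂ hf) (hdT₀ hh)
  rw [rinner_add_right, hg₂.rinner] at e1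
  have e2 : rinner f (g₂ (T₀ h')) + rinner (g₂ f') (T₀ h) = -rinner (g₂ f) (dT₀ h) := by
    linarith
  rw [e2, abs_neg]
  refine (abs_rinner_le_of_le (norm_apply_le hgB le_rfl) (norm_apply_le hdT₀B le_rfl)).trans_eq ?_
  ring

theorem rinner_cancel (hS : IsSkewGraph S) (hg : IsSymm g) (hSg : CommGraph S g)
    {f f' h h' : H} (hf : S f f') (hh : S h h') :
    rinner f (g h') + rinner h (g f') = 0 := by
  have e1 := hS hf (hSg hh)
  rw [e1, ← hg.rinner, rinner_comm h, neg_add_cancel]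

/-- The operators that occur in the system: multiplication by symbols, multiplication by the
coefficients, their derivatives and commutators. -/
structure SystemOps (H : Type*) [NormedAddCommGroup H] [InnerProductSpace ℂ H] (ι : Type*)
    (B : ℝ) where
  S : ι → H → H → Prop
  g₁ : H →L[ℂ] H
  g₂ : H →L[ℂ] H
  m : H →L[ℂ] H
  T₀ : H →L[ℂ] H
  T : ι → H →L[ℂ] H
  dT₀ : ι → H →L[ℂ] H
  dT : ι → H →L[ℂ] H
  K₀ : ι → H →L[ℂ] H
  K₁ : ι → H →L[ℂ] H
  K₂ : ι → H →L[ℂ] H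
  C₀ : ι → H →L[ℂ] H
  C : ι → H →L[ℂ] H
  one_le : 1 ≤ B
  skew : ∀ j, IsSkewGraph (S j)
  symm₁ : IsSymm g₁
  symm₂ : IsSymm g₂
  symmT₀ : IsSymm T₀
  symmT : ∀ j, IsSymm (T j)
  comm₁ : ∀ j, CommGraph (S j) g₁
  comm₂ : ∀ j, CommGraph (S j) g₂
  commm : ∀ j, CommGraph (S j) m
  g₁_m : ∀ x, g₁ (m x) = g₂ x
  m_g₁ : ∀ x, m (g₁ x) = g₂ x
  T₀_T : ∀ j x, T₀ (T j x) = T j (T₀ x)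
  leibniz₀ : ∀ j, LeibnizGraph (S j) T₀ (dT₀ j)
  leibniz : ∀ j, LeibnizGraph (S j) (T j) (dT j)
  commutator₀ : ∀ j, CommutatorGraph (S j) g₂ T₀ (K₀ j)
  commutator₁ : ∀ j, CommutatorGraph (S j) g₁ (T j) (K₁ j)
  commutator₂ : ∀ j, CommutatorGraph (S j) g₂ (T j) (K₂ j)
  norm_g₁ : ‖g₁‖ ≤ B
  norm_g₂ : ‖g₂‖ ≤ B
  norm_m : ‖m‖ ≤ 1
  norm_T₀ : ‖T₀‖ ≤ B
  norm_T : ∀ j, ‖T j‖ ≤ B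
  norm_dT₀ : ∀ j, ‖dT₀ j‖ ≤ B
  norm_dT : ∀ j, ‖dT j‖ ≤ B
  norm_K₀ : ∀ j, ‖K₀ j‖ ≤ B
  norm_K₁ : ∀ j, ‖K₁ j‖ ≤ B
  norm_K₂ : ∀ j, ‖K₂ j‖ ≤ B
  norm_C₀ : ∀ j, ‖C₀ j‖ ≤ B
  norm_C : ∀ j, ‖C j‖ ≤ B

variable {ι : Type*} [Fintype ι]

/-- The rate of change of the energy at a fixed time. -/
theorem SystemOps.energy_rate (O : SystemOps H ι B) {ε : ℝ} (hε : 0 < ε) (hε1 : ε ≤ 1)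
    {Z Z' R₁ : H} {V V' R₂ : ι → H} {DZ : ι → H} {DV : ι → ι → H}
    (hDZ : ∀ j, O.S j Z (DZ j)) (hDV : ∀ j k, O.S j (V k) (DV j k))
    (hZ : Z' + ∑ j, ((ε : ℂ) • O.g₂ (O.T j (DZ j) + O.C j Z) + O.g₁ (DV j j) +
      (ε : ℂ) • O.g₂ (O.T₀ (O.m (DV j j)) + O.C₀ j (O.m (V j)))) = (ε : ℂ) • R₁)
    (hV : ∀ k, V' k + (O.g₁ (DZ k) + ∑ j, (ε : ℂ) • O.g₁ (O.T j (O.m (DV j k)) +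
      O.C j (O.m (V k)))) = (ε : ℂ) • R₂ k) :
    rinner Z Z' + ∑ k, rinner (V k) (V' k) + ε * ∑ k, rinner (O.m (V' k)) (O.T₀ (O.m (V k))) ≤
      ε * (10 * (1 + Fintype.card ι) * B ^ 3) * (‖Z‖ ^ 2 + ∑ k, ‖V k‖ ^ 2) +
      ε * (2 * B) * (‖Z‖ * ‖R₁‖ + ∑ k, ‖V k‖ * ‖R₂ k‖) := by
  set n : ℝ := (Fintype.card ι : ℝ) with hn_def
  have hB := O.one_le
  have hB0 : 0 ≤ B := by linarith
  have hB2 : B ^ 2 ≤ B ^ 3 := pow_le_pow_right₀ hB (by norm_num)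
  have hmB : ‖O.m‖ ≤ B := O.norm_m.trans hB
  have hP : ∀ k, ‖O.m (V k)‖ ≤ ‖V k‖ := fun k ↦ by
    simpa using norm_apply_le O.norm_m (le_refl ‖V k‖)
  have hZ' : rinner Z Z' = ε * rinner Z R₁ - ∑ k, (ε * (rinner Z (O.g₂ (O.T k (DZ k))) +
      rinner Z (O.g₂ (O.C k Z))) + rinner Z (O.g₁ (DV k k)) +
      ε * (rinner Z (O.g₂ (O.T₀ (O.m (DV k k)))) + rinner Z (O.g₂ (O.C₀ k (O.m (V k)))))) := by
    rw [eq_sub_of_add_eq hZ, rinner_sub_right, rinner_smul_right, rinner_sum_right]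
    simp only [rinner_add_right, rinner_smul_right, map_add]
  have hV' : ∀ k, rinner (V k) (V' k) = ε * rinner (V k) (R₂ k) - (rinner (V k) (O.g₁ (DZ k)) +
      ε * ∑ j, (rinner (V k) (O.g₁ (O.T j (O.m (DV j k)))) +
        rinner (V k) (O.g₁ (O.C j (O.m (V k)))))) := fun k ↦ by
    rw [eq_sub_of_add_eq (hV k), rinner_sub_right, rinner_smul_right, rinner_add_right,
      rinner_sum_right, Finset.mul_sum]
    simp only [rinner_add_right, rinner_smul_right, map_add]
  -- The energy weight sees the velocity through `m`; the relation `m g₁ = g₂` is what makes the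
  -- elevation gradient appear with `g₂`, as the coupling cancellation requires.
  have hP' : ∀ k, rinner (O.m (V' k)) (O.T₀ (O.m (V k))) =
      ε * rinner (O.m (R₂ k)) (O.T₀ (O.m (V k))) -
      (rinner (O.g₂ (DZ k)) (O.T₀ (O.m (V k))) +
      ε * ∑ j, (rinner (O.g₂ (O.T j (O.m (DV j k)))) (O.T₀ (O.m (V k))) +
        rinner (O.g₂ (O.C j (O.m (V k)))) (O.T₀ (O.m (V k))))) := fun k ↦ by
    rw [eq_sub_of_add_eq (hV k)]
    simp only [map_sub, map_add, map_sum, map_smul, O.m_g₁]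
    rw [rinner_comm, rinner_sub_right, rinner_smul_right, rinner_add_right, rinner_sum_right,
      Finset.mul_sum]
    simp only [rinner_add_right, rinner_smul_right]
    simp only [rinner_comm (O.T₀ (O.m (V k)))]
  -- The `k`-th summand of the first equation is grouped with the `k`-th velocity equation, so that
  -- the cancellations happen for each `k` separately.
  have bound : ∀ k, -(ε * (rinner Z (O.g₂ (O.T k (DZ k))) +
      rinner Z (O.g₂ (O.C k Z))) + rinner Z (O.g₁ (DV k k)) +
      ε * (rinner Z (O.g₂ (O.T₀ (O.m (DV k k)))) + rinner Z (O.g₂ (O.C₀ k (O.m (V k)))))) +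
      rinner (V k) (V' k) + ε * rinner (O.m (V' k)) (O.T₀ (O.m (V k))) ≤
      ε * (3 * B ^ 3 * ‖Z‖ ^ 2 + (1 + 7 * n) * B ^ 3 * ‖V k‖ ^ 2) +
        ε * (2 * B) * (‖V k‖ * ‖R₂ k‖) := by
    intro k
    rw [hV', hP']
    have t1 := abs_rinner_transport_le (O.skew k) O.symm₂ (O.symmT k) (O.comm₂ k) (O.leibniz k)
      (O.commutator₂ k) hB O.norm_g₂ (O.norm_dT k) (O.norm_K₂ k) (hDZ k)
    have t2 : |rinner Z (O.g₂ (O.C k Z))| ≤ ‖Z‖ * (B * (B * ‖Z‖)) :=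
      abs_rinner_le_of_le le_rfl (norm_apply_le O.norm_g₂ (norm_apply_le (O.norm_C k) le_rfl))
    have t3 := rinner_cancel (O.skew k) O.symm₁ (O.comm₁ k) (hDZ k) (hDV k k)
    have t4 := abs_rinner_coupling_le (O.skew k) O.symm₂ (O.comm₂ k) (O.leibniz₀ k) O.norm_g₂
      (O.norm_dT₀ k) (hDZ k) (O.commm k (hDV k k))
    have t5 : |rinner Z (O.g₂ (O.C₀ k (O.m (V k))))| ≤ ‖Z‖ * (B * (B * ‖V k‖)) :=
      abs_rinner_le_of_le le_rfl (norm_apply_le O.norm_g₂ (norm_apply_le (O.norm_C₀ k) (hP k)))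
    have t6 : |rinner (O.m (R₂ k)) (O.T₀ (O.m (V k)))| ≤ (1 * ‖R₂ k‖) * (B * ‖V k‖) :=
      abs_rinner_le_of_le (norm_apply_le O.norm_m le_rfl) (norm_apply_le O.norm_T₀ (hP k))
    have t7 : |rinner (V k) (R₂ k)| ≤ ‖V k‖ * ‖R₂ k‖ := abs_rinner_le _ _
    have t8 : |∑ j, (rinner (V k) (O.g₁ (O.T j (O.m (DV j k)))) +
        rinner (V k) (O.g₁ (O.C j (O.m (V k)))))| ≤ n * (3 * B ^ 3 * ‖V k‖ ^ 2) := by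
      refine (Finset.abs_sum_le_sum_abs _ _).trans ((Finset.sum_le_card_nsmul _ _ _
        fun j _ ↦ ?_).trans_eq (by rw [nsmul_eq_mul]; rfl))
      have u1 := abs_rinner_transport_le' (O.skew j) O.symm₂ (O.symmT j) (O.comm₂ j) (O.commm j)
        (O.leibniz j) (O.commutator₂ j) (O.commutator₁ j) O.g₁_m hB O.norm_g₂ hmB
        (O.norm_dT j) (O.norm_K₂ j) (O.norm_K₁ j) (hDV j k)
      have u2 : |rinner (V k) (O.g₁ (O.C j (O.m (V k))))| ≤ ‖V k‖ * (B * (B * ‖V k‖)) :=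
        abs_rinner_le_of_le le_rfl (norm_apply_le O.norm_g₁ (norm_apply_le (O.norm_C j) (hP k)))
      have u3 : B ^ 2 * ‖V k‖ ^ 2 ≤ B ^ 3 * ‖V k‖ ^ 2 := by gcongr
      refine (abs_add_le _ _).trans ?_
      nlinarith
    have t9 : |∑ j, (rinner (O.g₂ (O.T j (O.m (DV j k)))) (O.T₀ (O.m (V k))) +
        rinner (O.g₂ (O.C j (O.m (V k)))) (O.T₀ (O.m (V k))))| ≤
        n * (4 * B ^ 3 * ‖V k‖ ^ 2) := by
      refine (Finset.abs_sum_le_sum_abs _ _).trans ((Finset.sum_le_card_nsmul _ _ _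
        fun j _ ↦ ?_).trans_eq (by rw [nsmul_eq_mul]; rfl))
      have u1 := abs_rinner_transport_weighted_le (O.skew j) O.symm₂ (O.symmT j) O.symmT₀
        (O.T₀_T j) (O.comm₂ j) (O.leibniz j) (O.leibniz₀ j) (O.commutator₂ j) (O.commutator₀ j)
        hB O.norm_g₂ (O.norm_T j) O.norm_T₀ (O.norm_dT j) (O.norm_dT₀ j) (O.norm_K₂ j)
        (O.norm_K₀ j) (O.commm j (hDV j k))
      have u2 : |rinner (O.g₂ (O.C j (O.m (V k)))) (O.T₀ (O.m (V k)))| ≤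
          (B * (B * ‖V k‖)) * (B * ‖V k‖) :=
        abs_rinner_le_of_le (norm_apply_le O.norm_g₂ (norm_apply_le (O.norm_C j) (hP k)))
          (norm_apply_le O.norm_T₀ (hP k))
      have u3 : 3 * B ^ 3 * ‖O.m (V k)‖ ^ 2 ≤ 3 * B ^ 3 * ‖V k‖ ^ 2 := by
        gcongr; exact hP k
      refine (abs_add_le _ _).trans ?_
      nlinarith
    have t10 : ‖Z‖ * ‖V k‖ ≤ (‖Z‖ ^ 2 + ‖V k‖ ^ 2) / 2 := by
      nlinarith [sq_nonneg (‖Z‖ - ‖V k‖)]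
    have t4' : |rinner Z (O.g₂ (O.T₀ (O.m (DV k k)))) + rinner (O.g₂ (DZ k)) (O.T₀ (O.m (V k)))|
        ≤ B ^ 2 * (‖Z‖ * ‖V k‖) := t4.trans (by gcongr; exact hP k)
    set r1 := rinner Z (O.g₂ (O.T k (DZ k)))
    set r2 := rinner Z (O.g₂ (O.C k Z))
    set r3 := rinner Z (O.g₁ (DV k k))
    set r3' := rinner (V k) (O.g₁ (DZ k))
    set r4 := rinner Z (O.g₂ (O.T₀ (O.m (DV k k))))
    set r4' := rinner (O.g₂ (DZ k)) (O.T₀ (O.m (V k)))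
    set r5 := rinner Z (O.g₂ (O.C₀ k (O.m (V k))))
    set r6 := rinner (O.m (R₂ k)) (O.T₀ (O.m (V k)))
    set r7 := rinner (V k) (R₂ k)
    set r8 := ∑ j, (rinner (V k) (O.g₁ (O.T j (O.m (DV j k)))) +
        rinner (V k) (O.g₁ (O.C j (O.m (V k)))))
    set r9 := ∑ j, (rinner (O.g₂ (O.T j (O.m (DV j k)))) (O.T₀ (O.m (V k))) +
        rinner (O.g₂ (O.C j (O.m (V k)))) (O.T₀ (O.m (V k))))
    -- The terms `r3`, `r3'` are the only ones without a factor `ε`, and they cancel by `t3`.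
    have e : -(ε * (r1 + r2) + r3 + ε * (r4 + r5)) + (ε * r7 - (r3' + ε * r8)) +
        ε * (ε * r6 - (r4' + ε * r9)) =
        ε * (-r1 - r2 - (r4 + r4') - r5 - r8 + r7) + ε * (ε * (r6 - r9)) := by
      linear_combination -t3
    rw [e]
    -- The contributions of order `ε²` come from the weight; one of the two factors is discarded
    -- using `ε ≤ 1`.
    have t11 : ε * (r6 - r9) ≤ |r6| + |r9| := by
      have h1 : r6 - r9 ≤ |r6| + |r9| := by linarith [le_abs_self r6, neg_abs_le r9]
      calc ε * (r6 - r9) ≤ ε * (|r6| + |r9|) := by gcongr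
        _ ≤ 1 * (|r6| + |r9|) := by gcongr
        _ = _ := one_mul _
    have t12 : -r1 - r2 - (r4 + r4') - r5 - r8 + r7 ≤
        |r1| + |r2| + |r4 + r4'| + |r5| + |r8| + |r7| := by
      linarith [neg_abs_le r1, neg_abs_le r2, neg_abs_le (r4 + r4'), neg_abs_le r5, neg_abs_le r8,
        le_abs_self r7]
    have t13 : B ^ 2 * (‖Z‖ ^ 2) ≤ B ^ 3 * ‖Z‖ ^ 2 := by gcongr
    have t14 : B ^ 2 * (‖Z‖ * ‖V k‖) ≤ B ^ 3 * ((‖Z‖ ^ 2 + ‖V k‖ ^ 2) / 2) := by gcongr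
    have t15 : ‖V k‖ * ‖R₂ k‖ ≤ B * (‖V k‖ * ‖R₂ k‖) :=
      le_mul_of_one_le_left (by positivity) hB
    rw [← mul_add, mul_assoc ε (2 * B), ← mul_add]
    refine mul_le_mul_of_nonneg_left ?_ hε.le
    linarith
  have hR : rinner Z R₁ ≤ 2 * B * (‖Z‖ * ‖R₁‖) := by
    refine (le_abs_self _).trans ((abs_rinner_le _ _).trans ?_)
    exact le_mul_of_one_le_left (by positivity) (by linarith)
  have hsum := Finset.sum_le_sum fun k (_ : k ∈ Finset.univ) ↦ bound k
  simp only [Finset.sum_add_distrib, Finset.sum_neg_distrib, ← Finset.mul_sum,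
    Finset.sum_const, nsmul_eq_mul] at hsum hZ'
  rw [hZ']
  have hn : (0 : ℝ) ≤ n := Nat.cast_nonneg _
  have hV0 : 0 ≤ ∑ k, ‖V k‖ ^ 2 := Finset.sum_nonneg fun k _ ↦ sq_nonneg _
  have f1 : (Finset.univ : Finset ι).card = n := rfl
  have f2 : ε * rinner Z R₁ ≤ ε * (2 * B * (‖Z‖ * ‖R₁‖)) := by gcongr
  have f3 : ε * (n * (3 * B ^ 3 * ‖Z‖ ^ 2) + (1 + 7 * n) * B ^ 3 * ∑ k, ‖V k‖ ^ 2) ≤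
      ε * (10 * (1 + n) * B ^ 3) * (‖Z‖ ^ 2 + ∑ k, ‖V k‖ ^ 2) := by
    have : 0 ≤ B ^ 3 := by positivity
    have g1 : 0 ≤ B ^ 3 * ‖Z‖ ^ 2 := by positivity
    have g2 : 0 ≤ B ^ 3 * ∑ k, ‖V k‖ ^ 2 := by positivity
    rw [mul_assoc ε]
    gcongr
    nlinarith [mul_nonneg hn g1, mul_nonneg hn g2]
  rw [f1] at hsum
  linarith

end HilbertEnergy

/-! ### Symbols and kernels as bounded operators on L² -/

section L2Operators

variable {d : ℕ}

/-- The space of complex square integrable functions. -/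
abbrev L2 (d : ℕ) := Lp ℂ 2 (volume : Measure (Space d))

/-- An operation on functions that induces a bounded operator on `L²`. -/
structure L2Bounded (Φ : (Space d → ℂ) → Space d → ℂ) (K : ℝ) : Prop where
  nonneg : 0 ≤ K
  memLp : ∀ f, MemLp f 2 volume → MemLp (Φ f) 2 volume
  norm_le : ∀ f, MemLp f 2 volume →
    eLpNorm (Φ f) 2 volume ≤ ENNReal.ofReal K * eLpNorm f 2 volume
  congr : ∀ f g : Space d → ℂ, f =ᵐ[volume] g → Φ f =ᵐ[volume] Φ g
  add : ∀ f g, MemLp f 2 volume → MemLp g 2 volume → Φ (f + g) =ᵐ[volume] Φ f + Φ g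
  smul : ∀ (c : ℂ) (f), Φ (c • f) =ᵐ[volume] c • Φ f

variable {Φ : (Space d → ℂ) → Space d → ℂ} {K : ℝ}

/-- The induced bounded operator. -/
def L2Bounded.clm (h : L2Bounded Φ K) : L2 d →L[ℂ] L2 d :=
  LinearMap.mkContinuous
    { toFun := fun f ↦ (h.memLp f (Lp.memLp f)).toLp
      map_add' := fun f g ↦ by
        rw [← MemLp.toLp_add]
        exact MemLp.toLp_congr _ _ ((h.congr _ _ (Lp.coeFn_add f g)).trans
          (h.add _ _ (Lp.memLp f) (Lp.memLp g)))
      map_smul' := fun c f ↦ by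
        exact (MemLp.toLp_congr (h.memLp _ (Lp.memLp (c • f))) ((h.memLp f (Lp.memLp f)).const_smul c)
          ((h.congr _ _ (Lp.coeFn_smul c f)).trans (h.smul _ _))).trans
          (MemLp.toLp_const_smul c (h.memLp f (Lp.memLp f))) }
    K fun f ↦ by
      change ‖MemLp.toLp (Φ f) (h.memLp f (Lp.memLp f))‖ ≤ _
      rw [Lp.norm_toLp]
      rw [Lp.norm_def, ← ENNReal.toReal_ofReal h.nonneg, ← ENNReal.toReal_mul]
      exact ENNReal.toReal_mono (ENNReal.mul_ne_top ENNReal.ofReal_ne_top (Lp.memLp f).2.ne)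
        (h.norm_le _ (Lp.memLp f))

theorem L2Bounded.coeFn (h : L2Bounded Φ K) (f : L2 d) : h.clm f =ᵐ[volume] Φ f :=
  MemLp.coeFn_toLp (h.memLp f (Lp.memLp f))

theorem L2Bounded.norm_clm_le (h : L2Bounded Φ K) : ‖h.clm‖ ≤ K :=
  LinearMap.mkContinuous_norm_le _ h.nonneg _

/-- Multiplication by a real symbol. -/
def mulOp (φ : Space d → ℝ) (f : Space d → ℂ) (ξ : Space d) : ℂ := (φ ξ : ℂ) * f ξ

/-- `φ` is a measurable symbol bounded by `C`. -/
structure BddSymbol (φ : Space d → ℝ) (C : ℝ) : Prop where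
  meas : AEStronglyMeasurable φ volume
  bound : ∀ᵐ ξ, |φ ξ| ≤ C

theorem BddSymbol.l2Bounded {φ : Space d → ℝ} {C : ℝ} (h : BddSymbol φ C) :
    L2Bounded (mulOp φ) C := by
  have hC : 0 ≤ C := by
    obtain ⟨ξ, hξ⟩ := h.bound.exists
    exact (abs_nonneg _).trans hξ
  have hb : ∀ f : Space d → ℂ,
      eLpNorm (mulOp φ f) 2 volume ≤ ENNReal.ofReal C * eLpNorm f 2 volume := by
    intro f
    refine (eLpNorm_le_nnreal_smul_eLpNorm_of_ae_le_mul' (c := C.toNNReal) ?_ 2).trans_eq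
      (by rw [ENNReal.smul_def]; rfl)
    filter_upwards [h.bound] with ξ hξ
    rw [mulOp, enorm_mul]
    gcongr
    rw [← ofReal_norm, Complex.norm_real]
    exact ENNReal.ofReal_le_ofReal hξ
  refine ⟨hC, fun f hf ↦ ⟨?_, (hb f).trans_lt (ENNReal.mul_lt_top ENNReal.ofReal_lt_top hf.2)⟩,
    fun f _ ↦ hb f, fun f g hfg ↦ ?_, fun f g _ _ ↦ ?_, fun c f ↦ ?_⟩
  · exact (Complex.continuous_ofReal.comp_aestronglyMeasurable h.meas).mul hf.1
  · filter_upwards [hfg] with ξ hξ using by simp [mulOp, hξ]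
  · exact Filter.Eventually.of_forall fun ξ ↦ by simp [mulOp, mul_add]
  · exact Filter.Eventually.of_forall fun ξ ↦ by simp [mulOp]; ring

/-- The weighted norm of a coefficient. -/
def wnorm (σ : ℝ) (a : Space d → ℂ) : ℝ :=
  (eLpNorm (fun ξ ↦ ((jb ξ ^ σ : ℝ) : ℂ) * a ξ) 2 volume).toReal

theorem wnorm_nonneg (σ : ℝ) (a : Space d → ℂ) : 0 ≤ wnorm σ a := ENNReal.toReal_nonneg

theorem kerOp_congr_coef {k : Space d → Space d → ℂ} {a a' : Space d → ℂ} (h : a =ᵐ[volume] a')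
    (f : Space d → ℂ) : kerOp k a f = kerOp k a' f := by
  funext ξ
  refine integral_congr_ae ?_
  filter_upwards [(quasiMeasurePreserving_sub_left volume ξ).ae h] with η hη
  rw [hη]

theorem kerOp_congr {k : Space d → Space d → ℂ} {a f g : Space d → ℂ} (h : f =ᵐ[volume] g) :
    kerOp k a f = kerOp k a g := by
  funext ξ
  refine integral_congr_ae ?_
  filter_upwards [h] with η hη
  rw [hη]

variable {t₀ σ C : ℝ} {k : Space d → Space d → ℂ} {a : Space d → ℂ}

theorem KerBound.l2Bounded (ht₀ : (d : ℝ) / 2 < t₀) (hk : KerBound t₀ σ C k) (ha : MemW σ a) :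
    L2Bounded (kerOp k a) (2 * C * weightNorm d t₀ * wnorm σ a) := by
  have h0 : 0 ≤ 2 * C * weightNorm d t₀ :=
    mul_nonneg (mul_nonneg zero_le_two hk.nonneg) (weightNorm_nonneg _)
  refine ⟨mul_nonneg h0 (wnorm_nonneg _ _), fun f hf ↦ hk.memLp_kerOp ht₀ ha hf, fun f hf ↦ ?_,
    fun f g hfg ↦ (kerOp_congr hfg).eventuallyEq, fun f g hf hg ↦ ?_, fun c f ↦ ?_⟩
  · rw [ENNReal.ofReal_mul h0, wnorm, ENNReal.ofReal_toReal ha.2.ne]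
    exact hk.eLpNorm_kerOp_le ht₀ ha hf
  · filter_upwards [hk.ae_integrable ht₀ ha hf, hk.ae_integrable ht₀ ha hg] with ξ h1 h2
    simp only [kerOp, Pi.add_apply, mul_add]
    exact integral_add h1 h2
  · refine Filter.Eventually.of_forall fun ξ ↦ ?_
    simp only [kerOp, Pi.smul_apply, smul_eq_mul]
    rw [← integral_const_mul]
    congr 1
    funext η
    ring

/-- Removing the weight. -/
def unweight (σ : ℝ) (A : Space d → ℂ) (ξ : Space d) : ℂ := ((jb ξ ^ (-σ) : ℝ) : ℂ) * A ξ

theorem ofReal_jb_rpow_mul (σ τ : ℝ) (ξ : Space d) (z : ℂ) :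
    ((jb ξ ^ σ : ℝ) : ℂ) * (((jb ξ ^ τ : ℝ) : ℂ) * z) = ((jb ξ ^ (σ + τ) : ℝ) : ℂ) * z := by
  rw [← mul_assoc, ← Complex.ofReal_mul, ← Real.rpow_add (jb_pos ξ)]

theorem weight_unweight (σ : ℝ) (A : Space d → ℂ) :
    (fun ξ ↦ ((jb ξ ^ σ : ℝ) : ℂ) * unweight σ A ξ) = A := by
  funext ξ
  rw [unweight, ofReal_jb_rpow_mul, add_neg_cancel]
  simp

theorem memW_unweight {A : Space d → ℂ} (hA : MemLp A 2 volume) : MemW σ (unweight σ A) := by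
  rwa [MemW, weight_unweight]

/-- The constant kernel gives plain convolution, that is, multiplication by the coefficient in
physical variables. -/
theorem kerBound_one (hσ : t₀ ≤ σ) : KerBound t₀ σ 1 (fun _ _ : Space d ↦ 1) where
  nonneg := zero_le_one
  meas := aestronglyMeasurable_const
  bound := Filter.Eventually.of_forall fun z ↦ by
    simpa [kerWeight] using one_le_rpow_mul_add (one_le_jb (z.1 - z.2)) (one_le_jb z.2) hσ

theorem ae_integrable_conv (ht₀ : (d : ℝ) / 2 < t₀) (hσ : t₀ ≤ σ) (ha : MemW σ a)
    {f : Space d → ℂ} (hf : MemLp f 2 volume) :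
    ∀ᵐ ξ, Integrable (fun η ↦ a (ξ - η) * f η) volume := by
  simpa using (kerBound_one hσ).ae_integrable ht₀ ha hf

/-- The convolution with `⟨·⟩^{-t₀} A`, as a bounded bilinear map in `A` and the function. -/
def convBilin (ht₀ : (d : ℝ) / 2 < t₀) : L2 d →L[ℂ] L2 d →L[ℂ] L2 d :=
  LinearMap.mkContinuous
    { toFun := fun A ↦ ((kerBound_one le_rfl).l2Bounded ht₀ (memW_unweight (σ := t₀)
        (Lp.memLp A))).clm
      map_add' := fun A A' ↦ by
        ext1 f
        rw [add_apply]
        refine Lp.ext ?_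
        have i1 := ae_integrable_conv ht₀ le_rfl (memW_unweight (σ := t₀) (Lp.memLp A))
          (Lp.memLp f)
        have i2 := ae_integrable_conv ht₀ le_rfl (memW_unweight (σ := t₀) (Lp.memLp A'))
          (Lp.memLp f)
        refine (L2Bounded.coeFn _ f).trans (Filter.EventuallyEq.trans ?_ (Lp.coeFn_add _ _).symm)
        filter_upwards [L2Bounded.coeFn ((kerBound_one le_rfl).l2Bounded ht₀
          (memW_unweight (σ := t₀) (Lp.memLp A))) f, L2Bounded.coeFn
          ((kerBound_one le_rfl).l2Bounded ht₀ (memW_unweight (σ := t₀) (Lp.memLp A'))) f, i1, i2]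
          with ξ h1 h2 h3 h4
        rw [Pi.add_apply, h1, h2]
        have h5 : unweight t₀ (A + A' : L2 d) =ᵐ[volume] unweight t₀ A + unweight t₀ A' := by
          filter_upwards [Lp.coeFn_add A A'] with ξ hξ
          simp only [unweight, Pi.add_apply] at hξ ⊢
          rw [hξ, mul_add]
        rw [kerOp_congr_coef h5]
        simp only [kerOp, one_mul, Pi.add_apply, add_mul]
        exact integral_add h3 h4
      map_smul' := fun c A ↦ by
        ext1 f
        rw [RingHom.id_apply, smul_apply]
        refine Lp.ext ?_
        refine (L2Bounded.coeFn _ f).trans (Filter.EventuallyEq.trans ?_ (Lp.coeFn_smul _ _).symm)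
        filter_upwards [L2Bounded.coeFn ((kerBound_one le_rfl).l2Bounded ht₀
          (memW_unweight (σ := t₀) (Lp.memLp A))) f] with ξ h1
        rw [Pi.smul_apply, h1]
        have h5 : unweight t₀ (c • A : L2 d) =ᵐ[volume] c • unweight t₀ A := by
          filter_upwards [Lp.coeFn_smul c A] with ξ hξ
          simp only [unweight, Pi.smul_apply, smul_eq_mul] at hξ ⊢
          rw [hξ]
          ring
        rw [kerOp_congr_coef h5]
        simp only [kerOp, one_mul, Pi.smul_apply, smul_eq_mul]
        rw [← integral_const_mul]
        congr 1
        funext η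
        ring }
    (2 * weightNorm d t₀) fun A ↦ by
      change ‖((kerBound_one le_rfl).l2Bounded ht₀ (memW_unweight (σ := t₀)
        (Lp.memLp A))).clm‖ ≤ _
      refine (L2Bounded.norm_clm_le _).trans_eq ?_
      rw [wnorm, weight_unweight, Lp.norm_def, mul_one]

theorem coeFn_convBilin (ht₀ : (d : ℝ) / 2 < t₀) (A f : L2 d) :
    convBilin ht₀ A f =ᵐ[volume] kerOp (fun _ _ ↦ 1) (unweight t₀ A) f :=
  L2Bounded.coeFn ((kerBound_one le_rfl).l2Bounded ht₀ (memW_unweight (Lp.memLp A))) f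

theorem norm_convBilin_apply_le (ht₀ : (d : ℝ) / 2 < t₀) (A : L2 d) :
    ‖convBilin ht₀ A‖ ≤ 2 * weightNorm d t₀ * ‖A‖ := by
  refine (ContinuousLinearMap.le_opNorm _ _).trans ?_
  gcongr
  exact LinearMap.mkContinuous_norm_le _ (mul_nonneg zero_le_two (weightNorm_nonneg _)) _

end L2Operators

/-! ### Leibniz and commutator rules on the Fourier side -/

section ConcreteRules

variable {d : ℕ} {t₀ σ s C M : ℝ} {a : Space d → ℂ} {φ ψ : Space d → ℝ}

/-- The graph of the multiplication by `2πiξ_j`, that is of `∂_j` on the Fourier side. -/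
def derivGraph (j : Fin d) (f f' : L2 d) : Prop := f' =ᵐ[volume] fun ξ ↦ dsym j ξ * f ξ

theorem inner_eq_integral (f g : L2 d) :
    inner ℂ f g = ∫ ξ, g ξ * (starRingEnd ℂ) (f ξ) := by
  rw [L2.inner_def]
  simp [RCLike.inner_apply]

/-- The symbol of `∂_j` is purely imaginary. -/
theorem isSkewGraph_derivGraph (j : Fin d) : IsSkewGraph (derivGraph j) := by
  intro f f' h h' hf hh
  rw [rinner, rinner, ← Complex.neg_re, inner_eq_integral, inner_eq_integral, ← integral_neg]
  congr 1
  refine integral_congr_ae ?_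
  filter_upwards [hf, hh] with ξ h1 h2
  rw [h1, h2, map_mul, conj_dsym]
  ring

theorem BddSymbol.coeFn (h : BddSymbol φ C) (f : L2 d) :
    h.l2Bounded.clm f =ᵐ[volume] fun ξ ↦ (φ ξ : ℂ) * f ξ :=
  h.l2Bounded.coeFn f

theorem BddSymbol.isSymm (h : BddSymbol φ C) : IsSymm h.l2Bounded.clm := by
  intro f g
  rw [inner_eq_integral, inner_eq_integral]
  refine integral_congr_ae ?_
  filter_upwards [h.coeFn f, h.coeFn g] with ξ h1 h2
  rw [h1, h2, map_mul, Complex.conj_ofReal]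
  ring

theorem BddSymbol.commGraph (h : BddSymbol φ C) (j : Fin d) :
    CommGraph (derivGraph j) h.l2Bounded.clm := by
  intro f f' hf
  filter_upwards [h.coeFn f, h.coeFn f', hf] with ξ h1 h2 h3
  rw [h1, h2, h3]
  ring

theorem BddSymbol.clm_clm {C' C'' : ℝ} {χ : Space d → ℝ} (h : BddSymbol φ C)
    (h' : BddSymbol ψ C') (h'' : BddSymbol χ C'') (hχ : ∀ ξ, φ ξ * ψ ξ = χ ξ) (f : L2 d) :
    h.l2Bounded.clm (h'.l2Bounded.clm f) = h''.l2Bounded.clm f := by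
  refine Lp.ext ?_
  filter_upwards [h.coeFn (h'.l2Bounded.clm f), h'.coeFn f, h''.coeFn f] with ξ h1 h2 h3
  rw [h1, h2, h3, ← hχ, Complex.ofReal_mul]
  ring

/-- A derivative of the coefficient costs `⟨ξ-η⟩`, which is affordable once the coefficient has `t₀
+ 1` derivatives. -/
theorem kerBound_dsym (hσ : t₀ + 1 ≤ σ) (j : Fin d) :
    KerBound t₀ σ 1 (fun ξ η : Space d ↦ dsym j (ξ - η)) where
  nonneg := zero_le_one
  meas := ((continuous_dsym j).comp (continuous_fst.sub continuous_snd)).aestronglyMeasurable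
  bound := Filter.Eventually.of_forall fun z ↦ by
    rw [one_mul]
    exact (norm_dsym_le j _).trans
      (le_rpow_mul_add (one_le_jb (z.1 - z.2)) (one_le_jb z.2) hσ)

/-- The multiplication on the Fourier side by the coefficient with Fourier transform `a`. -/
def coefOp (ht₀ : (d : ℝ) / 2 < t₀) (hσ : t₀ ≤ σ) (ha : MemW σ a) : L2 d →L[ℂ] L2 d :=
  ((kerBound_one hσ).l2Bounded ht₀ ha).clm

theorem coeFn_coefOp (ht₀ : (d : ℝ) / 2 < t₀) (hσ : t₀ ≤ σ) (ha : MemW σ a) (f : L2 d) :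
    coefOp ht₀ hσ ha f =ᵐ[volume] fun ξ ↦ ∫ η, a (ξ - η) * f η := by
  refine (L2Bounded.coeFn _ f).trans (Filter.Eventually.of_forall fun ξ ↦ ?_)
  simp [kerOp]

/-- Under the convolution integral the symbol of `∂_j` is additive: `ξ = (ξ-η) + η`. -/
theorem leibnizGraph_coefOp (ht₀ : (d : ℝ) / 2 < t₀) (hσ : t₀ + 1 ≤ σ) (ha : MemW σ a)
    (j : Fin d) :
    LeibnizGraph (derivGraph j) (coefOp ht₀ (by linarith : t₀ ≤ σ) ha)
      ((kerBound_dsym hσ j).l2Bounded ht₀ ha).clm := by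
  intro f f' hf
  have hσ' : t₀ ≤ σ := by linarith
  refine (Lp.coeFn_add _ _).trans ?_
  filter_upwards [coeFn_coefOp ht₀ hσ' ha f, coeFn_coefOp ht₀ hσ' ha f',
    L2Bounded.coeFn ((kerBound_dsym hσ j).l2Bounded ht₀ ha) f,
    ae_integrable_conv ht₀ hσ' ha (Lp.memLp f'),
    (kerBound_dsym hσ j).ae_integrable ht₀ ha (Lp.memLp f)] with ξ h1 h2 h3 h4 h5
  rw [Pi.add_apply, h1, h2, h3, kerOp, ← integral_add h4 h5, ← integral_const_mul]
  refine integral_congr_ae ?_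
  filter_upwards [hf] with η h6
  rw [h6, dsym_sub]
  ring

/-- The kernel of the commutator of a symbol and a coefficient, composed with `∂_j`. -/
def commKer (φ : Space d → ℝ) (j : Fin d) (ξ η : Space d) : ℂ :=
  ((φ ξ - φ η : ℝ) : ℂ) * dsym j η

/-- The increment of `φ` gains exactly the factor `⟨η⟩` lost to the derivative, and leaves one power
of `⟨ξ-η⟩` to be carried by the coefficient. -/
theorem kerBound_commKer (hσ : t₀ + 1 ≤ σ) (hM : 0 ≤ M) (hφ : AEStronglyMeasurable φ volume)
    (hS : ∃ S : Set (Space d), (∀ᵐ ξ, ξ ∈ S) ∧ ∀ ξ ∈ S, ∀ η ∈ S,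
      |φ ξ - φ η| * jb η ≤ 4 * M * jb (ξ - η)) (j : Fin d) :
    KerBound t₀ σ (4 * M) (commKer φ j) where
  nonneg := by positivity
  meas := (Complex.continuous_ofReal.comp_aestronglyMeasurable
    (hφ.comp_fst.sub hφ.comp_snd)).mul
      ((continuous_dsym j).comp continuous_snd).aestronglyMeasurable
  bound := by
    obtain ⟨S, hS, hS'⟩ := hS
    filter_upwards [Measure.quasiMeasurePreserving_fst.ae hS,
      Measure.quasiMeasurePreserving_snd.ae hS] with z h1 h2
    rw [commKer, norm_mul, Complex.norm_real, Real.norm_eq_abs]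
    calc |φ z.1 - φ z.2| * ‖dsym j z.2‖ ≤ |φ z.1 - φ z.2| * jb z.2 := by
          gcongr; exact norm_dsym_le j _
      _ ≤ 4 * M * jb (z.1 - z.2) := hS' _ h1 _ h2
      _ ≤ 4 * M * kerWeight t₀ σ z.1 z.2 := by
          gcongr
          exact le_rpow_mul_add (one_le_jb (z.1 - z.2)) (one_le_jb z.2) hσ

theorem commutatorGraph_commKer (ht₀ : (d : ℝ) / 2 < t₀) (hσ : t₀ ≤ σ) (ha : MemW σ a)
    (hφ : BddSymbol φ C) {j : Fin d} {C' : ℝ} (hk : KerBound t₀ σ C' (commKer φ j)) :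
    CommutatorGraph (derivGraph j) hφ.l2Bounded.clm (coefOp ht₀ hσ ha)
      (hk.l2Bounded ht₀ ha).clm := by
  intro f f' hf
  refine Lp.ext (Filter.EventuallyEq.trans ?_ (Lp.coeFn_add _ _).symm)
  filter_upwards [hφ.coeFn (coefOp ht₀ hσ ha f'), coeFn_coefOp ht₀ hσ ha f',
    coeFn_coefOp ht₀ hσ ha (hφ.l2Bounded.clm f'), L2Bounded.coeFn (hk.l2Bounded ht₀ ha) f,
    ae_integrable_conv ht₀ hσ ha (Lp.memLp (hφ.l2Bounded.clm f')),
    hk.ae_integrable ht₀ ha (Lp.memLp f)] with ξ h1 h2 h3 h4 h5 h6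
  rw [Pi.add_apply, h1, h2, h3, h4, kerOp, ← integral_add h5 h6, ← integral_const_mul]
  refine integral_congr_ae ?_
  filter_upwards [hf, hφ.coeFn f'] with η h7 h8
  rw [h8, h7, commKer]
  push_cast
  ring

/-- The kernel of the commutator of `Λ^s` and a coefficient, composed with `∂_j Λ^{-s}`. -/
def bracketKer (s : ℝ) (j : Fin d) (ξ η : Space d) : ℂ :=
  ((jb ξ ^ s - jb η ^ s : ℝ) : ℂ) * ((jb η ^ (-s) : ℝ) : ℂ) * dsym j η

/-- The scalar inequality `exists_abs_rpow_sub_rpow_mul_le` with `x = ⟨ξ⟩`, `y = ⟨η⟩`, `δ = ⟨ξ-η⟩`.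
The constant comes before `j`, and depends on `s` and `t₀` only. -/
theorem exists_kerBound_bracketKer (d : ℕ) (t₀ : ℝ) (hs : 0 ≤ s) :
    ∃ C, ∀ j : Fin d, KerBound t₀ (max (t₀ + 1) s) C (bracketKer s j) := by
  obtain ⟨C, hC, h⟩ := exists_abs_rpow_sub_rpow_mul_le s t₀ hs
  refine ⟨C, fun j ↦ ⟨hC, ?_, Filter.Eventually.of_forall fun z ↦ ?_⟩⟩
  · refine Continuous.aestronglyMeasurable ?_
    have h1 := continuous_jb_rpow (d := d) s
    have h2 := continuous_jb_rpow (d := d) (-s)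
    have h3 := continuous_dsym j
    have h4 := h1.comp (continuous_fst (X := Space d) (Y := Space d))
    have h5 := h1.comp (continuous_snd (X := Space d) (Y := Space d))
    have h6 := h2.comp (continuous_snd (X := Space d) (Y := Space d))
    have h7 := h3.comp (continuous_snd (X := Space d) (Y := Space d))
    exact ((Complex.continuous_ofReal.comp (h4.sub h5)).mul
      (Complex.continuous_ofReal.comp h6)).mul h7
  · rw [bracketKer, norm_mul, norm_mul, Complex.norm_real, Complex.norm_real, Real.norm_eq_abs,
      Real.norm_of_nonneg (Real.rpow_nonneg (jb_pos _).le _)]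
    have h1 := h _ _ _ (one_le_jb z.1) (one_le_jb z.2) (one_le_jb (z.1 - z.2))
      (abs_jb_sub_le z.1 z.2)
    have h2 := Real.rpow_nonneg (jb_pos z.2).le (-s)
    calc |jb z.1 ^ s - jb z.2 ^ s| * jb z.2 ^ (-s) * ‖dsym j z.2‖
        ≤ |jb z.1 ^ s - jb z.2 ^ s| * jb z.2 ^ (-s) * jb z.2 := by
          gcongr; exact norm_dsym_le j _
      _ = |jb z.1 ^ s - jb z.2 ^ s| * jb z.2 * jb z.2 ^ (-s) := by ring
      _ ≤ C * kerWeight t₀ (max (t₀ + 1) s) z.1 z.2 * jb z.2 ^ s * jb z.2 ^ (-s) := by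
          exact mul_le_mul_of_nonneg_right h1 h2
      _ = C * kerWeight t₀ (max (t₀ + 1) s) z.1 z.2 := by
          rw [mul_assoc, ← Real.rpow_add (jb_pos _), add_neg_cancel, Real.rpow_zero, mul_one]

/-- `Λ^s (a ∂_j z) = a ∂_j Λ^s z + [Λ^s, a] ∂_j z`, on the Fourier side. -/
theorem weight_mul_conv (ht₀ : (d : ℝ) / 2 < t₀) (hσ : t₀ ≤ σ) (ha : MemW σ a) {j : Fin d}
    (hk : KerBound t₀ σ C (bracketKer s j)) {Z DZ : L2 d} (hZ : derivGraph j Z DZ)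
    {z : Space d → ℂ} (hz : Z =ᵐ[volume] fun ξ ↦ ((jb ξ ^ s : ℝ) : ℂ) * z ξ) :
    (fun ξ ↦ ((jb ξ ^ s : ℝ) : ℂ) * ∫ η, a (ξ - η) * (dsym j η * z η)) =ᵐ[volume]
      (coefOp ht₀ hσ ha DZ + (hk.l2Bounded ht₀ ha).clm Z : L2 d) := by
  refine Filter.EventuallyEq.trans ?_ (Lp.coeFn_add _ _).symm
  filter_upwards [coeFn_coefOp ht₀ hσ ha DZ, L2Bounded.coeFn (hk.l2Bounded ht₀ ha) Z,
    ae_integrable_conv ht₀ hσ ha (Lp.memLp DZ), hk.ae_integrable ht₀ ha (Lp.memLp Z)]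
    with ξ h1 h2 h3 h4
  rw [Pi.add_apply, h1, h2, kerOp, ← integral_add h3 h4, ← integral_const_mul]
  refine integral_congr_ae ?_
  filter_upwards [hZ, hz] with η h5 h6
  have h7 : ((jb η ^ (-s) : ℝ) : ℂ) * Z η = z η := by
    rw [h6, ofReal_jb_rpow_mul, neg_add_cancel]
    simp
  rw [h5, bracketKer]
  have h8 : z η * ((jb η ^ s : ℝ) : ℂ) = Z η := by rw [h6, mul_comm]
  rw [← h7] at h8 ⊢
  push_cast at h8 ⊢
  linear_combination (a (ξ - η) * dsym j η) * h8

end ConcreteRules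

/-! ### Compactly supported test functions determine tempered distributions -/

section Density

variable {d : ℕ}

open Topology

theorem exists_cutoff_bound (χ : ContDiffBump (0 : Space d)) (i : ℕ) :
    ∃ C, ∀ x, ‖iteratedFDeriv ℝ i (fun x ↦ ((χ x : ℝ) : ℂ) - 1) x‖ ≤ C := by
  have hχ : ContDiff ℝ ∞ (fun x : Space d ↦ ((χ x : ℝ) : ℂ)) :=
    Complex.ofRealCLM.contDiff.comp χ.contDiff
  have hχc : HasCompactSupport (fun x : Space d ↦ ((χ x : ℝ) : ℂ)) :=
    χ.hasCompactSupport.comp_left (g := fun t : ℝ ↦ (t : ℂ)) (by simp)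
  refine ⟨SchwartzMap.seminorm ℝ 0 i (hχc.toSchwartzMap hχ) + 1, fun x ↦ ?_⟩
  have h1 : iteratedFDeriv ℝ i (fun x ↦ ((χ x : ℝ) : ℂ) - 1) x =
      iteratedFDeriv ℝ i (fun x ↦ ((χ x : ℝ) : ℂ)) x - iteratedFDeriv ℝ i (fun _ ↦ (1 : ℂ)) x :=
    iteratedFDeriv_sub_apply (hχ.of_le (mod_cast le_top)).contDiffAt contDiff_const.contDiffAt
  rw [h1]
  refine (norm_sub_le _ _).trans (add_le_add ?_ ?_)
  · exact SchwartzMap.norm_iteratedFDeriv_le_seminorm ℝ (hχc.toSchwartzMap hχ) i x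
  · rcases Nat.eq_zero_or_pos i with rfl | hi
    · simp
    · simp [iteratedFDeriv_const_of_ne hi.ne']

theorem contDiff_cutoff_sub_one (χ : ContDiffBump (0 : Space d)) :
    ContDiff ℝ ∞ (fun x ↦ ((χ x : ℝ) : ℂ) - 1) :=
  (Complex.ofRealCLM.contDiff.comp χ.contDiff).sub contDiff_const

/-- The dilated cutoff differs from one only where `‖x‖` is at least `rIn / r`; there, one spare
power of `‖x‖`, taken from the seminorm of order `k + 1`, yields the factor `r`. -/
theorem exists_seminorm_cutoff_le (χ : ContDiffBump (0 : Space d)) (φ : 𝓢(Space d, ℂ))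
    (k n : ℕ) : ∃ C, 0 ≤ C ∧ ∀ r : ℝ, 0 < r → r ≤ 1 → ∀ x,
      ‖x‖ ^ k * ‖iteratedFDeriv ℝ n (fun x ↦ (((χ (r • x) : ℝ) : ℂ) - 1) * φ x) x‖ ≤
        C * r := by
  choose c hc using exists_cutoff_bound χ
  have hc0 : ∀ i, 0 ≤ c i := fun i ↦ (norm_nonneg _).trans (hc i 0)
  refine ⟨∑ i ∈ Finset.range (n + 1), (n.choose i : ℝ) * c i *
    (SchwartzMap.seminorm ℝ (k + 1) (n - i) φ * χ.rIn⁻¹), ?_, fun r hr hr1 x ↦ ?_⟩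
  · have := χ.rIn_pos
    exact Finset.sum_nonneg fun i _ ↦ mul_nonneg (mul_nonneg (Nat.cast_nonneg _) (hc0 i))
      (by positivity)
  set g : Space d → ℂ := fun x ↦ ((χ (r • x) : ℝ) : ℂ) - 1 with hg
  have hgc : ContDiff ℝ ∞ g := (contDiff_cutoff_sub_one χ).comp (contDiff_const_smul r)
  rcases lt_or_ge (‖r • x‖) χ.rIn with hx | hx
  · have h1 : (fun x ↦ g x * φ x) =ᶠ[𝓝 x] fun _ ↦ 0 := by
      have hopen : IsOpen {y : Space d | ‖r • y‖ < χ.rIn} := by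
        apply isOpen_lt <;> fun_prop
      filter_upwards [hopen.mem_nhds hx] with y hy
      have : χ (r • y) = 1 := χ.one_of_mem_closedBall (by
        rw [mem_closedBall_zero_iff]; exact le_of_lt hy)
      simp [hg, this]
    have h2 : iteratedFDeriv ℝ n (fun x ↦ g x * φ x) x = 0 := by
      rw [(h1.iteratedFDeriv ℝ n).eq_of_nhds]
      exact congrFun (iteratedFDeriv_fun_zero) x
    rw [h2, norm_zero, mul_zero]
    have := χ.rIn_pos
    refine mul_nonneg (Finset.sum_nonneg fun i _ ↦ mul_nonneg (mul_nonneg (Nat.cast_nonneg _)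
      (hc0 i)) (by positivity)) hr.le
  · have h1 := norm_iteratedFDeriv_mul_le (𝕜 := ℝ) hgc φ.smooth' x (n := n)
      (by exact_mod_cast le_top)
    have h2 : 1 ≤ ‖x‖ * (r * χ.rIn⁻¹) := by
      rw [norm_smul, Real.norm_of_nonneg hr.le] at hx
      rw [← mul_assoc, ← div_eq_mul_inv, one_le_div χ.rIn_pos]
      linarith
    calc ‖x‖ ^ k * ‖iteratedFDeriv ℝ n (fun x ↦ g x * φ x) x‖
        ≤ ‖x‖ ^ k * ∑ i ∈ Finset.range (n + 1), (n.choose i : ℝ) *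
          ‖iteratedFDeriv ℝ i g x‖ * ‖iteratedFDeriv ℝ (n - i) φ x‖ := by gcongr; exact h1
      _ = ∑ i ∈ Finset.range (n + 1), (n.choose i : ℝ) *
          ‖iteratedFDeriv ℝ i g x‖ * (‖x‖ ^ k * ‖iteratedFDeriv ℝ (n - i) φ x‖) := by
          rw [Finset.mul_sum]
          refine Finset.sum_congr rfl fun i _ ↦ by ring
      _ ≤ ∑ i ∈ Finset.range (n + 1), (n.choose i : ℝ) * c i *
          (SchwartzMap.seminorm ℝ (k + 1) (n - i) φ * χ.rIn⁻¹ * r) := by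
          refine Finset.sum_le_sum fun i _ ↦ ?_
          have h3 : ‖iteratedFDeriv ℝ i g x‖ ≤ c i := by
            have h4 := congrFun (iteratedFDeriv_comp_const_smul (𝕜 := ℝ) (i := i) r
              ((contDiff_cutoff_sub_one χ).of_le (mod_cast le_top))) x
            change ‖iteratedFDeriv ℝ i (fun x ↦ (fun x ↦ ((χ x : ℝ) : ℂ) - 1) (r • x)) x‖ ≤ _
            rw [h4, norm_smul]
            have h5 : ‖r ^ i‖ ≤ 1 := by
              rw [norm_pow, Real.norm_of_nonneg hr.le]
              exact pow_le_one₀ hr.le hr1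
            calc _ ≤ 1 * c i := by
                  gcongr
                  exact hc i _
              _ = c i := one_mul _
          have h6 : ‖x‖ ^ k * ‖iteratedFDeriv ℝ (n - i) φ x‖ ≤
              SchwartzMap.seminorm ℝ (k + 1) (n - i) φ * χ.rIn⁻¹ * r := by
            have h7 := SchwartzMap.le_seminorm ℝ (k + 1) (n - i) φ x
            have hr0 : 0 ≤ χ.rIn⁻¹ * r := mul_nonneg (inv_nonneg.2 χ.rIn_pos.le) hr.le
            calc ‖x‖ ^ k * ‖iteratedFDeriv ℝ (n - i) φ x‖
                ≤ ‖x‖ ^ k * ‖iteratedFDeriv ℝ (n - i) φ x‖ * (‖x‖ * (r * χ.rIn⁻¹)) :=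
                  le_mul_of_one_le_right (by positivity) h2
              _ = ‖x‖ ^ (k + 1) * ‖iteratedFDeriv ℝ (n - i) φ x‖ * (χ.rIn⁻¹ * r) := by ring
              _ ≤ SchwartzMap.seminorm ℝ (k + 1) (n - i) φ * (χ.rIn⁻¹ * r) := by gcongr
              _ = _ := by ring
          have := hc0 i
          gcongr
      _ = _ := by
          rw [Finset.sum_mul]
          refine Finset.sum_congr rfl fun i _ ↦ by ring

/-- A tempered distribution is determined by its values on compactly supported functions. -/
theorem eq_of_forall_hasCompactSupport {F : Type*} [NormedAddCommGroup F] [NormedSpace ℂ F]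
    {u v : 𝓢'(Space d, F)}
    (h : ∀ φ : 𝓢(Space d, ℂ), HasCompactSupport (φ : Space d → ℂ) → u φ = v φ) : u = v := by
  ext φ
  let χ : ContDiffBump (0 : Space d) := ⟨1, 2, by norm_num, by norm_num⟩
  let r : ℕ → ℝ := fun N ↦ 1 / ((N : ℝ) + 1)
  have hr0 : ∀ N, 0 < r N := fun N ↦ by positivity
  have hr1 : ∀ N, r N ≤ 1 := fun N ↦ by
    rw [div_le_one (by positivity)]
    linarith [(Nat.cast_nonneg N : (0 : ℝ) ≤ N)]
  have hsm : ∀ N, ContDiff ℝ ∞ (fun x ↦ ((χ (r N • x) : ℝ) : ℂ) * φ x) := fun N ↦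
    ((Complex.ofRealCLM.contDiff.comp χ.contDiff).comp (contDiff_const_smul (r N))).mul φ.smooth'
  have hcs : ∀ N, HasCompactSupport (fun x ↦ ((χ (r N • x) : ℝ) : ℂ) * φ x) := fun N ↦ by
    refine HasCompactSupport.mul_right ?_
    have h1 : HasCompactSupport (fun x : Space d ↦ ((χ x : ℝ) : ℂ)) :=
      χ.hasCompactSupport.comp_left (g := fun t : ℝ ↦ (t : ℂ)) (by simp)
    exact h1.comp_smul (hr0 N).ne'
  let ψ : ℕ → 𝓢(Space d, ℂ) := fun N ↦ (hcs N).toSchwartzMap (hsm N)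
  have hψ : Filter.Tendsto ψ Filter.atTop (𝓝 φ) := by
    rw [(schwartz_withSeminorms ℝ (Space d) ℂ).tendsto_nhds_atTop]
    intro ⟨k, n⟩ δ hδ
    obtain ⟨C, hC, hb⟩ := exists_seminorm_cutoff_le χ φ k n
    obtain ⟨N₀, hN₀⟩ := exists_nat_gt (C / δ)
    refine ⟨N₀, fun N hN ↦ ?_⟩
    have h1 : SchwartzMap.seminorm ℝ k n (ψ N - φ) ≤ C * r N := by
      refine SchwartzMap.seminorm_le_bound ℝ k n _ (mul_nonneg hC (hr0 N).le) fun x ↦ ?_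
      have h2 : ((ψ N - φ : 𝓢(Space d, ℂ)) : Space d → ℂ) =
          fun x ↦ (((χ (r N • x) : ℝ) : ℂ) - 1) * φ x := by
        funext y
        simp [ψ, sub_mul]
      rw [h2]
      exact hb (r N) (hr0 N) (hr1 N) x
    refine lt_of_le_of_lt h1 ?_
    have h3 : C < δ * ((N : ℝ) + 1) := by
      rw [div_lt_iff₀ hδ] at hN₀
      have : (N₀ : ℝ) ≤ N := Nat.cast_le.2 hN
      nlinarith
    change C * (1 / ((N : ℝ) + 1)) < δ
    rw [mul_one_div, div_lt_iff₀ (by positivity)]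
    exact h3
  have hu := (u.continuous.tendsto φ).comp hψ
  have hv := (v.continuous.tendsto φ).comp hψ
  refine tendsto_nhds_unique hu (hv.congr fun N ↦ ?_)
  exact (h (ψ N) (hcs N)).symm

end Density

/-! ### Distributions whose Fourier transform is a function -/

section FourierFunctions

variable {d : ℕ} {F : Type*} [NormedAddCommGroup F] [InnerProductSpace ℂ F] [CompleteSpace F]
  {u u' : 𝓢'(Space d, F)} {w w' : Space d → F} {G : Space d → ℝ} {s : ℝ}

theorem _root_.MeasureTheory.LocallyIntegrable.integrable_schwartz_smul
    (hw : LocallyIntegrable w volume) {φ : 𝓢(Space d, ℂ)} (hφ : HasCompactSupport φ) :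
    Integrable (fun ξ ↦ φ ξ • w ξ) volume :=
  hw.integrable_smul_left_of_hasCompactSupport φ.continuous hφ

theorem HasFourierFun.ae_eq (h : HasFourierFun u w) (h' : HasFourierFun u w') :
    w =ᵐ[volume] w' := by
  refine ae_eq_of_integral_contDiff_smul_eq h.1 h'.1 fun g hg hgc ↦ ?_
  have hg₁ : HasCompactSupport (Complex.ofRealCLM ∘ g) := hgc.comp_left rfl
  have hg₂ : ContDiff ℝ ∞ (Complex.ofRealCLM ∘ g) := by fun_prop
  have h1 := h.2 (hg₁.toSchwartzMap hg₂) hg₁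
  have h2 := h'.2 (hg₁.toSchwartzMap hg₂) hg₁
  rw [h1] at h2
  simpa using h2

theorem HasFourierFun.congr (h : HasFourierFun u w) (hw : w =ᵐ[volume] w') :
    HasFourierFun u w' := by
  refine ⟨h.1.congr hw, fun φ hφ ↦ ?_⟩
  rw [h.2 φ hφ]
  refine integral_congr_ae ?_
  filter_upwards [hw] with ξ hξ
  rw [hξ]

theorem HasFourierFun.add (h : HasFourierFun u w) (h' : HasFourierFun u' w') :
    HasFourierFun (u + u') (fun ξ ↦ w ξ + w' ξ) := by
  refine ⟨h.1.add h'.1, fun φ hφ ↦ ?_⟩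
  rw [FourierTransform.fourier_add]
  simp only [smul_add]
  rw [integral_add (h.1.integrable_schwartz_smul hφ) (h'.1.integrable_schwartz_smul hφ),
    ← h.2 φ hφ, ← h'.2 φ hφ]
  rfl

theorem HasFourierFun.smul (c : ℂ) (h : HasFourierFun u w) :
    HasFourierFun (c • u) (fun ξ ↦ c • w ξ) := by
  refine ⟨h.1.smul c, fun φ hφ ↦ ?_⟩
  rw [FourierTransform.fourier_smul]
  simp only [smul_comm _ c]
  rw [integral_smul, ← h.2 φ hφ]
  rfl

theorem HasFourierFun.zero : HasFourierFun (0 : 𝓢'(Space d, F)) (fun _ ↦ 0) := by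
  refine ⟨locallyIntegrable_const 0, fun φ hφ ↦ ?_⟩
  rw [FourierTransform.fourier_zero]
  simp

theorem HasFourierFun.sum {ι : Type*} (S : Finset ι) {U : ι → 𝓢'(Space d, F)}
    {W : ι → Space d → F} (h : ∀ i ∈ S, HasFourierFun (U i) (W i)) :
    HasFourierFun (∑ i ∈ S, U i) (fun ξ ↦ ∑ i ∈ S, W i ξ) := by
  classical
  induction S using Finset.induction_on with
  | empty => simpa using HasFourierFun.zero
  | insert i S hi ih =>
    simp only [Finset.sum_insert hi]
    exact (h i (Finset.mem_insert_self _ _)).add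
      (ih fun j hj ↦ h j (Finset.mem_insert_of_mem hj))

theorem hasFourierFun_lp (f : Lp F 2 (volume : Measure (Space d))) :
    HasFourierFun (f : 𝓢'(Space d, F)) (𝓕 f : Lp F 2 (volume : Measure (Space d))) := by
  refine ⟨(Lp.memLp _).locallyIntegrable one_le_two, fun φ _ ↦ ?_⟩
  rw [Lp.fourier_toTemperedDistribution_eq, Lp.toTemperedDistribution_apply]

/-- A distribution with square integrable Fourier transform is an `L²` function. -/
theorem HasFourierFun.eq_lp (h : HasFourierFun u w) (hw : MemLp w 2 volume) :
    ((𝓕⁻ (hw.toLp w) : Lp F 2 (volume : Measure (Space d))) : 𝓢'(Space d, F)) = u := by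
  have h1 : 𝓕 u = ((hw.toLp w : Lp F 2 (volume : Measure (Space d))) : 𝓢'(Space d, F)) := by
    refine eq_of_forall_hasCompactSupport fun φ hφ ↦ ?_
    rw [h.2 φ hφ, Lp.toTemperedDistribution_apply]
    refine integral_congr_ae ?_
    filter_upwards [hw.coeFn_toLp] with ξ hξ
    rw [hξ]
  rw [← Lp.fourierInv_toTemperedDistribution_eq, ← h1, FourierTransform.fourierInv_fourier_eq]

theorem toTemperedDistribution_injective (p : ℝ≥0∞) [Fact (1 ≤ p)] :
    Function.Injective (fun f : Lp F p (volume : Measure (Space d)) ↦ (f : 𝓢'(Space d, F))) := by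
  have h := LinearMap.ker_eq_bot.1
    (Lp.ker_toTemperedDistributionCLM_eq_bot (F := F) (μ := (volume : Measure (Space d))) (p := p))
  exact h

/-- By injectivity of the embedding, the choice in `toL2` has only one possible outcome. -/
theorem toL2_coe (f : Lp F 2 (volume : Measure (Space d))) :
    toL2 (f : 𝓢'(Space d, F)) = f := by
  have h : ∃ g : Lp F 2 (volume : Measure (Space d)),
    (g : 𝓢'(Space d, F)) = (f : 𝓢'(Space d, F)) := ⟨f, rfl⟩
  rw [toL2, dif_pos h]
  exact toTemperedDistribution_injective 2 h.choose_spec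

theorem HasFourierFun.fourier_toL2 (h : HasFourierFun u w) (hw : MemLp w 2 volume) :
    𝓕 (toL2 u) = hw.toLp w := by
  rw [← h.eq_lp hw, toL2_coe, FourierTransform.fourier_fourierInv_eq]

theorem weighted_apply (G : Space d → ℝ) (s : ℝ) (w : Space d → F) (ξ : Space d) :
    weighted G s w ξ = ((jb ξ ^ s * scaled G ξ : ℝ) : ℂ) • w ξ := rfl

theorem MemHs.memLp (hu : MemHs G s u) (h : HasFourierFun u w) : MemLp (weighted G s w) 2 volume := by
  obtain ⟨v, hv, hv'⟩ := hu
  refine hv'.ae_eq ?_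
  filter_upwards [hv.ae_eq h] with ξ hξ
  rw [weighted_apply, weighted_apply, hξ]

/-- The representative chosen inside `lift` may be replaced by any other one, since they agree
almost everywhere. -/
theorem MemHs.coeFn_lift (hu : MemHs G s u) (h : HasFourierFun u w) :
    lift G s u =ᵐ[volume] weighted G s w := by
  rw [lift, dif_pos hu]
  refine (MemLp.coeFn_toLp _).trans ?_
  filter_upwards [hu.choose_spec.1.ae_eq h] with ξ hξ
  rw [weighted_apply, weighted_apply, hξ]

theorem HasFourierFun.memHs (h : HasFourierFun u w) (hw : MemLp (weighted G s w) 2 volume) :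
    MemHs G s u := ⟨w, h, hw⟩

theorem HasFourierFun.mult (h : HasFourierFun u w)
    (hw : MemLp (fun ξ ↦ (scaled G ξ : ℂ) • w ξ) 2 volume) :
    HasFourierFun (mult G u) (fun ξ ↦ (scaled G ξ : ℂ) • w ξ) := by
  have e : weighted G 0 w = fun ξ ↦ (scaled G ξ : ℂ) • w ξ := by
    funext ξ
    rw [weighted_apply, Real.rpow_zero, one_mul]
  have hu : MemHs G 0 u := h.memHs (by rwa [e])
  refine (hasFourierFun_lp (𝓕⁻ (lift G 0 u))).congr ?_
  rw [FourierTransform.fourier_fourierInv_eq, ← e]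
  exact hu.coeFn_lift h

theorem hasTemperateGrowth_inner_left (m : Space d) :
    Function.HasTemperateGrowth (fun ξ : Space d ↦ ((inner ℝ ξ m : ℝ) : ℂ)) := by
  fun_prop

theorem HasFourierFun.lineDeriv (h : HasFourierFun u w) (j : Fin d) :
    HasFourierFun (∂_{(EuclideanSpace.single j (1 : ℝ) : Space d)} u)
      (fun ξ ↦ dsym j ξ • w ξ) := by
  refine ⟨h.1.continuous_smul (continuous_dsym j), fun φ hφ ↦ ?_⟩
  rw [TemperedDistribution.fourier_lineDerivOp_eq]
  change (2 * Real.pi * Complex.I) • (TemperedDistribution.smulLeftCLM F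
    (fun ξ : Space d ↦ ((inner ℝ ξ (EuclideanSpace.single j (1 : ℝ)) : ℝ) : ℂ)) (𝓕 u)) φ = _
  rw [TemperedDistribution.smulLeftCLM_apply_apply, h.2, ← integral_smul]
  · refine integral_congr_ae (Filter.Eventually.of_forall fun ξ ↦ ?_)
    simp only
    rw [SchwartzMap.smulLeftCLM_apply_apply (hasTemperateGrowth_inner_left _), smul_smul, smul_smul]
    congr 1
    simp [dsym, EuclideanSpace.inner_single_right]
    ring
  -- Multiplying the test function by `ξ_j` does not enlarge its support, so the defining property
  -- of `w` still applies.
  · refine hφ.mono ?_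
    intro ξ hξ
    rw [Function.mem_support,
      SchwartzMap.smulLeftCLM_apply_apply (hasTemperateGrowth_inner_left _)] at hξ
    exact right_ne_zero_of_smul hξ

theorem HasFourierFun.comp {v : 𝓢'(Space d, CVec d)} {w : Space d → CVec d}
    (h : HasFourierFun v w) (j : Fin d) : HasFourierFun (comp j v) (fun ξ ↦ w ξ j) := by
  have hL : LocallyIntegrable (fun ξ ↦ w ξ j) volume := by
    intro x
    obtain ⟨S, hS, hS'⟩ := h.1 x
    exact ⟨S, hS, (EuclideanSpace.proj j : CVec d →L[ℂ] ℂ).integrable_comp hS'⟩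
  refine ⟨hL, fun φ hφ ↦ ?_⟩
  have h1 := congrArg (EuclideanSpace.proj j : CVec d →L[ℂ] ℂ) (h.2 φ hφ)
  rw [← ContinuousLinearMap.integral_comp_comm _ (h.1.integrable_schwartz_smul hφ)] at h1
  exact h1

theorem HasFourierFun.single {a : 𝓢'(Space d, ℂ)} {w : Space d → ℂ} (h : HasFourierFun a w)
    (j : Fin d) : HasFourierFun (single j a) (fun ξ ↦ w ξ • EuclideanSpace.single j (1 : ℂ)) := by
  have hL : LocallyIntegrable (fun ξ ↦ w ξ • (EuclideanSpace.single j (1 : ℂ) : CVec d)) volume := by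
    intro x
    obtain ⟨S, hS, hS'⟩ := h.1 x
    exact ⟨S, hS, hS'.smul_const _⟩
  refine ⟨hL, fun φ hφ ↦ ?_⟩
  have h1 := congrArg (fun z : ℂ ↦ z • (EuclideanSpace.single j (1 : ℂ) : CVec d)) (h.2 φ hφ)
  rw [← integral_smul_const] at h1
  simp only [← smul_assoc]
  exact h1

end FourierFunctions

/-! ### Products of L² functions and convolution of their transforms -/

section Products

variable {d : ℕ} {F : Type*} [NormedAddCommGroup F] [InnerProductSpace ℂ F] [CompleteSpace F]

theorem convolution_memLp_integrable {a : Space d → ℂ} {b : Space d → F} (ha : MemLp a 2 volume)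
    (hb : MemLp b 2 volume) (ξ : Space d) : Integrable (fun η ↦ a (ξ - η) • b η) volume := by
  have h := ha.comp_measurePreserving (Measure.measurePreserving_sub_left volume ξ)
  exact memLp_one_iff_integrable.1 (hb.smul (r := 1) h)

theorem norm_convolution_le {a : Space d → ℂ} {b : Space d → F} (ha : MemLp a 2 volume)
    (hb : MemLp b 2 volume) (ξ : Space d) :
    ‖∫ η, a (ξ - η) • b η‖ ≤ (eLpNorm a 2 volume).toReal * (eLpNorm b 2 volume).toReal := by
  have h := ha.comp_measurePreserving (Measure.measurePreserving_sub_left volume ξ)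
  refine (norm_integral_le_lintegral_norm _).trans ?_
  rw [← ENNReal.toReal_mul]
  refine ENNReal.toReal_mono (ENNReal.mul_ne_top ha.2.ne hb.2.ne) ?_
  have h1 := eLpNorm_smul_le_mul_eLpNorm (p := 2) (q := 2) (r := 1) hb.1 h.1
  rw [eLpNorm_comp_measurePreserving ha.1 (Measure.measurePreserving_sub_left volume ξ)] at h1
  refine le_trans (le_of_eq ?_) h1
  rw [eLpNorm_one_eq_lintegral_enorm]
  refine lintegral_congr fun η ↦ ?_
  rw [ofReal_norm]
  rfl

theorem aestronglyMeasurable_convolution {a : Space d → ℂ} {b : Space d → F}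
    (ha : AEStronglyMeasurable a volume) (hb : AEStronglyMeasurable b volume) :
    AEStronglyMeasurable (fun ξ ↦ ∫ η, a (ξ - η) • b η) volume := by
  have h1 : AEStronglyMeasurable (fun z : Space d × Space d ↦ a (z.1 - z.2) • b z.2)
      (volume.prod volume) :=
    (ha.comp_quasiMeasurePreserving (quasiMeasurePreserving_sub volume volume)).smul
      (hb.comp_quasiMeasurePreserving Measure.quasiMeasurePreserving_snd)
  exact h1.integral_prod_right'

theorem locallyIntegrable_convolution {a : Space d → ℂ} {b : Space d → F} (ha : MemLp a 2 volume)
    (hb : MemLp b 2 volume) : LocallyIntegrable (fun ξ ↦ ∫ η, a (ξ - η) • b η) volume :=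
  (memLp_top_of_bound (aestronglyMeasurable_convolution ha.1 hb.1) _
    (Filter.Eventually.of_forall (norm_convolution_le ha hb))).locallyIntegrable le_top

theorem integrable_schwartz_smul_convolution {a : Space d → ℂ} {b : Space d → F}
    (ha : MemLp a 2 volume) (hb : MemLp b 2 volume) (φ : 𝓢(Space d, ℂ)) :
    Integrable (fun ξ ↦ φ ξ • ∫ η, a (ξ - η) • b η) volume :=
  φ.integrable.smul_bdd ((eLpNorm a 2 volume).toReal * (eLpNorm b 2 volume).toReal)
    (aestronglyMeasurable_convolution ha.1 hb.1)
    (Filter.Eventually.of_forall (norm_convolution_le ha hb))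

/-- The pairing of a test function with the convolution of two square integrable functions. -/
def convPairing (φ : 𝓢(Space d, ℂ)) : Lp ℂ 2 (volume : Measure (Space d)) →L[ℂ]
    Lp F 2 (volume : Measure (Space d)) →L[ℂ] F :=
  LinearMap.mkContinuous₂
    (LinearMap.mk₂ ℂ (fun (a : Lp ℂ 2 (volume : Measure (Space d)))
        (b : Lp F 2 (volume : Measure (Space d))) ↦ ∫ ξ, φ ξ • ∫ η, a (ξ - η) • b η)
      (fun a a' b ↦ by
        rw [← integral_add (integrable_schwartz_smul_convolution (Lp.memLp a) (Lp.memLp b) φ)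
          (integrable_schwartz_smul_convolution (Lp.memLp a') (Lp.memLp b) φ)]
        congr 1
        funext ξ
        rw [← smul_add, ← integral_add (convolution_memLp_integrable (Lp.memLp a) (Lp.memLp b) ξ)
          (convolution_memLp_integrable (Lp.memLp a') (Lp.memLp b) ξ)]
        congr 1
        refine integral_congr_ae ?_
        filter_upwards [(quasiMeasurePreserving_sub_left volume ξ).ae (Lp.coeFn_add a a')] with η hη
        rw [hη, Pi.add_apply, add_smul])
      (fun c a b ↦ by
        rw [← integral_smul]
        congr 1
        funext ξ
        rw [smul_comm, ← integral_smul c (fun η ↦ a (ξ - η) • b η)]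
        congr 1
        refine integral_congr_ae ?_
        filter_upwards [(quasiMeasurePreserving_sub_left volume ξ).ae (Lp.coeFn_smul c a)] with η hη
        rw [hη, Pi.smul_apply, smul_assoc])
      (fun a b b' ↦ by
        rw [← integral_add (integrable_schwartz_smul_convolution (Lp.memLp a) (Lp.memLp b) φ)
          (integrable_schwartz_smul_convolution (Lp.memLp a) (Lp.memLp b') φ)]
        congr 1
        funext ξ
        rw [← smul_add, ← integral_add (convolution_memLp_integrable (Lp.memLp a) (Lp.memLp b) ξ)
          (convolution_memLp_integrable (Lp.memLp a) (Lp.memLp b') ξ)]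
        congr 1
        refine integral_congr_ae ?_
        filter_upwards [Lp.coeFn_add b b'] with η hη
        rw [hη, Pi.add_apply, smul_add])
      (fun c a b ↦ by
        rw [← integral_smul]
        congr 1
        funext ξ
        rw [smul_comm, ← integral_smul c (fun η ↦ a (ξ - η) • b η)]
        congr 1
        refine integral_congr_ae ?_
        filter_upwards [Lp.coeFn_smul c b] with η hη
        rw [hη, Pi.smul_apply, smul_comm]))
    (∫ ξ, ‖φ ξ‖) fun a b ↦ by
      refine (norm_integral_le_integral_norm _).trans ?_
      rw [mul_assoc, ← integral_mul_const]
      refine integral_mono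
        (integrable_schwartz_smul_convolution (Lp.memLp a) (Lp.memLp b) φ).norm
        (φ.integrable.norm.mul_const _) fun ξ ↦ ?_
      simp only [norm_smul]
      gcongr
      rw [Lp.norm_def, Lp.norm_def]
      exact norm_convolution_le (Lp.memLp a) (Lp.memLp b) ξ

theorem convPairing_apply (φ : 𝓢(Space d, ℂ)) (a : Lp ℂ 2 (volume : Measure (Space d)))
    (b : Lp F 2 (volume : Measure (Space d))) :
    convPairing φ a b = ∫ ξ, φ ξ • ∫ η, a (ξ - η) • b η := rfl

theorem fourier_neg_apply {E : Type*} [NormedAddCommGroup E] [NormedSpace ℂ E]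
    (h : 𝓢(Space d, E)) (x : Space d) : (𝓕 h) (-x) = (𝓕⁻ h) x := by
  rw [SchwartzMap.fourier_coe, SchwartzMap.fourierInv_coe, Real.fourierInv_eq_fourier_neg]

/-- The case of Schwartz functions, where the convolution theorem is available; it is extended by
density in `fourier_smul_apply`. -/
theorem fourier_toLp_smul_toLp_apply (f : 𝓢(Space d, ℂ)) (g : 𝓢(Space d, F))
    (φ : 𝓢(Space d, ℂ)) :
    (𝓕 (((f.toLp 2 volume • g.toLp 2 volume : Lp F 1 (volume : Measure (Space d)))) :
      𝓢'(Space d, F))) φ = convPairing φ (𝓕 (f.toLp 2)) (𝓕 (g.toLp 2)) := by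
  set c : 𝓢(Space d, F) := SchwartzMap.convolution (ContinuousLinearMap.lsmul ℂ ℂ) (𝓕 f) (𝓕 g)
    with hc
  have h1 : ∀ x, (𝓕⁻ c) x = f x • g x := by
    intro x
    -- The convolution theorem is used for the direct transform and evaluated at `-x`, which turns
    -- every outer transform into an inverse one.
    have h2 : (𝓕 c) (-x) = (𝓕 (𝓕 f)) (-x) • (𝓕 (𝓕 g)) (-x) := by
      rw [hc, SchwartzMap.fourier_convolution]
      simp
    rw [fourier_neg_apply, fourier_neg_apply, fourier_neg_apply] at h2
    simpa using h2
  have h3 : (f.toLp 2 volume • g.toLp 2 volume : Lp F 1 (volume : Measure (Space d))) =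
      (𝓕⁻ c).toLp 1 volume := by
    refine Lp.ext ?_
    filter_upwards [Lp.coeFn_lpSMul (r := 1) (f.toLp 2 volume) (g.toLp 2 volume),
      f.coeFn_toLp 2 volume, g.coeFn_toLp 2 volume, (𝓕⁻ c).coeFn_toLp 1 volume] with x e1 e2 e3 e4
    rw [e1, e4, h1, Pi.smul_apply', e2, e3]
  rw [h3, Lp.toTemperedDistribution_toLp_eq, TemperedDistribution.fourier_toTemperedDistributionCLM_eq,
    FourierTransform.fourier_fourierInv_eq, convPairing_apply, SchwartzMap.toLp_fourier_eq,
    SchwartzMap.toLp_fourier_eq]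
  simp only [SchwartzMap.toTemperedDistributionCLM_apply_apply]
  congr 1
  funext ξ
  congr 1
  rw [hc, SchwartzMap.convolution_apply, MeasureTheory.convolution_lsmul_swap]
  refine integral_congr_ae ?_
  filter_upwards [(quasiMeasurePreserving_sub_left volume ξ).ae ((𝓕 f).coeFn_toLp 2 volume),
    (𝓕 g).coeFn_toLp 2 volume] with η e1 e2
  rw [e1, e2]

/-- Identifies the product with a bounded bilinear map, from which its joint continuity follows. -/
theorem holderL_lsmul (α : Lp ℂ 2 (volume : Measure (Space d)))
    (β : Lp F 2 (volume : Measure (Space d))) :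
    (ContinuousLinearMap.lsmul ℂ ℂ : ℂ →L[ℂ] F →L[ℂ] F).holderL volume 2 2 1 α β = α • β := by
  refine Lp.ext ?_
  filter_upwards [ContinuousLinearMap.coeFn_holder (r := 1)
    (ContinuousLinearMap.lsmul ℂ ℂ : ℂ →L[ℂ] F →L[ℂ] F) α β, Lp.coeFn_lpSMul (r := 1) α β]
    with x h1 h2
  rw [ContinuousLinearMap.holderL_apply_apply, h1, h2]
  rfl

/-- The Fourier transform of a product of square integrable functions is the convolution of their
Fourier transforms. -/
theorem fourier_smul_apply (α : Lp ℂ 2 (volume : Measure (Space d)))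
    (β : Lp F 2 (volume : Measure (Space d))) (φ : 𝓢(Space d, ℂ)) :
    (𝓕 ((α • β : Lp F 1 (volume : Measure (Space d))) : 𝓢'(Space d, F))) φ =
      convPairing φ (𝓕 α : Lp ℂ 2 (volume : Measure (Space d))) (𝓕 β) := by
  -- Both sides are continuous in the pair `(α, β)` and agree on the dense set of Schwartz pairs.
  have hc : Continuous fun p : Lp ℂ 2 (volume : Measure (Space d)) ×
      Lp F 2 (volume : Measure (Space d)) ↦
      (𝓕 ((p.1 • p.2 : Lp F 1 (volume : Measure (Space d))) : 𝓢'(Space d, F))) φ := by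
    have h1 : Continuous fun p : Lp ℂ 2 (volume : Measure (Space d)) ×
      Lp F 2 (volume : Measure (Space d)) ↦
        (p.1 • p.2 : Lp F 1 (volume : Measure (Space d))) := by
      simp only [← holderL_lsmul]
      fun_prop
    have h2 := (Lp.toTemperedDistributionCLM F (volume : Measure (Space d)) 1).continuous.comp h1
    have h3 : Continuous fun u : 𝓢'(Space d, F) ↦ u (𝓕 φ) := by
      exact (PointwiseConvergenceCLM.evalCLM (RingHom.id ℂ) F (𝓕 φ)).continuous
    exact h3.comp h2
  have hc' : Continuous fun p : Lp ℂ 2 (volume : Measure (Space d)) ×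
      Lp F 2 (volume : Measure (Space d)) ↦
      convPairing φ (𝓕 p.1 : Lp ℂ 2 (volume : Measure (Space d))) (𝓕 p.2) := by
    have h1 : Continuous fun p : Lp ℂ 2 (volume : Measure (Space d)) ×
      Lp F 2 (volume : Measure (Space d)) ↦ (𝓕 p.1 : Lp ℂ 2 (volume : Measure (Space d))) :=
      (Lp.fourierTransformₗᵢ (Space d) ℂ).continuous.comp continuous_fst
    have h2 : Continuous fun p : Lp ℂ 2 (volume : Measure (Space d)) ×
      Lp F 2 (volume : Measure (Space d)) ↦ (𝓕 p.2 : Lp F 2 (volume : Measure (Space d))) :=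
      (Lp.fourierTransformₗᵢ (Space d) F).continuous.comp continuous_snd
    fun_prop
  have hd : DenseRange (Prod.map (SchwartzMap.toLpCLM ℝ ℂ 2 (volume : Measure (Space d)))
      (SchwartzMap.toLpCLM ℝ F 2 (volume : Measure (Space d)))) :=
    (SchwartzMap.denseRange_toLpCLM (p := 2) ENNReal.ofNat_ne_top).prodMap
      (SchwartzMap.denseRange_toLpCLM (p := 2) ENNReal.ofNat_ne_top)
  exact congrFun (hd.equalizer hc hc' (funext fun p ↦ fourier_toLp_smul_toLp_apply p.1 p.2 φ))
    (α, β)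

theorem HasFourierFun.prod {a : 𝓢'(Space d, ℂ)} {u : 𝓢'(Space d, F)} {wa : Space d → ℂ}
    {wu : Space d → F} (ha : HasFourierFun a wa) (ha' : MemLp wa 2 volume)
    (hu : HasFourierFun u wu) (hu' : MemLp wu 2 volume) :
    HasFourierFun (prod a u) (fun ξ ↦ ∫ η, wa (ξ - η) • wu η) := by
  refine ⟨locallyIntegrable_convolution ha' hu', fun φ _ ↦ ?_⟩
  rw [WhithamBoussinesq.prod, fourier_smul_apply, ha.fourier_toL2 ha', hu.fourier_toL2 hu',
    convPairing_apply]
  congr 1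
  funext ξ
  congr 1
  refine integral_congr_ae ?_
  filter_upwards [(quasiMeasurePreserving_sub_left volume ξ).ae ha'.coeFn_toLp, hu'.coeFn_toLp]
    with η e1 e2
  rw [e1, e2]

end Products

/-! ### Coefficients as multiplications in physical variables -/

section PhysicalSide

variable {d : ℕ} {t₀ σ τ : ℝ} {a b : Space d → ℂ}

/-- The exponents may differ: the product is only known to be in L¹, while the inverse transform of
the convolution is in L². -/
theorem ae_eq_of_toTemperedDistribution_eq {p q : ℝ≥0∞} [hp : Fact (1 ≤ p)] [hq : Fact (1 ≤ q)]
    {f : Lp ℂ p (volume : Measure (Space d))} {g : Lp ℂ q (volume : Measure (Space d))}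
    (h : (f : 𝓢'(Space d, ℂ)) = (g : 𝓢'(Space d, ℂ))) : f =ᵐ[volume] g := by
  refine ae_eq_of_integral_contDiff_smul_eq ((Lp.memLp f).locallyIntegrable hp.out)
    ((Lp.memLp g).locallyIntegrable hq.out) fun φ hφ hφc ↦ ?_
  have hφ₁ : HasCompactSupport (Complex.ofRealCLM ∘ φ) := hφc.comp_left rfl
  have hφ₂ : ContDiff ℝ ∞ (Complex.ofRealCLM ∘ φ) := by fun_prop
  have h1 := DFunLike.congr_fun h (hφ₁.toSchwartzMap hφ₂)
  rw [Lp.toTemperedDistribution_apply, Lp.toTemperedDistribution_apply] at h1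
  simpa using h1

theorem MemW.memLp (ha : MemW σ a) (hσ : 0 ≤ σ) : MemLp a 2 volume := by
  refine MemLp.of_le ha ha.aestronglyMeasurable (Filter.Eventually.of_forall fun ξ ↦ ?_)
  rw [norm_mul, Complex.norm_real, Real.norm_of_nonneg (Real.rpow_nonneg (jb_pos ξ).le _)]
  exact le_mul_of_one_le_left (norm_nonneg _) (Real.one_le_rpow (one_le_jb ξ) hσ)

theorem nonneg_of_half_lt (ht₀ : (d : ℝ) / 2 < t₀) : 0 ≤ t₀ :=
  le_trans (by positivity) ht₀.le

/-- In physical variables, `coefOp` is the multiplication by the coefficient. -/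
theorem fourierInv_coefOp (ht₀ : (d : ℝ) / 2 < t₀) (hσ : t₀ ≤ σ) (ha : MemW σ a) {α : L2 d}
    (hα : (𝓕 α : L2 d) =ᵐ[volume] a) (f : L2 d) :
    (𝓕⁻ (coefOp ht₀ hσ ha f) : L2 d) =ᵐ[volume] fun x ↦ α x * (𝓕⁻ f : L2 d) x := by
  have h1 := ((hasFourierFun_lp α).congr hα).prod (ha.memLp ((nonneg_of_half_lt ht₀).trans hσ))
    (hasFourierFun_lp (𝓕⁻ f : L2 d)) (Lp.memLp _)
  rw [FourierTransform.fourier_fourierInv_eq] at h1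
  have h2 := h1.congr (coeFn_coefOp ht₀ hσ ha f).symm
  have h3 := h2.eq_lp (Lp.memLp _)
  rw [Lp.toLp_coeFn, prod, toL2_coe, toL2_coe] at h3
  refine (ae_eq_of_toTemperedDistribution_eq h3).trans ?_
  exact Lp.coeFn_lpSMul (r := 1) α (𝓕⁻ f : L2 d)

theorem inner_fourierInv (f g : L2 d) : inner ℂ (𝓕⁻ f : L2 d) (𝓕⁻ g) = inner ℂ f g := by
  rw [← Lp.inner_fourier_eq, FourierTransform.fourier_fourierInv_eq,
    FourierTransform.fourier_fourierInv_eq]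

/-- By Plancherel this is the symmetry of the multiplication by a real function. -/
theorem isSymm_coefOp (ht₀ : (d : ℝ) / 2 < t₀) (hσ : t₀ ≤ σ) (ha : MemW σ a) {α : L2 d}
    (hα : (𝓕 α : L2 d) =ᵐ[volume] a) (hr : ∀ᵐ x, (α x).im = 0) :
    IsSymm (coefOp ht₀ hσ ha) := by
  intro f g
  rw [← inner_fourierInv, ← inner_fourierInv f, inner_eq_integral, inner_eq_integral]
  refine integral_congr_ae ?_
  filter_upwards [fourierInv_coefOp ht₀ hσ ha hα f, fourierInv_coefOp ht₀ hσ ha hα g, hr]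
    with x h1 h2 h3
  rw [h1, h2, map_mul, Complex.conj_eq_iff_im.2 h3]
  ring

theorem coefOp_comm (ht₀ : (d : ℝ) / 2 < t₀) (hσ : t₀ ≤ σ) (ha : MemW σ a)
    (hτ : t₀ ≤ τ) (hb : MemW τ b) {α β : L2 d}
    (hα : (𝓕 α : L2 d) =ᵐ[volume] a) (hβ : (𝓕 β : L2 d) =ᵐ[volume] b) (f : L2 d) :
    coefOp ht₀ hσ ha (coefOp ht₀ hτ hb f) = coefOp ht₀ hτ hb (coefOp ht₀ hσ ha f) := by
  have h : (𝓕⁻ (coefOp ht₀ hσ ha (coefOp ht₀ hτ hb f)) : L2 d) =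
      𝓕⁻ (coefOp ht₀ hτ hb (coefOp ht₀ hσ ha f)) := by
    refine Lp.ext ?_
    filter_upwards [fourierInv_coefOp ht₀ hσ ha hα f, fourierInv_coefOp ht₀ hτ hb hβ f,
      fourierInv_coefOp ht₀ hσ ha hα (coefOp ht₀ hτ hb f),
      fourierInv_coefOp ht₀ hτ hb hβ (coefOp ht₀ hσ ha f)] with x h1 h2 h3 h4
    rw [h3, h4, h1, h2]
    ring
  have h' := congrArg (fun q : L2 d ↦ (𝓕 q : L2 d)) h
  simpa only [FourierTransform.fourier_fourierInv_eq] using h'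

/-- By Plancherel the right side is the integral of `(1 + ε α) |f|²` in physical variables, with the
real part of `α`. -/
theorem le_norm_sq_add_rinner_coefOp (ht₀ : (d : ℝ) / 2 < t₀) (hσ : t₀ ≤ σ) (ha : MemW σ a)
    {α : L2 d} (hα : (𝓕 α : L2 d) =ᵐ[volume] a) {ε h : ℝ}
    (hh : ∀ᵐ x, h ≤ 1 + ε * (α x).re) (f : L2 d) :
    h * ‖f‖ ^ 2 ≤ ‖f‖ ^ 2 + ε * rinner f (coefOp ht₀ hσ ha f) := by
  have hn : ‖f‖ ^ 2 = rinner f f := by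
    rw [rinner, inner_self_eq_norm_sq_to_K]
    norm_cast
  have hre : ∀ p q : L2 d, rinner p q = ∫ x, (q x * (starRingEnd ℂ) (p x)).re := by
    intro p q
    rw [rinner, inner_eq_integral]
    exact (integral_re (by simpa [RCLike.inner_apply] using L2.integrable_inner (𝕜 := ℂ) p q)).symm
  have hi : ∀ p q : L2 d, Integrable (fun x ↦ (q x * (starRingEnd ℂ) (p x)).re) volume :=
    fun p q ↦ Integrable.re (by simpa [RCLike.inner_apply] using L2.integrable_inner (𝕜 := ℂ) p q)
  have hF : ∀ p q : L2 d, rinner p q = rinner (𝓕⁻ p : L2 d) (𝓕⁻ q) := fun p q ↦ by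
    rw [rinner, rinner, inner_fourierInv]
  rw [hn, hF, hF f, hre, hre, ← integral_const_mul, ← integral_const_mul,
    ← integral_add (hi _ _) ((hi _ _).const_mul _)]
  refine integral_mono_ae ((hi _ _).const_mul _) ((hi _ _).add ((hi _ _).const_mul _)) ?_
  filter_upwards [fourierInv_coefOp ht₀ hσ ha hα f, hh] with x h1 h2
  rw [h1, mul_assoc, Complex.mul_conj, Complex.ofReal_re, Complex.re_mul_ofReal]
  nlinarith [Complex.normSq_nonneg ((𝓕⁻ f : L2 d) x)]

end PhysicalSide

/-! ### Weighted transforms of the state and of the coefficients -/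

section Lifts

variable {d : ℕ} {t₀ σ s M : ℝ} {G G₁ G₂ : Space d → ℝ}

theorem HasFourierFun.aestronglyMeasurable {F : Type*} [NormedAddCommGroup F]
    [InnerProductSpace ℂ F] [CompleteSpace F] {u : 𝓢'(Space d, F)} {w : Space d → F}
    (h : HasFourierFun u w) : AEStronglyMeasurable w volume :=
  h.1.aestronglyMeasurable

theorem weighted_one (s : ℝ) (w : Space d → ℂ) :
    weighted (fun _ ↦ 1) s w = fun ξ ↦ ((jb ξ ^ s : ℝ) : ℂ) * w ξ := by
  funext ξ
  simp [weighted_apply, scaled]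

theorem MemHs.memW {u : 𝓢'(Space d, ℂ)} {w : Space d → ℂ} (h : MemHs (fun _ ↦ 1) σ u)
    (hw : HasFourierFun u w) : MemW σ w := by
  have := h.memLp hw
  rwa [weighted_one] at this

theorem MemHs.coeFn_lift_one {u : 𝓢'(Space d, ℂ)} {w : Space d → ℂ} (h : MemHs (fun _ ↦ 1) s u)
    (hw : HasFourierFun u w) :
    lift (fun _ ↦ 1) s u =ᵐ[volume] fun ξ ↦ ((jb ξ ^ s : ℝ) : ℂ) * w ξ := by
  have := h.coeFn_lift hw
  rwa [weighted_one] at this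

theorem MemHs.wnorm_eq {u : 𝓢'(Space d, ℂ)} {w : Space d → ℂ} (h : MemHs (fun _ ↦ 1) σ u)
    (hw : HasFourierFun u w) : wnorm σ w = ‖lift (fun _ ↦ 1) σ u‖ := by
  rw [Lp.norm_def, wnorm, eLpNorm_congr_ae (h.coeFn_lift_one hw)]

/-- Two forms of one operator: `coefOp` with a weight `σ` large enough for the commutator bounds,
and `convBilin`, bounded and bilinear with only `t₀` derivatives on the coefficient, which is what
can be differentiated in time. -/
theorem coefOp_eq_convBilin (ht₀ : (d : ℝ) / 2 < t₀) (hσ : t₀ ≤ σ) {u : 𝓢'(Space d, ℂ)}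
    {w : Space d → ℂ} (h : MemHs (fun _ ↦ 1) t₀ u) (hw : HasFourierFun u w) (hw' : MemW σ w) :
    coefOp ht₀ hσ hw' = convBilin ht₀ (lift (fun _ ↦ 1) t₀ u) := by
  ext1 f
  refine Lp.ext ?_
  filter_upwards [coeFn_coefOp ht₀ hσ hw' f, coeFn_convBilin ht₀ (lift (fun _ ↦ 1) t₀ u) f]
    with ξ h1 h2
  have h3 : unweight t₀ (lift (fun _ ↦ 1) t₀ u) =ᵐ[volume] w := by
    filter_upwards [h.coeFn_lift_one hw] with η h4
    rw [unweight, h4, ofReal_jb_rpow_mul, neg_add_cancel]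
    simp
  rw [h1, h2, kerOp_congr_coef h3]
  simp [kerOp]

/-- The `k`-th component of a square integrable vector field. -/
def compL2 (k : Fin d) : Lp (CVec d) 2 (volume : Measure (Space d)) →L[ℂ] L2 d :=
  (EuclideanSpace.proj k : CVec d →L[ℂ] ℂ).compLpL 2 volume

theorem coeFn_compL2 (k : Fin d) (f : Lp (CVec d) 2 (volume : Measure (Space d))) :
    compL2 k f =ᵐ[volume] fun ξ ↦ f ξ k :=
  (EuclideanSpace.proj k : CVec d →L[ℂ] ℂ).coeFn_compLpL f

theorem sum_norm_compL2_sq (f : Lp (CVec d) 2 (volume : Measure (Space d))) :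
    ∑ k, ‖compL2 k f‖ ^ 2 = ‖f‖ ^ 2 := by
  have h : ∀ k, inner ℂ (compL2 k f) (compL2 k f) = ∫ ξ, inner ℂ (f ξ k) (f ξ k) := fun k ↦ by
    rw [L2.inner_def]
    refine integral_congr_ae ?_
    filter_upwards [coeFn_compL2 k f] with ξ h1
    rw [h1]
  have hi : ∀ k, Integrable (fun ξ ↦ inner ℂ (f ξ k) (f ξ k)) volume := fun k ↦
    (L2.integrable_inner (𝕜 := ℂ) (compL2 k f) (compL2 k f)).congr (by
      filter_upwards [coeFn_compL2 k f] with ξ h1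
      rw [h1])
  have h2 : (∑ k, (‖compL2 k f‖ : ℂ) ^ 2) = (‖f‖ : ℂ) ^ 2 := by
    have e1 := inner_self_eq_norm_sq_to_K (𝕜 := ℂ) f
    have e2 := fun k ↦ inner_self_eq_norm_sq_to_K (𝕜 := ℂ) (compL2 k f)
    simp only [Complex.coe_algebraMap] at e1 e2
    rw [← e1, L2.inner_def]
    simp only [← e2, h]
    rw [← integral_finsetSum _ fun k _ ↦ hi k]
    rfl
  exact_mod_cast h2

theorem MemHs.coeFn_compL2_lift {v : 𝓢'(Space d, CVec d)} {w : Space d → CVec d}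
    (h : MemHs G s v) (hw : HasFourierFun v w) (k : Fin d) :
    compL2 k (lift G s v) =ᵐ[volume]
      fun ξ ↦ ((jb ξ ^ s : ℝ) : ℂ) * ((scaled G ξ : ℂ) * w ξ k) := by
  filter_upwards [coeFn_compL2 k (lift G s v), h.coeFn_lift hw] with ξ h1 h2
  rw [h1, h2, weighted_apply, PiLp.smul_apply, smul_eq_mul]
  push_cast
  ring

theorem exists_derivGraph {f F : L2 d} (hF : F =ᵐ[volume] fun ξ ↦ (jb ξ : ℂ) * f ξ) (j : Fin d) :
    ∃ f', derivGraph j f f' := by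
  have h : MemLp (fun ξ ↦ dsym j ξ * f ξ) 2 volume := by
    refine MemLp.of_le (Lp.memLp F)
      ((continuous_dsym j).aestronglyMeasurable.mul (Lp.memLp f).1) ?_
    filter_upwards [hF] with ξ hξ
    rw [hξ, norm_mul, norm_mul, Complex.norm_real, Real.norm_of_nonneg (jb_pos ξ).le]
    gcongr
    exact norm_dsym_le j ξ
  exact ⟨h.toLp, h.coeFn_toLp⟩

theorem jb_mul_rpow (ξ : Space d) (s : ℝ) (z : ℂ) :
    (jb ξ : ℂ) * (((jb ξ ^ s : ℝ) : ℂ) * z) = ((jb ξ ^ (s + 1) : ℝ) : ℂ) * z := by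
  rw [add_comm s, ← ofReal_jb_rpow_mul, Real.rpow_one]

/-- The norm of `X^σ` controls `G₁[v̄]`, hence the coefficients `G₂[v̄_j]`, because `|G₂| ≤ G₁`. -/
theorem memW_component {v : 𝓢'(Space d, CVec d)} {b : Space d → CVec d} (h : MemHs G₁ σ v)
    (hb : HasFourierFun v b) (hG : ∀ ξ, |G₂ ξ| ≤ G₁ ξ)
    (hG₂ : AEStronglyMeasurable (scaled G₂) volume) (j : Fin d) :
    MemW σ (fun ξ ↦ (scaled G₂ ξ : ℂ) * b ξ j) ∧
      wnorm σ (fun ξ ↦ (scaled G₂ ξ : ℂ) * b ξ j) ≤ ‖lift G₁ σ v‖ := by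
  have h1 : ∀ ξ, ‖((jb ξ ^ σ : ℝ) : ℂ) * ((scaled G₂ ξ : ℂ) * b ξ j)‖ ≤ ‖weighted G₁ σ b ξ‖ := by
    intro ξ
    have h2 : ‖(scaled G₂ ξ : ℂ)‖ ≤ ‖(scaled G₁ ξ : ℂ)‖ := by
      rw [Complex.norm_real, Complex.norm_real]
      exact (hG _).trans (le_abs_self _)
    rw [weighted_apply, norm_smul, norm_mul, norm_mul, Complex.ofReal_mul, norm_mul, mul_assoc]
    have h3 : ‖b ξ j‖ ≤ ‖b ξ‖ := PiLp.norm_apply_le (b ξ) j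
    gcongr
  have h4 : AEStronglyMeasurable
      (fun ξ ↦ ((jb ξ ^ σ : ℝ) : ℂ) * ((scaled G₂ ξ : ℂ) * b ξ j)) volume :=
    (Complex.continuous_ofReal.comp (continuous_jb_rpow σ)).aestronglyMeasurable.mul
      ((Complex.continuous_ofReal.comp_aestronglyMeasurable hG₂).mul
        (hb.comp j).aestronglyMeasurable)
  refine ⟨MemLp.of_le (h.memLp hb) h4 (Filter.Eventually.of_forall h1), ?_⟩
  rw [Lp.norm_def, eLpNorm_congr_ae (h.coeFn_lift hb), wnorm]
  exact ENNReal.toReal_mono (h.memLp hb).2.ne (eLpNorm_mono h1)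

end Lifts

/-! ### The operators of the system at a fixed time -/

section Operators

variable {d : ℕ} {t₀ s M N Cs : ℝ} {G₁ G₂ : Space d → ℝ}

theorem SymbolBound.bddSymbol {G : Space d → ℝ} (h : SymbolBound G M) :
    BddSymbol (scaled G) M := ⟨h.aestronglyMeasurable_scaled, h.scaled_bound⟩

theorem bddSymbol_div (hG : IsAdmissible G₁ G₂) :
    BddSymbol (fun ξ ↦ scaled G₂ ξ / scaled G₁ ξ) 1 := by
  obtain ⟨M₁, h₁⟩ := hG.bounded₁
  obtain ⟨M₂, h₂⟩ := hG.bounded₂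
  refine ⟨(h₂.aestronglyMeasurable_scaled.aemeasurable.div
    h₁.aestronglyMeasurable_scaled.aemeasurable).aestronglyMeasurable,
    Filter.Eventually.of_forall fun ξ ↦ ?_⟩
  have h := hG.pos ((2 * Real.pi) • ξ)
  rw [abs_div, scaled, scaled, abs_of_pos h, div_le_one h]
  exact hG.le _

/-- The bound for all the operators occurring in the linearized system. -/
def opBound (d : ℕ) (t₀ M Cs N : ℝ) : ℝ := 1 + M + 2 * (1 + 4 * M + Cs) * weightNorm d t₀ * N

/-- The operators of the linearized system at a fixed time, with coefficients whose Fourier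
transforms are `a₀` and `a j`. -/
def systemOps (ht₀ : (d : ℝ) / 2 < t₀) (hG : IsAdmissible G₁ G₂) (h₁ : SymbolBound G₁ M)
    (h₂ : SymbolBound G₂ M) (hCs : 0 ≤ Cs)
    (hk : ∀ j : Fin d, KerBound t₀ (max (t₀ + 1) s) Cs (bracketKer s j))
    {a₀ : Space d → ℂ} {a : Fin d → Space d → ℂ} (ha₀ : MemW (max (t₀ + 1) s) a₀)
    (ha : ∀ j, MemW (max (t₀ + 1) s) (a j)) (hN₀ : wnorm (max (t₀ + 1) s) a₀ ≤ N)
    (hN : ∀ j, wnorm (max (t₀ + 1) s) (a j) ≤ N) {α₀ : L2 d} {α : Fin d → L2 d}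
    (hα₀ : (𝓕 α₀ : L2 d) =ᵐ[volume] a₀) (hα : ∀ j, (𝓕 (α j) : L2 d) =ᵐ[volume] a j)
    (hr₀ : ∀ᵐ x, (α₀ x).im = 0) (hr : ∀ j, ∀ᵐ x, (α j x).im = 0) :
    SystemOps (L2 d) (Fin d) (opBound d t₀ M Cs N) :=
  have hσ : t₀ + 1 ≤ max (t₀ + 1) s := le_max_left _ _
  have hσ' : t₀ ≤ max (t₀ + 1) s := by linarith
  have hM : 0 ≤ M := h₁.nonneg
  have hk₁ := fun j ↦ kerBound_commKer hσ hM h₁.aestronglyMeasurable_scaled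
    h₁.scaled_exists_full_set j
  have hk₂ := fun j ↦ kerBound_commKer hσ hM h₂.aestronglyMeasurable_scaled
    h₂.scaled_exists_full_set j
  have hw := weightNorm_nonneg (d := d) t₀
  have hN0 : 0 ≤ N := (wnorm_nonneg _ _).trans hN₀
  have hP : 0 ≤ 2 * (1 + 4 * M + Cs) * weightNorm d t₀ * N := by positivity
  -- The kernel constants that occur are `1`, `4 M` and `Cs`; all are dominated by their sum.
  have hbd : ∀ {C ν : ℝ}, C ≤ 1 + 4 * M + Cs → 0 ≤ C → 0 ≤ ν → ν ≤ N →
      2 * C * weightNorm d t₀ * ν ≤ opBound d t₀ M Cs N := by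
    intro C ν h h0 h0' h'
    have : 2 * C * weightNorm d t₀ * ν ≤ 2 * (1 + 4 * M + Cs) * weightNorm d t₀ * N := by gcongr
    unfold opBound
    linarith
  have hMB : M ≤ opBound d t₀ M Cs N := by
    unfold opBound
    linarith
  { S := derivGraph
    g₁ := h₁.bddSymbol.l2Bounded.clm
    g₂ := h₂.bddSymbol.l2Bounded.clm
    m := (bddSymbol_div hG).l2Bounded.clm
    T₀ := coefOp ht₀ hσ' ha₀
    T := fun j ↦ coefOp ht₀ hσ' (ha j)
    dT₀ := fun j ↦ ((kerBound_dsym hσ j).l2Bounded ht₀ ha₀).clm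
    dT := fun j ↦ ((kerBound_dsym hσ j).l2Bounded ht₀ (ha j)).clm
    K₀ := fun j ↦ ((hk₂ j).l2Bounded ht₀ ha₀).clm
    K₁ := fun j ↦ ((hk₁ j).l2Bounded ht₀ (ha j)).clm
    K₂ := fun j ↦ ((hk₂ j).l2Bounded ht₀ (ha j)).clm
    C₀ := fun j ↦ ((hk j).l2Bounded ht₀ ha₀).clm
    C := fun j ↦ ((hk j).l2Bounded ht₀ (ha j)).clm
    one_le := by unfold opBound; linarith
    skew := isSkewGraph_derivGraph
    symm₁ := h₁.bddSymbol.isSymm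
    symm₂ := h₂.bddSymbol.isSymm
    symmT₀ := isSymm_coefOp ht₀ hσ' ha₀ hα₀ hr₀
    symmT := fun j ↦ isSymm_coefOp ht₀ hσ' (ha j) (hα j) (hr j)
    comm₁ := h₁.bddSymbol.commGraph
    comm₂ := h₂.bddSymbol.commGraph
    commm := (bddSymbol_div hG).commGraph
    g₁_m := h₁.bddSymbol.clm_clm (bddSymbol_div hG) h₂.bddSymbol
      fun ξ ↦ mul_div_cancel₀ _ (hG.pos _).ne'
    m_g₁ := (bddSymbol_div hG).clm_clm h₁.bddSymbol h₂.bddSymbol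
      fun ξ ↦ div_mul_cancel₀ _ (hG.pos _).ne'
    T₀_T := fun j x ↦ coefOp_comm ht₀ hσ' ha₀ hσ' (ha j) hα₀ (hα j) x
    leibniz₀ := leibnizGraph_coefOp ht₀ hσ ha₀
    leibniz := fun j ↦ leibnizGraph_coefOp ht₀ hσ (ha j) j
    commutator₀ := fun j ↦ commutatorGraph_commKer ht₀ hσ' ha₀ h₂.bddSymbol (hk₂ j)
    commutator₁ := fun j ↦ commutatorGraph_commKer ht₀ hσ' (ha j) h₁.bddSymbol (hk₁ j)
    commutator₂ := fun j ↦ commutatorGraph_commKer ht₀ hσ' (ha j) h₂.bddSymbol (hk₂ j)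
    norm_g₁ := h₁.bddSymbol.l2Bounded.norm_clm_le.trans hMB
    norm_g₂ := h₂.bddSymbol.l2Bounded.norm_clm_le.trans hMB
    norm_m := (bddSymbol_div hG).l2Bounded.norm_clm_le
    norm_T₀ := (L2Bounded.norm_clm_le _).trans
      (hbd (by linarith) zero_le_one (wnorm_nonneg _ _) hN₀)
    norm_T := fun j ↦ (L2Bounded.norm_clm_le _).trans
      (hbd (by linarith) zero_le_one (wnorm_nonneg _ _) (hN j))
    norm_dT₀ := fun j ↦ (L2Bounded.norm_clm_le _).trans
      (hbd (by linarith) zero_le_one (wnorm_nonneg _ _) hN₀)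
    norm_dT := fun j ↦ (L2Bounded.norm_clm_le _).trans
      (hbd (by linarith) zero_le_one (wnorm_nonneg _ _) (hN j))
    norm_K₀ := fun j ↦ (L2Bounded.norm_clm_le _).trans
      (hbd (by linarith) (by positivity) (wnorm_nonneg _ _) hN₀)
    norm_K₁ := fun j ↦ (L2Bounded.norm_clm_le _).trans
      (hbd (by linarith) (by positivity) (wnorm_nonneg _ _) (hN j))
    norm_K₂ := fun j ↦ (L2Bounded.norm_clm_le _).trans
      (hbd (by linarith) (by positivity) (wnorm_nonneg _ _) (hN j))
    norm_C₀ := fun j ↦ (L2Bounded.norm_clm_le _).trans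
      (hbd (by linarith) hCs (wnorm_nonneg _ _) hN₀)
    norm_C := fun j ↦ (L2Bounded.norm_clm_le _).trans
      (hbd (by linarith) hCs (wnorm_nonneg _ _) (hN j)) }

end Operators

/-! ### The equations in terms of the weighted unknowns -/

section LinearizedSystem

variable {d : ℕ} {t₀ s σ M Cs N ε : ℝ} {G₁ G₂ : Space d → ℝ}

/-- Matches the first row of `A_j`, multiplied by `⟨ξ⟩^s`, with the form required by
`SystemOps.energy_rate`. The weight passes through each convolution by `weight_mul_conv`, and `G₂ w`
is rewritten as the quotient `G₂ / G₁` acting on `V`. -/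
theorem weighted_fst (ht₀ : (d : ℝ) / 2 < t₀) (hσ : t₀ ≤ σ) (hG : IsAdmissible G₁ G₂)
    (h₁ : BddSymbol (scaled G₁) M) (h₂ : BddSymbol (scaled G₂) M)
    {a₀ a z w : Space d → ℂ} (ha₀ : MemW σ a₀) (ha : MemW σ a) {j : Fin d}
    (hk : KerBound t₀ σ Cs (bracketKer s j)) {Z DZ V DV : L2 d} (hDZ : derivGraph j Z DZ)
    (hDV : derivGraph j V DV) (hZ : Z =ᵐ[volume] fun ξ ↦ ((jb ξ ^ s : ℝ) : ℂ) * z ξ)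
    (hV : V =ᵐ[volume] fun ξ ↦ ((jb ξ ^ s : ℝ) : ℂ) * ((scaled G₁ ξ : ℂ) * w ξ)) :
    (((ε : ℂ) • h₂.l2Bounded.clm (coefOp ht₀ hσ ha DZ + (hk.l2Bounded ht₀ ha).clm Z) +
      h₁.l2Bounded.clm DV + (ε : ℂ) • h₂.l2Bounded.clm
        (coefOp ht₀ hσ ha₀ ((bddSymbol_div hG).l2Bounded.clm DV) +
          (hk.l2Bounded ht₀ ha₀).clm ((bddSymbol_div hG).l2Bounded.clm V)) : L2 d)) =ᵐ[volume]
    fun ξ ↦ ((jb ξ ^ s : ℝ) : ℂ) *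
      ((ε : ℂ) * ((scaled G₂ ξ : ℂ) * ∫ η, a (ξ - η) * (dsym j η * z η)) +
        (scaled G₁ ξ : ℂ) * ((scaled G₁ ξ : ℂ) * (dsym j ξ * w ξ)) +
        (ε : ℂ) * ((scaled G₂ ξ : ℂ) *
          ∫ η, a₀ (ξ - η) * (dsym j η * ((scaled G₂ η : ℂ) * w η)))) := by
  have hm := bddSymbol_div hG
  have hP : hm.l2Bounded.clm V =ᵐ[volume]
      fun ξ ↦ ((jb ξ ^ s : ℝ) : ℂ) * ((scaled G₂ ξ : ℂ) * w ξ) := by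
    filter_upwards [hm.coeFn V, hV] with ξ e1 e2
    have h0 : (scaled G₁ ξ : ℂ) ≠ 0 := Complex.ofReal_ne_zero.2 (hG.pos _).ne'
    rw [e1, e2]
    push_cast
    field_simp
  have e1 := weight_mul_conv ht₀ hσ ha hk hDZ hZ
  have e2 := weight_mul_conv ht₀ hσ ha₀ hk (hm.commGraph j hDV) hP
  refine (Lp.coeFn_add _ _).trans ?_
  filter_upwards [e1, e2, hV, hDV,
    Lp.coeFn_add ((ε : ℂ) • h₂.l2Bounded.clm (coefOp ht₀ hσ ha DZ + (hk.l2Bounded ht₀ ha).clm Z))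
      (h₁.l2Bounded.clm DV),
    Lp.coeFn_smul (ε : ℂ) (h₂.l2Bounded.clm
      (coefOp ht₀ hσ ha DZ + (hk.l2Bounded ht₀ ha).clm Z)),
    Lp.coeFn_smul (ε : ℂ) (h₂.l2Bounded.clm (coefOp ht₀ hσ ha₀ (hm.l2Bounded.clm DV) +
          (hk.l2Bounded ht₀ ha₀).clm (hm.l2Bounded.clm V))),
    h₁.coeFn DV, h₂.coeFn (coefOp ht₀ hσ ha DZ + (hk.l2Bounded ht₀ ha).clm Z),
    h₂.coeFn (coefOp ht₀ hσ ha₀ (hm.l2Bounded.clm DV) +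
          (hk.l2Bounded ht₀ ha₀).clm (hm.l2Bounded.clm V))]
    with ξ f1 f2 f3 f4 f5 f6 f7 f8 f9 f10
  rw [Pi.add_apply, f5, Pi.add_apply, f6, f7, Pi.smul_apply, Pi.smul_apply, f8, f9, f10, ← f1,
    ← f2, f4, f3, smul_eq_mul, smul_eq_mul]
  ring

theorem weighted_snd (ht₀ : (d : ℝ) / 2 < t₀) (hσ : t₀ ≤ σ) (hG : IsAdmissible G₁ G₂)
    (h₁ : BddSymbol (scaled G₁) M)
    {a w : Space d → ℂ} (ha : MemW σ a) {j : Fin d}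
    (hk : KerBound t₀ σ Cs (bracketKer s j)) {V DV : L2 d}
    (hDV : derivGraph j V DV)
    (hV : V =ᵐ[volume] fun ξ ↦ ((jb ξ ^ s : ℝ) : ℂ) * ((scaled G₁ ξ : ℂ) * w ξ)) :
    ((ε : ℂ) • h₁.l2Bounded.clm
        (coefOp ht₀ hσ ha ((bddSymbol_div hG).l2Bounded.clm DV) +
          (hk.l2Bounded ht₀ ha).clm ((bddSymbol_div hG).l2Bounded.clm V)) : L2 d) =ᵐ[volume]
    fun ξ ↦ ((jb ξ ^ s : ℝ) : ℂ) * ((scaled G₁ ξ : ℂ) *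
      ((ε : ℂ) * ∫ η, a (ξ - η) * (dsym j η * ((scaled G₂ η : ℂ) * w η)))) := by
  have hm := bddSymbol_div hG
  have hP : hm.l2Bounded.clm V =ᵐ[volume]
      fun ξ ↦ ((jb ξ ^ s : ℝ) : ℂ) * ((scaled G₂ ξ : ℂ) * w ξ) := by
    filter_upwards [hm.coeFn V, hV] with ξ e1 e2
    have h0 : (scaled G₁ ξ : ℂ) ≠ 0 := Complex.ofReal_ne_zero.2 (hG.pos _).ne'
    rw [e1, e2]
    push_cast
    field_simp
  have e2 := weight_mul_conv ht₀ hσ ha hk (hm.commGraph j hDV) hP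
  refine (Lp.coeFn_smul _ _).trans ?_
  filter_upwards [e2, h₁.coeFn (coefOp ht₀ hσ ha (hm.l2Bounded.clm DV) +
          (hk.l2Bounded ht₀ ha).clm (hm.l2Bounded.clm V))] with ξ f2 f10
  rw [Pi.smul_apply, f10, ← f2, smul_eq_mul]
  ring

theorem memLp_convolution (ht₀ : (d : ℝ) / 2 < t₀) (hσ : t₀ ≤ σ) {a f : Space d → ℂ}
    (ha : MemW σ a) (hf : MemLp f 2 volume) :
    MemLp (fun ξ ↦ ∫ η, a (ξ - η) * f η) 2 volume := by
  have h := (kerBound_one hσ).memLp_kerOp ht₀ ha hf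
  unfold kerOp at h
  simpa only [one_mul] using h

theorem norm_dsym_le_rpow (hs : 0 ≤ s) (j : Fin d) (ξ : Space d) : ‖dsym j ξ‖ ≤ jb ξ ^ (s + 1) := by
  refine (norm_dsym_le j ξ).trans ?_
  conv_lhs => rw [← Real.rpow_one (jb ξ)]
  exact Real.rpow_le_rpow_of_exponent_le (one_le_jb ξ) (by linarith)

theorem memLp_dsym_mul (hs : 0 ≤ s) {z : Space d → ℂ} (hz : MemW (s + 1) z) (j : Fin d) :
    MemLp (fun ξ ↦ dsym j ξ * z ξ) 2 volume := by
  refine MemLp.of_le hz ((continuous_dsym j).aestronglyMeasurable.mul hz.aestronglyMeasurable)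
    (Filter.Eventually.of_forall fun ξ ↦ ?_)
  rw [norm_mul, norm_mul, Complex.norm_real, Real.norm_of_nonneg (Real.rpow_nonneg (jb_pos ξ).le _)]
  gcongr
  exact norm_dsym_le_rpow hs j ξ

theorem memLp_symbol_dsym_smul (hs : 0 ≤ s) {G : Space d → ℝ} (hG : ∀ ξ, |G ξ| ≤ G₁ ξ)
    (hGm : AEStronglyMeasurable (scaled G) volume) {w : Space d → CVec d}
    (hwm : AEStronglyMeasurable w volume)
    (hw : MemLp (weighted G₁ (s + 1) w) 2 volume) (j : Fin d) :
    MemLp (fun ξ ↦ (scaled G ξ : ℂ) • (dsym j ξ • w ξ)) 2 volume := by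
  refine MemLp.of_le hw ((Complex.continuous_ofReal.comp_aestronglyMeasurable hGm).smul
    ((continuous_dsym j).aestronglyMeasurable.smul hwm)) (Filter.Eventually.of_forall fun ξ ↦ ?_)
  rw [weighted_apply, norm_smul, norm_smul, norm_smul, Complex.ofReal_mul, norm_mul,
    Complex.norm_real, Complex.norm_real, Complex.norm_real,
    Real.norm_of_nonneg (Real.rpow_nonneg (jb_pos ξ).le _), ← mul_assoc, mul_comm (‖scaled G ξ‖)]
  have h1 : ‖scaled G ξ‖ ≤ ‖scaled G₁ ξ‖ := (hG _).trans (le_abs_self _)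
  have h2 := norm_dsym_le_rpow hs j ξ
  gcongr
  exact Real.rpow_nonneg (jb_pos ξ).le _

theorem memLp_component {f : Space d → CVec d} (hf : MemLp f 2 volume) (k : Fin d) :
    MemLp (fun ξ ↦ f ξ k) 2 volume :=
  (EuclideanSpace.proj k : CVec d →L[ℂ] ℂ).comp_memLp' hf

/-- The multipliers and products in `opA` take default values outside L², so the content here is
that each intermediate function is square integrable. This uses the extra derivative on `U`, and
`|G₂| ≤ G₁` for the velocity. -/
theorem hasFourierFun_opA_fst (ht₀ : (d : ℝ) / 2 < t₀) (hσ : t₀ ≤ σ) (hs : 0 ≤ s)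
    (hG : IsAdmissible G₁ G₂)
    (h₁ : BddSymbol (scaled G₁) M) (h₂ : BddSymbol (scaled G₂) M) {Ubar U : State d}
    {a₀ z : Space d → ℂ} {a : Fin d → Space d → ℂ} {w : Space d → CVec d}
    (ha₀ : MemW σ a₀) (ha : ∀ j, MemW σ (a j)) (ha₀' : HasFourierFun Ubar.1 a₀)
    (ha' : ∀ j, HasFourierFun (mult G₂ (comp j Ubar.2)) (a j)) (hU : MemX G₁ (s + 1) U)
    (hz : HasFourierFun U.1 z) (hw : HasFourierFun U.2 w) (j : Fin d) :
    HasFourierFun (opA ε G₁ G₂ Ubar j (partialD j U)).1 (fun ξ ↦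
      (ε : ℂ) * ((scaled G₂ ξ : ℂ) * ∫ η, a j (ξ - η) * (dsym j η * z η)) +
        (scaled G₁ ξ : ℂ) * ((scaled G₁ ξ : ℂ) * (dsym j ξ * w ξ j)) +
        (ε : ℂ) * ((scaled G₂ ξ : ℂ) *
          ∫ η, a₀ (ξ - η) * (dsym j η * ((scaled G₂ η : ℂ) * w η j)))) := by
  have h0 : 0 ≤ σ := (nonneg_of_half_lt ht₀).trans hσ
  have m1 := memLp_dsym_mul hs (hU.1.memW hz) j
  have m2 : MemLp (fun ξ ↦ (scaled G₂ ξ : ℂ) * (dsym j ξ * w ξ j)) 2 volume := memLp_component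
    (memLp_symbol_dsym_smul hs hG.le h₂.meas hw.aestronglyMeasurable (hU.2.memLp hw) j) j
  have m3 : MemLp (fun ξ ↦ (scaled G₁ ξ : ℂ) * (dsym j ξ * w ξ j)) 2 volume := memLp_component
    (memLp_symbol_dsym_smul hs (fun ξ ↦ (abs_of_pos (hG.pos ξ)).le) h₁.meas
      hw.aestronglyMeasurable (hU.2.memLp hw) j) j
  have hw' : HasFourierFun (comp j (partialD j U).2) (fun ξ ↦ dsym j ξ * w ξ j) :=
    (hw.lineDeriv j).comp j
  have f1 : HasFourierFun (mult G₂ (prod (mult G₂ (comp j Ubar.2)) (partialD j U).1))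
      (fun ξ ↦ (scaled G₂ ξ : ℂ) * ∫ η, a j (ξ - η) * (dsym j η * z η)) :=
    ((ha' j).prod ((ha j).memLp h0) (hz.lineDeriv j) m1).mult
      (h₂.l2Bounded.memLp _ (memLp_convolution ht₀ hσ (ha j) m1))
  have f2 : HasFourierFun (mult G₁ (mult G₁ (comp j (partialD j U).2)))
      (fun ξ ↦ (scaled G₁ ξ : ℂ) * ((scaled G₁ ξ : ℂ) * (dsym j ξ * w ξ j))) :=
    (hw'.mult m3).mult (h₁.l2Bounded.memLp _ m3)
  have f3 : HasFourierFun (mult G₂ (prod Ubar.1 (mult G₂ (comp j (partialD j U).2))))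
      (fun ξ ↦ (scaled G₂ ξ : ℂ) * ∫ η, a₀ (ξ - η) * ((scaled G₂ η : ℂ) * (dsym j η * w η j))) :=
    (ha₀'.prod (ha₀.memLp h0) (hw'.mult m2) m2).mult
      (h₂.l2Bounded.memLp _ (memLp_convolution ht₀ hσ ha₀ m2))
  simp only [mul_left_comm ((scaled G₂ _ : ℝ) : ℂ) (dsym _ _)] at f3
  exact ((f1.smul _).add f2).add (f3.smul _)

theorem hasFourierFun_opA_snd (ht₀ : (d : ℝ) / 2 < t₀) (hσ : t₀ ≤ σ) (hs : 0 ≤ s)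
    (hG : IsAdmissible G₁ G₂) (h₂ : BddSymbol (scaled G₂) M) {Ubar U : State d}
    {z : Space d → ℂ} {a : Fin d → Space d → ℂ} {w : Space d → CVec d}
    (ha : ∀ j, MemW σ (a j))
    (ha' : ∀ j, HasFourierFun (mult G₂ (comp j Ubar.2)) (a j)) (hU : MemX G₁ (s + 1) U)
    (hz : HasFourierFun U.1 z) (hw : HasFourierFun U.2 w) (j k : Fin d) :
    HasFourierFun (comp k (opA ε G₁ G₂ Ubar j (partialD j U)).2) (fun ξ ↦
      (if j = k then dsym k ξ * z ξ else 0) +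
        (ε : ℂ) * ∫ η, a j (ξ - η) * (dsym j η * ((scaled G₂ η : ℂ) * w η k))) := by
  have h0 : 0 ≤ σ := (nonneg_of_half_lt ht₀).trans hσ
  have m2 := memLp_symbol_dsym_smul hs hG.le h₂.meas hw.aestronglyMeasurable (hU.2.memLp hw) j
  have f1 := (hz.lineDeriv j).single j
  have f2 := (ha' j).prod ((ha j).memLp h0) ((hw.lineDeriv j).mult m2) m2
  refine ((f1.add (f2.smul (ε : ℂ))).comp k).congr (Filter.Eventually.of_forall fun ξ ↦ ?_)
  have f3 := (EuclideanSpace.proj k : CVec d →L[ℂ] ℂ).integral_comp_comm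
    (convolution_memLp_integrable ((ha j).memLp h0) m2 ξ)
  simp only [PiLp.proj_apply, PiLp.smul_apply, smul_eq_mul, PiLp.add_apply] at f3 ⊢
  rw [← f3]
  simp only [mul_left_comm ((scaled G₂ _ : ℝ) : ℂ) (dsym _ _)]
  congr 1
  by_cases h : j = k
  · subst h
    simp
  · simp [h, Ne.symm h]

end LinearizedSystem

/-! ### The energy rate for solutions at a fixed time -/

section FixedTime

variable {d : ℕ} {t₀ s σ M Cs N ε : ℝ} {G₁ G₂ : Space d → ℝ}

/-- The weighted Fourier transform of the velocity component `G₁[v_k]`. -/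
def liftV (G₁ : Space d → ℝ) (s : ℝ) (U : State d) (k : Fin d) : L2 d :=
  compL2 k (lift G₁ s U.2)

/-- The multiplication by `G₂ / G₁`. -/
def quotientOp (hG : IsAdmissible G₁ G₂) : L2 d →L[ℂ] L2 d := (bddSymbol_div hG).l2Bounded.clm

theorem norm_quotientOp_le (hG : IsAdmissible G₁ G₂) : ‖quotientOp hG‖ ≤ 1 :=
  (bddSymbol_div hG).l2Bounded.norm_clm_le

/-- Membership in `X^{s+1}` puts the derivatives of the lifts in L², so that the energy identity can
be applied without regularization. -/
theorem exists_derivGraph_lift {U : State d} (hU : MemX G₁ s U) (hU1 : MemX G₁ (s + 1) U)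
    (j : Fin d) : (∃ f', derivGraph j (lift (fun _ ↦ 1) s U.1) f') ∧
      ∀ k, ∃ f', derivGraph j (liftV G₁ s U k) f' := by
  obtain ⟨z, hz, -⟩ := hU.1
  obtain ⟨w, hw, -⟩ := hU.2
  refine ⟨exists_derivGraph (F := lift (fun _ ↦ 1) (s + 1) U.1) ?_ j,
    fun k ↦ exists_derivGraph (F := liftV G₁ (s + 1) U k) ?_ j⟩
  · filter_upwards [hU.1.coeFn_lift_one hz, hU1.1.coeFn_lift_one hz] with ξ h1 h2
    rw [h1, h2, jb_mul_rpow]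
  · filter_upwards [hU.2.coeFn_compL2_lift hw k, hU1.2.coeFn_compL2_lift hw k] with ξ h1 h2
    rw [liftV, liftV, h1, h2, jb_mul_rpow]

theorem add_sum_eq_smul {ι : Type*} [Fintype ι] {X Y : L2 d} {Q : ι → L2 d} {c : ℂ}
    {x y : Space d → ℂ} {q : ι → Space d → ℂ} (hX : X =ᵐ[volume] x) (hY : Y =ᵐ[volume] y)
    (hQ : ∀ j, Q j =ᵐ[volume] q j) (h : ∀ᵐ ξ, x ξ + ∑ j, q j ξ = c * y ξ) :
    X + ∑ j, Q j = c • Y := by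
  refine Lp.ext ?_
  refine (Lp.coeFn_add _ _).trans (Filter.EventuallyEq.trans ?_ (Lp.coeFn_smul _ _).symm)
  filter_upwards [hX, hY, ae_all_iff.2 hQ, h, Lp.coeFn_fun_finsetSum Finset.univ Q]
    with ξ e1 e2 e3 e4 e5
  rw [Pi.add_apply, Pi.smul_apply, e1, e2, e5, Finset.sum_congr rfl fun j _ ↦ e3 j, e4, smul_eq_mul]

/-- The rate of change of the energy for solutions of the linearized system. -/
theorem linearized_energy_rate (ht₀ : (d : ℝ) / 2 < t₀) (hs : 0 ≤ s) (hG : IsAdmissible G₁ G₂)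
    (h₁ : SymbolBound G₁ M) (h₂ : SymbolBound G₂ M) (hCs : 0 ≤ Cs)
    (hk : ∀ j : Fin d, KerBound t₀ (max (t₀ + 1) s) Cs (bracketKer s j))
    (hε : 0 < ε) (hε1 : ε ≤ 1) {Ubar U dU R : State d} (hbar₀ : MemX G₁ t₀ Ubar)
    (hbar : MemX G₁ (max (t₀ + 1) s) Ubar) (hreal : HasRealCoefficients G₂ Ubar)
    (hU : MemX G₁ s U) (hU1 : MemX G₁ (s + 1) U) (hdU : MemX G₁ s dU) (hR : MemX G₁ s R)
    (heq : dU + ∑ j, opA ε G₁ G₂ Ubar j (partialD j U) = (ε : ℂ) • R)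
    (hN : normX G₁ (max (t₀ + 1) s) Ubar ≤ N) :
    rinner (lift (fun _ ↦ 1) s U.1) (lift (fun _ ↦ 1) s dU.1) +
      ∑ k, rinner (liftV G₁ s U k) (liftV G₁ s dU k) +
      ε * ∑ k, rinner (quotientOp hG (liftV G₁ s dU k))
        (convBilin ht₀ (lift (fun _ ↦ 1) t₀ Ubar.1) (quotientOp hG (liftV G₁ s U k))) ≤
      ε * (10 * (1 + d) * opBound d t₀ M Cs N ^ 3) *
        (‖lift (fun _ ↦ 1) s U.1‖ ^ 2 + ∑ k, ‖liftV G₁ s U k‖ ^ 2) +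
      ε * (2 * opBound d t₀ M Cs N) * (‖lift (fun _ ↦ 1) s U.1‖ * ‖lift (fun _ ↦ 1) s R.1‖ +
        ∑ k, ‖liftV G₁ s U k‖ * ‖liftV G₁ s R k‖) := by
  have hσ : t₀ ≤ max (t₀ + 1) s := (by linarith : t₀ ≤ t₀ + 1).trans (le_max_left _ _)
  have hσ0 : 0 ≤ max (t₀ + 1) s := (nonneg_of_half_lt ht₀).trans hσ
  obtain ⟨a₀, ha₀, -⟩ := hbar.1
  obtain ⟨b, hb, -⟩ := hbar.2
  obtain ⟨z, hz, -⟩ := hU.1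
  obtain ⟨w, hw, -⟩ := hU.2
  obtain ⟨z', hz', -⟩ := hdU.1
  obtain ⟨w', hw', -⟩ := hdU.2
  obtain ⟨r, hr, -⟩ := hR.1
  obtain ⟨q, hq, -⟩ := hR.2
  have hW₀ := hbar.1.memW ha₀
  have hW := memW_component hbar.2 hb hG.le h₂.aestronglyMeasurable_scaled
  have ha : ∀ j, HasFourierFun (mult G₂ (comp j Ubar.2)) (fun ξ ↦ (scaled G₂ ξ : ℂ) * b ξ j) :=
    fun j ↦ (hb.comp j).mult ((hW j).1.memLp hσ0)
  have hn1 := norm_nonneg (lift (fun _ ↦ 1) (max (t₀ + 1) s) Ubar.1)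
  have hn2 := norm_nonneg (lift G₁ (max (t₀ + 1) s) Ubar.2)
  have hNN := hN
  rw [normX] at hNN
  have hN₀ : wnorm (max (t₀ + 1) s) a₀ ≤ N := by
    rw [hbar.1.wnorm_eq ha₀]
    linarith
  have hN' : ∀ j, wnorm (max (t₀ + 1) s) (fun ξ ↦ (scaled G₂ ξ : ℂ) * b ξ j) ≤ N := fun j ↦
    (hW j).2.trans (by linarith)
  have hα₀ : (𝓕 (toL2 Ubar.1) : L2 d) =ᵐ[volume] a₀ := by
    rw [ha₀.fourier_toL2 (hW₀.memLp hσ0)]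
    exact MemLp.coeFn_toLp _
  have hα : ∀ j, (𝓕 (toL2 (mult G₂ (comp j Ubar.2))) : L2 d) =ᵐ[volume]
      fun ξ ↦ (scaled G₂ ξ : ℂ) * b ξ j := fun j ↦ by
    rw [(ha j).fourier_toL2 ((hW j).1.memLp hσ0)]
    exact MemLp.coeFn_toLp _
  let O := systemOps ht₀ hG h₁ h₂ hCs hk hW₀ (fun j ↦ (hW j).1) hN₀ hN' hα₀ hα hreal.1 hreal.2
  have hDZ := fun j ↦ (exists_derivGraph_lift hU hU1 j).1
  have hDV := fun j ↦ (exists_derivGraph_lift hU hU1 j).2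
  choose DZ hDZ using hDZ
  choose DV hDV using hDV
  have eZ := hU.1.coeFn_lift_one hz
  have eV : ∀ k, liftV G₁ s U k =ᵐ[volume] _ := fun k ↦ hU.2.coeFn_compL2_lift hw k
  have eq1 : dU.1 + ∑ j, (opA ε G₁ G₂ Ubar j (partialD j U)).1 = (ε : ℂ) • R.1 := by
    rw [← Prod.smul_fst, ← heq, Prod.fst_add, Prod.fst_sum]
  have eq2 : ∀ k, comp k dU.2 + ∑ j, comp k (opA ε G₁ G₂ Ubar j (partialD j U)).2 =
      (ε : ℂ) • comp k R.2 := fun k ↦ by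
    have e1 : dU.2 + ∑ j, (opA ε G₁ G₂ Ubar j (partialD j U)).2 = (ε : ℂ) • R.2 := by
      rw [← Prod.smul_snd, ← heq, Prod.snd_add, Prod.snd_sum]
    have e2 := congrArg (comp k) e1
    simpa only [comp, map_add, map_sum, map_smul] using e2
  have f1 := (hz'.add (HasFourierFun.sum Finset.univ fun j _ ↦ hasFourierFun_opA_fst ht₀ hσ hs hG
    h₁.bddSymbol h₂.bddSymbol (ε := ε) hW₀ (fun j ↦ (hW j).1) ha₀ ha hU1 hz hw j))
  rw [eq1] at f1
  -- Uniqueness of the Fourier function turns the equation between distributions into an identity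
  -- for almost every `ξ`.
  have f1 := f1.ae_eq (hr.smul (ε : ℂ))
  have f2 : ∀ k, _ := fun k ↦ ((hw'.comp k).add (HasFourierFun.sum Finset.univ fun j _ ↦
    hasFourierFun_opA_snd ht₀ hσ hs hG h₂.bddSymbol (ε := ε) (fun j ↦ (hW j).1) ha hU1 hz hw j k))
  simp only [eq2] at f2
  have f2 := fun k ↦ (f2 k).ae_eq ((hq.comp k).smul (ε : ℂ))
  have main := O.energy_rate hε hε1 (Z := lift (fun _ ↦ 1) s U.1) (Z' := lift (fun _ ↦ 1) s dU.1)
    (R₁ := lift (fun _ ↦ 1) s R.1) (V := liftV G₁ s U) (V' := liftV G₁ s dU)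
    (R₂ := liftV G₁ s R) hDZ hDV ?_ ?_
  · rw [Fintype.card_fin] at main
    rw [← coefOp_eq_convBilin ht₀ hσ hbar₀.1 ha₀ hW₀]
    exact main
  · have g := fun j ↦ weighted_fst (ε := ε) ht₀ hσ hG h₁.bddSymbol h₂.bddSymbol hW₀ (hW j).1 (hk j)
      (hDZ j) (hDV j j) eZ (eV j)
    refine add_sum_eq_smul (hdU.1.coeFn_lift_one hz') (hR.1.coeFn_lift_one hr) g ?_
    filter_upwards [f1] with ξ e3
    rw [smul_eq_mul] at e3
    rw [← Finset.mul_sum, ← mul_add, e3]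
    ring
  · intro k
    have g := fun j ↦ weighted_snd (ε := ε) ht₀ hσ hG h₁.bddSymbol (hW j).1 (hk j)
      (hDV j k) (eV k)
    have g0 : (liftV G₁ s dU k + h₁.bddSymbol.l2Bounded.clm (DZ k) : L2 d) =ᵐ[volume] fun ξ ↦
        ((jb ξ ^ s : ℝ) : ℂ) * ((scaled G₁ ξ : ℂ) * (w' ξ k + dsym k ξ * z ξ)) := by
      filter_upwards [hdU.2.coeFn_compL2_lift hw' k, h₁.bddSymbol.coeFn (DZ k), hDZ k, eZ,
        Lp.coeFn_add (liftV G₁ s dU k) (h₁.bddSymbol.l2Bounded.clm (DZ k))] with ξ e1 e2 e3 e4 e5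
      rw [e5, Pi.add_apply, e2, e3, e4, liftV, e1]
      ring
    refine (add_assoc _ _ _).symm.trans
      (add_sum_eq_smul g0 (hR.2.coeFn_compL2_lift hq k) g ?_)
    filter_upwards [f2 k] with ξ e3
    simp only [Finset.sum_add_distrib, Finset.sum_ite_eq', Finset.mem_univ, if_true,
      smul_eq_mul] at e3
    rw [← Finset.mul_sum, ← Finset.mul_sum]
    linear_combination ((jb ξ ^ s : ℝ) : ℂ) * (scaled G₁ ξ : ℂ) * e3

end FixedTime

/-! ### Lipschitz curves and a Grönwall inequality -/

section TimeCalculus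

open Topology NNReal

theorem intervalIntegrable_of_memLp_top {E : Type*} [NormedAddCommGroup E] {τ : ℝ} (hτ : 0 ≤ τ)
    {f : ℝ → E} (hf : MemLp f ⊤ (timeMeasure τ)) : IntervalIntegrable f volume 0 τ := by
  rw [intervalIntegrable_iff_integrableOn_Icc_of_le hτ]
  exact hf.integrable le_top

/-- Primitives of bounded functions are Lipschitz continuous, and differentiable almost
everywhere. -/
theorem lipschitz_hasDerivAt_of_eq_integral {E : Type*} [NormedAddCommGroup E] [NormedSpace ℝ E]
    [CompleteSpace E] {τ : ℝ} (hτ : 0 ≤ τ) {p p' : ℝ → E} (hp' : MemLp p' ⊤ (timeMeasure τ))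
    (hp : ∀ t ∈ Icc 0 τ, p t = p 0 + ∫ r in (0 : ℝ)..t, p' r) :
    (∃ C, LipschitzOnWith C p (Icc 0 τ)) ∧ ∀ᵐ t ∂timeMeasure τ, HasDerivAt p (p' t) t := by
  have hi := intervalIntegrable_of_memLp_top hτ hp'
  constructor
  · set C := (eLpNorm p' ⊤ (timeMeasure τ)).toNNReal with hC
    have hb : ∀ᵐ r ∂timeMeasure τ, ‖p' r‖ ≤ C := by
      filter_upwards [enorm_ae_le_eLpNormEssSup p' (timeMeasure τ)] with r hr
      rw [← eLpNorm_exponent_top, ← ENNReal.coe_toNNReal hp'.2.ne] at hr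
      exact_mod_cast hr
    rw [ae_restrict_iff' measurableSet_Icc] at hb
    refine ⟨C, LipschitzOnWith.of_dist_le_mul fun x hx y hy ↦ ?_⟩
    have hsub : ∀ {z}, z ∈ Icc 0 τ → IntervalIntegrable p' volume 0 z := fun {z} hz ↦
      hi.mono_set (by rw [uIcc_of_le hz.1, uIcc_of_le hτ]; exact Icc_subset_Icc_right hz.2)
    rw [dist_eq_norm, hp x hx, hp y hy, add_sub_add_left_eq_sub,
      intervalIntegral.integral_interval_sub_left (hsub hx) (hsub hy), Real.dist_eq]
    refine intervalIntegral.norm_integral_le_of_norm_le_const_ae ?_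
    filter_upwards [hb] with r hr h
    refine hr ?_
    have := uIoc_subset_uIcc h
    exact (convex_Icc (0 : ℝ) τ).ordConnected.uIcc_subset hy hx this
  · have h1 := hi.ae_hasDerivAt_integral
    have h2 : ∀ᵐ t, t ∈ Icc 0 τ → t ∈ Ioo 0 τ := by
      filter_upwards [Measure.ae_ne volume (0 : ℝ), Measure.ae_ne volume τ] with t h0 h1 h
      exact ⟨lt_of_le_of_ne h.1 h0.symm, lt_of_le_of_ne h.2 h1⟩
    rw [ae_restrict_iff' measurableSet_Icc]
    filter_upwards [h1, h2] with t h3 h4 h5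
    have h6 := h4 h5
    have h7 := (h3 (by rwa [uIcc_of_le hτ]) 0 left_mem_uIcc).const_add (p 0)
    refine h7.congr_of_eventuallyEq ?_
    filter_upwards [Ioo_mem_nhds h6.1 h6.2] with x hx
    exact hp x ⟨hx.1.le, hx.2.le⟩

/-- The shift by `δ` makes the square root Lipschitz on the half line, so that its composition with
the energy remains absolutely continuous even where the energy vanishes. -/
theorem abs_sqrt_sub_sqrt_le {δ x y : ℝ} (hδ : 0 < δ) (hx : 0 ≤ x) (hy : 0 ≤ y) :
    |√(x + δ) - √(y + δ)| ≤ (√δ)⁻¹ * |x - y| := by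
  have h1 : √δ ≤ √(x + δ) + √(y + δ) := by
    have := Real.sqrt_le_sqrt (by linarith : δ ≤ x + δ)
    have := Real.sqrt_nonneg (y + δ)
    linarith
  have h2 := Real.sqrt_pos.2 hδ
  rw [← div_eq_inv_mul, le_div_iff₀ h2]
  calc |√(x + δ) - √(y + δ)| * √δ ≤ |√(x + δ) - √(y + δ)| * (√(x + δ) + √(y + δ)) := by gcongr
    _ = |(√(x + δ) - √(y + δ)) * (√(x + δ) + √(y + δ))| := by
        rw [abs_mul, abs_of_nonneg (h2.le.trans h1)]
    _ = |x - y| := by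
        congr 1
        have e1 := Real.sq_sqrt (by linarith : 0 ≤ x + δ)
        have e2 := Real.sq_sqrt (by linarith : 0 ≤ y + δ)
        nlinarith

/-- Dividing the differential inequality by `2 √(E + δ)` makes it linear. The function `exp (-Λ x)
√(E + δ)` is absolutely continuous and its derivative is at most `L r`; integrate, then let `δ` tend
to zero. -/
theorem sqrt_le_of_ae_deriv_le {E r : ℝ → ℝ} {τ Λ L : ℝ} {K : ℝ≥0} (hL : 0 ≤ L) (hΛ : 0 ≤ Λ)
    (hE : LipschitzOnWith K E (Icc 0 τ)) (hE0 : ∀ t ∈ Icc 0 τ, 0 ≤ E t)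
    (hr : IntervalIntegrable r volume 0 τ) (hr0 : ∀ t, 0 ≤ r t)
    (h : ∀ᵐ t ∂timeMeasure τ, ∃ E', HasDerivAt E E' t ∧ E' ≤ 2 * Λ * E t + 2 * L * √(E t) * r t)
    {t : ℝ} (ht : t ∈ Icc 0 τ) :
    √(E t) ≤ Real.exp (Λ * t) * (√(E 0) + L * ∫ x in (0 : ℝ)..t, r x) := by
  have key : ∀ δ : ℝ, 0 < δ →
      √(E t) ≤ Real.exp (Λ * t) * (√(E 0 + δ) + L * ∫ x in (0 : ℝ)..t, r x) := by
    intro δ hδ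
    have hsub : Icc 0 t ⊆ Icc 0 τ := Icc_subset_Icc_right ht.2
    have hri : IntervalIntegrable r volume 0 t :=
      hr.mono_set (by rwa [uIcc_of_le ht.1, uIcc_of_le (ht.1.trans ht.2)])
    have a1 : AbsolutelyContinuousOnInterval (fun x ↦ √(E x + δ)) 0 t := by
      refine LipschitzOnWith.absolutelyContinuousOnInterval (K := (√δ)⁻¹.toNNReal * K) ?_
      rw [uIcc_of_le ht.1]
      refine LipschitzOnWith.of_dist_le_mul fun x hx y hy ↦ ?_
      rw [NNReal.coe_mul, Real.coe_toNNReal _ (by positivity), mul_assoc, Real.dist_eq]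
      refine (abs_sqrt_sub_sqrt_le hδ (hE0 x (hsub hx)) (hE0 y (hsub hy))).trans ?_
      gcongr
      exact hE.dist_le_mul x (hsub hx) y (hsub hy)
    have a2 : AbsolutelyContinuousOnInterval (fun x ↦ Real.exp (-Λ * x)) 0 t :=
      ContDiffOn.absolutelyContinuousOnInterval (by fun_prop)
    have a3 := a2.fun_mul a1
    have h1 := a3.integral_deriv_eq_sub
    have h2 : ∫ x in (0 : ℝ)..t, deriv (fun x ↦ Real.exp (-Λ * x) * √(E x + δ)) x ≤
        ∫ x in (0 : ℝ)..t, L * r x := by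
      refine intervalIntegral.integral_mono_ae_restrict ht.1 a3.intervalIntegrable_deriv
        (hri.const_mul L) ?_
      have h' := ae_mono (Measure.restrict_mono_set volume hsub) h
      filter_upwards [h', ae_restrict_mem measurableSet_Icc] with x ⟨E', h3, h4⟩ hx
      have hEx := hE0 x (hsub hx)
      have hy : 0 < √(E x + δ) := Real.sqrt_pos.2 (by linarith)
      have h5 : HasDerivAt (fun x ↦ Real.exp (-Λ * x)) (Real.exp (-Λ * x) * -Λ) x := by
        simpa using ((hasDerivAt_id x).const_mul (-Λ)).exp
      have h6 := h5.mul ((h3.add_const δ).sqrt (by linarith))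
      have h7 : deriv (fun x ↦ Real.exp (-Λ * x) * √(E x + δ)) x = _ := h6.deriv
      rw [h7]
      have h8 : √(E x) ≤ √(E x + δ) := Real.sqrt_le_sqrt (by linarith)
      have h9 : √(E x + δ) ^ 2 = E x + δ := Real.sq_sqrt (by linarith)
      have h10 : E' / (2 * √(E x + δ)) ≤ Λ * √(E x + δ) + L * r x := by
        rw [div_le_iff₀ (by positivity)]
        have h11 : 2 * L * √(E x) * r x ≤ 2 * L * √(E x + δ) * r x := by
          have := hr0 x
          gcongr
        nlinarith [mul_nonneg hΛ hδ.le]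
      have h12 : Real.exp (-Λ * x) ≤ 1 := by
        rw [Real.exp_le_one_iff]
        nlinarith [hx.1]
      calc Real.exp (-Λ * x) * -Λ * √(E x + δ) + Real.exp (-Λ * x) * (E' / (2 * √(E x + δ)))
          = Real.exp (-Λ * x) * (E' / (2 * √(E x + δ)) - Λ * √(E x + δ)) := by ring
        _ ≤ Real.exp (-Λ * x) * (L * r x) := by gcongr; linarith
        _ ≤ 1 * (L * r x) := by
          have := mul_nonneg hL (hr0 x)
          gcongr
        _ = L * r x := one_mul _
    rw [intervalIntegral.integral_const_mul, h1] at h2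
    simp only [mul_zero, Real.exp_zero, one_mul] at h2
    have h3 : √(E t) ≤ √(E t + δ) := Real.sqrt_le_sqrt (by linarith)
    refine h3.trans ?_
    have h4 : √(E t + δ) = Real.exp (Λ * t) * (Real.exp (-Λ * t) * √(E t + δ)) := by
      rw [← mul_assoc, ← Real.exp_add]
      simp
    rw [h4]
    gcongr
    linarith
  have hlim : Filter.Tendsto (fun δ : ℝ ↦
      Real.exp (Λ * t) * (√(E 0 + δ) + L * ∫ x in (0 : ℝ)..t, r x)) (𝓝[>] 0)
      (𝓝 (Real.exp (Λ * t) * (√(E 0 + 0) + L * ∫ x in (0 : ℝ)..t, r x))) := by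
    refine Filter.Tendsto.mono_left (Continuous.tendsto ?_ 0) nhdsWithin_le_nhds
    fun_prop
  rw [add_zero] at hlim
  refine ge_of_tendsto hlim ?_
  filter_upwards [self_mem_nhdsWithin] with δ hδ using key δ hδ

end TimeCalculus

/-! ### Differentiating quadratic expressions -/

section HilbertCalculus

variable {H : Type*} [NormedAddCommGroup H] [InnerProductSpace ℂ H] [NormedSpace ℝ H]

theorem contDiff_rinner {E : Type*} [NormedAddCommGroup E] [NormedSpace ℝ E] {f g : E → H}
    (hf : ContDiff ℝ 1 f) (hg : ContDiff ℝ 1 g) : ContDiff ℝ 1 fun x ↦ rinner (f x) (g x) :=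
  Complex.reCLM.contDiff.comp (hf.inner ℂ hg)

theorem contDiff_rinner_bilin [IsScalarTower ℝ ℂ H] {E : Type*} [NormedAddCommGroup E] [NormedSpace ℝ E]
    (Q : H →L[ℂ] H) (L : H →L[ℂ] H →L[ℂ] H) {f g : E → H} (hf : ContDiff ℝ 1 f)
    (hg : ContDiff ℝ 1 g) : ContDiff ℝ 1 fun x ↦ rinner (Q (f x)) (L (g x) (Q (f x))) := by
  have h2 : ContDiff ℝ 1 fun x ↦ Q (f x) := (Q.contDiff.restrict_scalars ℝ).comp hf
  exact contDiff_rinner h2 ((L.isBoundedBilinearMap.contDiff.restrict_scalars ℝ).comp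
    (hg.prodMk h2))

theorem hasDerivAt_rinner {f g : ℝ → H} {f' g' : H} {t : ℝ} (hf : HasDerivAt f f' t)
    (hg : HasDerivAt g g' t) :
    HasDerivAt (fun t ↦ rinner (f t) (g t)) (rinner (f t) g' + rinner f' (g t)) t := by
  have h := Complex.reCLM.hasFDerivAt.comp_hasDerivAt t (hf.inner ℂ hg)
  rw [map_add] at h
  exact h

theorem hasDerivAt_rinner_self {f : ℝ → H} {f' : H} {t : ℝ} (hf : HasDerivAt f f' t) :
    HasDerivAt (fun t ↦ rinner (f t) (f t)) (2 * rinner (f t) f') t := by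
  refine (hasDerivAt_rinner hf hf).congr_deriv ?_
  rw [rinner_comm f']
  ring

/-- By symmetry the two terms in which `f` is differentiated coincide; the remaining one
differentiates the coefficient. -/
theorem hasDerivAt_rinner_bilin [IsScalarTower ℝ ℂ H] (Q : H →L[ℂ] H) (L : H →L[ℂ] H →L[ℂ] H)
    {f g : ℝ → H} {f' g' : H} {t : ℝ} (hf : HasDerivAt f f' t) (hg : HasDerivAt g g' t) (hs : IsSymm (L (g t))) :
    HasDerivAt (fun t ↦ rinner (Q (f t)) (L (g t) (Q (f t))))
      (2 * rinner (Q f') (L (g t) (Q (f t))) + rinner (Q (f t)) (L g' (Q (f t)))) t := by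
  have h2 : HasDerivAt (fun t ↦ Q (f t)) (Q f') t :=
    (Q.hasFDerivAt.restrictScalars ℝ).comp_hasDerivAt t hf
  have h3 : HasDerivAt (fun t ↦ L (g t) (Q (f t))) (L (g t) (Q f') + L g' (Q (f t))) t := by
    have h := ((L.isBoundedBilinearMap.hasFDerivAt (g t, Q (f t))).restrictScalars
      ℝ).comp_hasDerivAt t (hg.prodMk h2)
    exact h
  refine (hasDerivAt_rinner h2 h3).congr_deriv ?_
  rw [rinner_add_right, ← hs.rinner, rinner_comm (L (g t) (Q (f t)))]
  ring

end HilbertCalculus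

/-! ### The energy functional: coercivity, upper bound, differentiability -/

section Energy

variable {d : ℕ} {t₀ ε h : ℝ} {G₁ G₂ : Space d → ℝ}

/-- The energy functional, in terms of the weighted Fourier transforms of the elevation `ζ̄` of the
background, of `ζ` and of `G₁[v]`. -/
def energy (ht₀ : (d : ℝ) / 2 < t₀) (hG : IsAdmissible G₁ G₂) (ε : ℝ)
    (p : L2 d × Lp (CVec d) 2 (volume : Measure (Space d)) × L2 d) : ℝ :=
  rinner p.1 p.1 + ∑ k, rinner (compL2 k p.2.1) (compL2 k p.2.1) +
    ε * ∑ k, rinner (quotientOp hG (compL2 k p.2.1))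
      (convBilin ht₀ p.2.2 (quotientOp hG (compL2 k p.2.1)))

theorem rinner_self (f : L2 d) : rinner f f = ‖f‖ ^ 2 := by
  rw [rinner, inner_self_eq_norm_sq_to_K]
  norm_cast

theorem energy_eq (ht₀ : (d : ℝ) / 2 < t₀) (hG : IsAdmissible G₁ G₂) (ε : ℝ)
    (Z A : L2 d) (W : Lp (CVec d) 2 (volume : Measure (Space d))) :
    energy ht₀ hG ε (Z, W, A) = ‖Z‖ ^ 2 + ∑ k, (‖compL2 k W‖ ^ 2 +
      ε * rinner (quotientOp hG (compL2 k W)) (convBilin ht₀ A (quotientOp hG (compL2 k W)))) := by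
  simp only [energy, rinner_self, Finset.sum_add_distrib, Finset.mul_sum, add_assoc]

theorem norm_quotientOp_apply_le (hG : IsAdmissible G₁ G₂) (f : L2 d) :
    ‖quotientOp hG f‖ ≤ ‖f‖ := by
  simpa using norm_apply_le (norm_quotientOp_le hG) (le_refl ‖f‖)

/-- The weighted term involves only the quotient `G₂ / G₁` applied to `W`, whose norm is at most
that of `W`. The part of `‖W‖²` not seen by it has coefficient one, the rest has coefficient at
least `h`; hence the constant `max 1 (1 / h)`. -/
theorem le_energy (ht₀ : (d : ℝ) / 2 < t₀) (hG : IsAdmissible G₁ G₂) {Ubar : State d}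
    (hbar : MemX G₁ t₀ Ubar) (hh : 0 < h) (hnc : NonCavitation ε h Ubar) (Z : L2 d)
    (W : Lp (CVec d) 2 (volume : Measure (Space d))) :
    ‖Z‖ ^ 2 + ‖W‖ ^ 2 ≤
      max 1 (1 / h) * energy ht₀ hG ε (Z, W, lift (fun _ ↦ 1) t₀ Ubar.1) := by
  obtain ⟨a₀, ha₀, -⟩ := hbar.1
  have hW₀ := hbar.1.memW ha₀
  have hα₀ : (𝓕 (toL2 Ubar.1) : L2 d) =ᵐ[volume] a₀ := by
    rw [ha₀.fourier_toL2 (hW₀.memLp (nonneg_of_half_lt ht₀))]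
    exact MemLp.coeFn_toLp _
  have hc1 : 1 ≤ max 1 (1 / h) := le_max_left _ _
  have hc2 : 1 ≤ max 1 (1 / h) * h := by
    rw [← div_le_iff₀ hh]
    exact le_max_right _ _
  rw [energy_eq, ← sum_norm_compL2_sq, mul_add, Finset.mul_sum]
  refine add_le_add (le_mul_of_one_le_left (sq_nonneg _) hc1) (Finset.sum_le_sum fun k _ ↦ ?_)
  have h1 := le_norm_sq_add_rinner_coefOp ht₀ le_rfl hW₀ hα₀ hnc (quotientOp hG (compL2 k W))
  rw [coefOp_eq_convBilin ht₀ le_rfl hbar.1 ha₀ hW₀] at h1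
  have h2 : ‖quotientOp hG (compL2 k W)‖ ^ 2 ≤ ‖compL2 k W‖ ^ 2 := by
    gcongr
    exact norm_quotientOp_apply_le hG _
  set c := max 1 (1 / h)
  set F := ‖quotientOp hG (compL2 k W)‖ ^ 2
  have h3 := mul_le_mul_of_nonneg_left h1 (zero_le_one.trans hc1)
  have h4 : 0 ≤ (c - 1) * (‖compL2 k W‖ ^ 2 - F) :=
    mul_nonneg (by linarith) (by linarith)
  have h5 : 0 ≤ (c * h - 1) * F := mul_nonneg (by linarith) (sq_nonneg _)
  nlinarith

theorem abs_rinner_convBilin_le (ht₀ : (d : ℝ) / 2 < t₀) (hG : IsAdmissible G₁ G₂) (A f : L2 d) :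
    |rinner (quotientOp hG f) (convBilin ht₀ A (quotientOp hG f))| ≤
      2 * weightNorm d t₀ * ‖A‖ * ‖f‖ ^ 2 := by
  have h := norm_quotientOp_apply_le hG f
  refine (abs_rinner_le_of_le h (norm_apply_le (norm_convBilin_apply_le ht₀ A) h)).trans_eq ?_
  ring

theorem sum_rinner_convBilin_le (ht₀ : (d : ℝ) / 2 < t₀) (hG : IsAdmissible G₁ G₂) (A : L2 d)
    (W : Lp (CVec d) 2 (volume : Measure (Space d))) :
    ∑ k, rinner (quotientOp hG (compL2 k W)) (convBilin ht₀ A (quotientOp hG (compL2 k W))) ≤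
      2 * weightNorm d t₀ * ‖A‖ * ‖W‖ ^ 2 := by
  rw [← sum_norm_compL2_sq, Finset.mul_sum]
  exact Finset.sum_le_sum fun k _ ↦ (le_abs_self _).trans (abs_rinner_convBilin_le ht₀ hG A _)

theorem energy_le (ht₀ : (d : ℝ) / 2 < t₀) (hG : IsAdmissible G₁ G₂) (hε : 0 < ε) (hε1 : ε ≤ 1)
    (Z A : L2 d) (W : Lp (CVec d) 2 (volume : Measure (Space d))) :
    energy ht₀ hG ε (Z, W, A) ≤ (1 + 2 * weightNorm d t₀ * ‖A‖) * (‖Z‖ ^ 2 + ‖W‖ ^ 2) := by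
  have h1 := sum_rinner_convBilin_le ht₀ hG A W
  have h2 : 0 ≤ 2 * weightNorm d t₀ * ‖A‖ :=
    mul_nonneg (mul_nonneg zero_le_two (weightNorm_nonneg _)) (norm_nonneg _)
  rw [energy_eq, Finset.sum_add_distrib, sum_norm_compL2_sq, ← Finset.mul_sum]
  have h3 : ε * ∑ k, rinner (quotientOp hG (compL2 k W))
      (convBilin ht₀ A (quotientOp hG (compL2 k W))) ≤
      1 * (2 * weightNorm d t₀ * ‖A‖ * ‖W‖ ^ 2) :=
    (mul_le_mul_of_nonneg_left h1 hε.le).trans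
      (mul_le_mul_of_nonneg_right hε1 (mul_nonneg h2 (sq_nonneg _)))
  nlinarith [mul_nonneg h2 (sq_nonneg ‖Z‖)]

theorem isSymm_convBilin (ht₀ : (d : ℝ) / 2 < t₀) {Ubar : State d}
    (hbar : MemX G₁ t₀ Ubar) (hreal : IsRealValued Ubar.1) :
    IsSymm (convBilin ht₀ (lift (fun _ ↦ 1) t₀ Ubar.1)) := by
  obtain ⟨a₀, ha₀, -⟩ := hbar.1
  have hW₀ := hbar.1.memW ha₀
  have hα₀ : (𝓕 (toL2 Ubar.1) : L2 d) =ᵐ[volume] a₀ := by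
    rw [ha₀.fourier_toL2 (hW₀.memLp (nonneg_of_half_lt ht₀))]
    exact MemLp.coeFn_toLp _
  rw [← coefOp_eq_convBilin ht₀ le_rfl hbar.1 ha₀ hW₀]
  exact isSymm_coefOp ht₀ le_rfl hW₀ hα₀ hreal

/-- Used for the Lipschitz continuity in time: a `C¹` function is Lipschitz on the compact image of
a Lipschitz curve. -/
theorem contDiff_energy (ht₀ : (d : ℝ) / 2 < t₀) (hG : IsAdmissible G₁ G₂) (ε : ℝ) :
    ContDiff ℝ 1 (energy ht₀ hG ε) := by
  have h1 : ∀ k : Fin d, ContDiff ℝ 1 fun p : L2 d × Lp (CVec d) 2 (volume : Measure (Space d)) ×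
      L2 d ↦ compL2 k p.2.1 := fun k ↦
    ((compL2 k).contDiff.restrict_scalars ℝ).comp (contDiff_fst.comp contDiff_snd)
  have h2 : ∀ k : Fin d, ContDiff ℝ 1 fun p : L2 d × Lp (CVec d) 2 (volume : Measure (Space d)) ×
      L2 d ↦ rinner (compL2 k p.2.1) (compL2 k p.2.1) := fun k ↦ contDiff_rinner (h1 k) (h1 k)
  have h3 : ∀ k : Fin d, ContDiff ℝ 1 fun p : L2 d × Lp (CVec d) 2 (volume : Measure (Space d)) ×
      L2 d ↦ rinner (quotientOp hG (compL2 k p.2.1))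
        (convBilin ht₀ p.2.2 (quotientOp hG (compL2 k p.2.1))) := fun k ↦
    contDiff_rinner_bilin (quotientOp hG) (convBilin ht₀) (h1 k) (contDiff_snd.comp contDiff_snd)
  have h4 : ContDiff ℝ 1 fun p : L2 d × Lp (CVec d) 2 (volume : Measure (Space d)) × L2 d ↦
      rinner p.1 p.1 := contDiff_rinner contDiff_fst contDiff_fst
  unfold energy
  exact (h4.add (ContDiff.sum fun k _ ↦ h2 k)).add
    (contDiff_const.mul (ContDiff.sum fun k _ ↦ h3 k))

theorem hasDerivAt_energy (ht₀ : (d : ℝ) / 2 < t₀) (hG : IsAdmissible G₁ G₂) (ε : ℝ)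
    {Z A : ℝ → L2 d} {W : ℝ → Lp (CVec d) 2 (volume : Measure (Space d))} {Z' A' : L2 d}
    {W' : Lp (CVec d) 2 (volume : Measure (Space d))} {t : ℝ} (hZ : HasDerivAt Z Z' t)
    (hW : HasDerivAt W W' t) (hA : HasDerivAt A A' t) (hs : IsSymm (convBilin ht₀ (A t))) :
    HasDerivAt (fun t ↦ energy ht₀ hG ε (Z t, W t, A t))
      (2 * (rinner (Z t) Z' + ∑ k, rinner (compL2 k (W t)) (compL2 k W') +
        ε * ∑ k, rinner (quotientOp hG (compL2 k W'))
          (convBilin ht₀ (A t) (quotientOp hG (compL2 k (W t))))) +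
        ε * ∑ k, rinner (quotientOp hG (compL2 k (W t)))
          (convBilin ht₀ A' (quotientOp hG (compL2 k (W t))))) t := by
  have h1 : ∀ k : Fin d, HasDerivAt (fun t ↦ compL2 k (W t)) (compL2 k W') t := fun k ↦
    ((compL2 k).hasFDerivAt.restrictScalars ℝ).comp_hasDerivAt t hW
  have h2 : ∀ k : Fin d, HasDerivAt (fun t ↦ rinner (compL2 k (W t)) (compL2 k (W t)))
      (2 * rinner (compL2 k (W t)) (compL2 k W')) t := fun k ↦ hasDerivAt_rinner_self (h1 k)
  have h3 := fun k ↦ hasDerivAt_rinner_bilin (quotientOp hG) (convBilin ht₀) (h1 k) hA hs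
  have h4 := ((hasDerivAt_rinner_self hZ).add
    (HasDerivAt.fun_sum fun k (_ : k ∈ Finset.univ) ↦ h2 k)).add
    ((HasDerivAt.fun_sum fun k (_ : k ∈ Finset.univ) ↦ h3 k).const_mul ε)
  unfold energy
  refine h4.congr_deriv ?_
  rw [Finset.sum_add_distrib, ← Finset.mul_sum, ← Finset.mul_sum]
  ring

end Energy

/-! ### The energy estimate in time -/

section Estimate

variable {d : ℕ} {t₀ s M Cs N ε h τ : ℝ} {G₁ G₂ : Space d → ℝ}

theorem MemLinfX.memLp_normX {U : ℝ → State d} (hU : MemLinfX G₁ s τ U) :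
    MemLp (fun t ↦ normX G₁ s (U t)) ⊤ (timeMeasure τ) :=
  hU.memLp_fst.norm.add hU.memLp_snd.norm

theorem normX_nonneg (G₁ : Space d → ℝ) (s : ℝ) (U : State d) : 0 ≤ normX G₁ s U :=
  add_nonneg (norm_nonneg _) (norm_nonneg _)

theorem MemLinfX.ae_normX_le {U : ℝ → State d} (hU : MemLinfX G₁ s τ U) :
    ∀ᵐ t ∂timeMeasure τ, normX G₁ s (U t) ≤ normLinfX G₁ s τ U := by
  filter_upwards [enorm_ae_le_eLpNormEssSup (fun t ↦ normX G₁ s (U t)) (timeMeasure τ)] with t ht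
  rw [← eLpNorm_exponent_top] at ht
  have h1 := ENNReal.toReal_mono hU.memLp_normX.2.ne ht
  rwa [toReal_enorm, Real.norm_of_nonneg (normX_nonneg _ _ _)] at h1

theorem sum_norm_mul_le (Z R₁ : L2 d) (W R₂ : Lp (CVec d) 2 (volume : Measure (Space d))) :
    ‖Z‖ * ‖R₁‖ + ∑ k, ‖compL2 k W‖ * ‖compL2 k R₂‖ ≤
      √(‖Z‖ ^ 2 + ‖W‖ ^ 2) * (‖R₁‖ + ‖R₂‖) := by
  have h1 : ∑ k, ‖compL2 k W‖ * ‖compL2 k R₂‖ ≤ ‖W‖ * ‖R₂‖ := by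
    refine (Real.sum_mul_le_sqrt_mul_sqrt _ _ _).trans_eq ?_
    rw [sum_norm_compL2_sq, sum_norm_compL2_sq, Real.sqrt_sq (norm_nonneg _),
      Real.sqrt_sq (norm_nonneg _)]
  have h2 : ‖Z‖ ≤ √(‖Z‖ ^ 2 + ‖W‖ ^ 2) := Real.le_sqrt_of_sq_le (by nlinarith [sq_nonneg ‖W‖])
  have h3 : ‖W‖ ≤ √(‖Z‖ ^ 2 + ‖W‖ ^ 2) := Real.le_sqrt_of_sq_le (by nlinarith [sq_nonneg ‖Z‖])
  rw [mul_add]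
  refine add_le_add ?_ (h1.trans ?_)
  · gcongr
  · gcongr

/-- The exponential rate in the energy estimate. -/
def energyRate (d : ℕ) (t₀ B c a : ℝ) : ℝ :=
  c * (10 * (1 + d) * B ^ 3 + weightNorm d t₀ * a)

/-- The energy estimate on the time interval `[0, τ]`. -/
theorem energy_estimate (ht₀ : (d : ℝ) / 2 < t₀) (hs : 0 ≤ s) (hG : IsAdmissible G₁ G₂)
    (h₁ : SymbolBound G₁ M) (h₂ : SymbolBound G₂ M) (hCs : 0 ≤ Cs)
    (hk : ∀ j : Fin d, KerBound t₀ (max (t₀ + 1) s) Cs (bracketKer s j))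
    (hε : 0 < ε) (hε1 : ε ≤ 1) {Ubar dUbar U dU R : ℝ → State d}
    (hbar : MemW1infX G₁ t₀ τ Ubar dUbar) (hbar' : MemLinfX G₁ (max (t₀ + 1) s) τ Ubar)
    (hreal : ∀ t ∈ Icc 0 τ, HasRealCoefficients G₂ (Ubar t)) (hh : 0 < h)
    (hnc : ∀ t ∈ Icc 0 τ, NonCavitation ε h (Ubar t)) (hU : MemW1infX G₁ s τ U dU)
    (hU1 : MemLinfX G₁ (s + 1) τ U) (hR : MemLinfX G₁ s τ R)
    (heq : SolvesLinearized ε G₁ G₂ τ Ubar U dU R) {B c a : ℝ}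
    (hB : B = opBound d t₀ M Cs (normLinfX G₁ (max (t₀ + 1) s) τ Ubar))
    (hc : c = max 1 (1 / h)) (ha : normLinfX G₁ t₀ τ dUbar ≤ a) {t : ℝ} (ht : t ∈ Icc 0 τ) :
    √(‖lift (fun _ ↦ 1) s (U t).1‖ ^ 2 + ‖lift G₁ s (U t).2‖ ^ 2) ≤
      c * (Real.exp (ε * energyRate d t₀ B c a * t) *
        (√((1 + 2 * weightNorm d t₀ * ‖lift (fun _ ↦ 1) t₀ (Ubar 0).1‖) *
          (‖lift (fun _ ↦ 1) s (U 0).1‖ ^ 2 + ‖lift G₁ s (U 0).2‖ ^ 2)) +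
        ε * (2 * B * c) * ∫ r in (0 : ℝ)..t, normX G₁ s (R r))) := by
  have hτ : 0 ≤ τ := ht.1.trans ht.2
  have h0 : (0 : ℝ) ∈ Icc 0 τ := left_mem_Icc.2 hτ
  have hc1 : 1 ≤ c := hc ▸ le_max_left _ _
  have hc0 : 0 ≤ c := zero_le_one.trans hc1
  have hM : 0 ≤ M := h₁.nonneg
  have hw := weightNorm_nonneg (d := d) t₀
  have hN0 : 0 ≤ normLinfX G₁ (max (t₀ + 1) s) τ Ubar := ENNReal.toReal_nonneg
  have hB0 : 0 ≤ B := by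
    rw [hB, opBound]
    positivity
  have ha0 : 0 ≤ a := ENNReal.toReal_nonneg.trans ha
  set Y : ℝ → ℝ := fun t ↦ ‖lift (fun _ ↦ 1) s (U t).1‖ ^ 2 + ‖lift G₁ s (U t).2‖ ^ 2 with hY
  set E : ℝ → ℝ := fun t ↦ energy ht₀ hG ε
    (lift (fun _ ↦ 1) s (U t).1, lift G₁ s (U t).2, lift (fun _ ↦ 1) t₀ (Ubar t).1) with hE
  have hYE : ∀ t ∈ Icc 0 τ, Y t ≤ c * E t := fun t ht ↦ by
    rw [hc]
    exact le_energy ht₀ hG (hbar.mem t ht) hh (hnc t ht) _ _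
  have hY0 : ∀ t, 0 ≤ Y t := fun t ↦ by positivity
  have hE0 : ∀ t ∈ Icc 0 τ, 0 ≤ E t := fun t ht ↦
    nonneg_of_mul_nonneg_right ((hY0 t).trans (hYE t ht)) (by linarith)
  -- Since `c ≥ 1`, its square root is replaced by `c` itself.
  have hsq : ∀ t ∈ Icc 0 τ, √(Y t) ≤ c * √(E t) := fun t ht ↦ by
    refine Real.sqrt_le_iff.2 ⟨by positivity, ?_⟩
    rw [mul_pow, Real.sq_sqrt (hE0 t ht)]
    have : c ≤ c ^ 2 := le_self_pow₀ hc1 two_ne_zero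
    exact (hYE t ht).trans (mul_le_mul_of_nonneg_right this (hE0 t ht))
  have hZ := lipschitz_hasDerivAt_of_eq_integral hτ hU.memLinf_deriv.memLp_fst hU.eq_fst
  have hW := lipschitz_hasDerivAt_of_eq_integral hτ hU.memLinf_deriv.memLp_snd hU.eq_snd
  have hA := lipschitz_hasDerivAt_of_eq_integral hτ hbar.memLinf_deriv.memLp_fst hbar.eq_fst
  have hLip : ∃ K, LipschitzOnWith K E (Icc 0 τ) := by
    obtain ⟨K₁, hK₁⟩ := hZ.1
    obtain ⟨K₂, hK₂⟩ := hW.1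
    obtain ⟨K₃, hK₃⟩ := hA.1
    have hp := hK₁.prodMk (hK₂.prodMk hK₃)
    obtain ⟨K, hK⟩ := LocallyLipschitzOn.exists_lipschitzOnWith_of_compact
      (isCompact_Icc.image_of_continuousOn hp.continuousOn)
      ((contDiff_energy ht₀ hG ε).locallyLipschitz.locallyLipschitzOn)
    exact ⟨_, hK.comp hp (mapsTo_image _ _)⟩
  obtain ⟨K, hK⟩ := hLip
  have hder : ∀ᵐ t ∂timeMeasure τ, ∃ E', HasDerivAt E E' t ∧
      E' ≤ 2 * (ε * energyRate d t₀ B c a) * E t +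
        2 * (ε * (2 * B * c)) * √(E t) * normX G₁ s (R t) := by
    filter_upwards [hZ.2, hW.2, hA.2, hU1.mem, hU.memLinf_deriv.mem, hR.mem, heq, hbar'.mem,
      hbar'.ae_normX_le, hbar.memLinf_deriv.ae_normX_le, ae_restrict_mem measurableSet_Icc]
      with t e1 e2 e3 e4 e5 e6 e7 e8 e9 e10 ht
    refine ⟨_, hasDerivAt_energy ht₀ hG ε e1 e2 e3
      (isSymm_convBilin ht₀ (hbar.mem t ht) (hreal t ht).1), ?_⟩
    have h3 := linearized_energy_rate ht₀ hs hG h₁ h₂ hCs hk hε hε1 (hbar.mem t ht) e8 (hreal t ht)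
      (hU.mem t ht) e4 e5 e6 e7 e9
    simp only [liftV] at h3
    rw [sum_norm_compL2_sq, ← hB] at h3
    have h4 := sum_norm_mul_le (lift (fun _ ↦ 1) s (U t).1) (lift (fun _ ↦ 1) s (R t).1)
      (lift G₁ s (U t).2) (lift G₁ s (R t).2)
    have h5 := sum_rinner_convBilin_le ht₀ hG (lift (fun _ ↦ 1) t₀ (dUbar t).1) (lift G₁ s (U t).2)
    have h6 : ‖lift (fun _ ↦ 1) t₀ (dUbar t).1‖ ≤ a := by
      refine le_trans ?_ (e10.trans ha)
      exact le_add_of_nonneg_right (norm_nonneg _)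
    have h7 : 2 * weightNorm d t₀ * ‖lift (fun _ ↦ 1) t₀ (dUbar t).1‖ * ‖lift G₁ s (U t).2‖ ^ 2 ≤
        2 * weightNorm d t₀ * a * Y t := by
      have : ‖lift G₁ s (U t).2‖ ^ 2 ≤ Y t := le_add_of_nonneg_left (sq_nonneg _)
      gcongr
    have h8 : √(Y t) * normX G₁ s (R t) ≤ c * √(E t) * normX G₁ s (R t) :=
      mul_le_mul_of_nonneg_right (hsq t ht) (normX_nonneg _ _ _)
    have h9 := mul_le_mul_of_nonneg_left (h5.trans h7) hε.le
    have h10 := mul_le_mul_of_nonneg_left (h4.trans h8) (by positivity : 0 ≤ ε * (2 * B))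
    have h11 := mul_le_mul_of_nonneg_left (hYE t ht)
      -- Converts the quadratic bound in terms of `Y` into one in terms of the energy; half of this
      -- coefficient, times `c`, is `ε` times `energyRate`.
      (by positivity : 0 ≤ 2 * ε * (10 * (1 + d) * B ^ 3 + weightNorm d t₀ * a))
    change _ ≤ ε * (10 * (1 + d) * B ^ 3) * Y t + _ at h3
    unfold energyRate
    linarith
  have main := sqrt_le_of_ae_deriv_le (by positivity) (by unfold energyRate; positivity) hK hE0
    (intervalIntegrable_of_memLp_top hτ hR.memLp_normX) (fun t ↦ normX_nonneg _ _ _) hder ht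
  refine (hsq t ht).trans (mul_le_mul_of_nonneg_left (main.trans ?_) hc0)
  have h12 : √(E 0) ≤ √((1 + 2 * weightNorm d t₀ * ‖lift (fun _ ↦ 1) t₀ (Ubar 0).1‖) * Y 0) :=
    Real.sqrt_le_sqrt (energy_le ht₀ hG hε hε1 _ _ _)
  gcongr

end Estimate

/-! ### Monotonicity of the constants -/

section Constants

variable {d : ℕ} {t₀ M Cs : ℝ}

theorem one_le_opBound {N : ℝ} (hM : 0 ≤ M) (hCs : 0 ≤ Cs) (hN : 0 ≤ N) :
    1 ≤ opBound d t₀ M Cs N := by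
  have := weightNorm_nonneg (d := d) t₀
  have : 0 ≤ 2 * (1 + 4 * M + Cs) * weightNorm d t₀ * N := by positivity
  unfold opBound
  linarith

theorem opBound_le {N N' : ℝ} (hM : 0 ≤ M) (hCs : 0 ≤ Cs) (hN : N ≤ N') :
    opBound d t₀ M Cs N ≤ opBound d t₀ M Cs N' := by
  have := weightNorm_nonneg (d := d) t₀
  unfold opBound
  gcongr

theorem energyRate_nonneg {B c a : ℝ} (hB : 0 ≤ B) (hc : 0 ≤ c) (ha : 0 ≤ a) :
    0 ≤ energyRate d t₀ B c a := by
  have := weightNorm_nonneg (d := d) t₀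
  unfold energyRate
  positivity

theorem energyRate_le {B B' c c' a a' : ℝ} (hB : 0 ≤ B) (hc : 0 ≤ c) (ha : 0 ≤ a) (hB' : B ≤ B')
    (hc' : c ≤ c') (ha' : a ≤ a') : energyRate d t₀ B c a ≤ energyRate d t₀ B' c' a' := by
  have := weightNorm_nonneg (d := d) t₀
  unfold energyRate
  gcongr
  exact hc.trans hc'

end Constants

/-! ### The functions `κ`, `λ` and `ν` -/

section Functions

variable (d : ℕ) (t₀ M Cs : ℝ)

/-- The prefactor of the initial data in the energy estimate. -/
def initialFactor (p : ℝ × ℝ) : ℝ :=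
  -- Clamping at zero gives monotonicity and positivity on the whole plane, not only for the norms
  -- that are substituted. Nothing here involves `s`, as the order of quantifiers requires.
  2 * max 1 p.1 * √(1 + 2 * weightNorm d t₀ * max p.2 0)

/-- The growth rate in the energy estimate. -/
def growthRate (p : ℝ × ℝ × ℝ × ℝ) : ℝ :=
  -- The absolute value covers negative `M`, and the added `1` makes the rate strictly positive.
  energyRate d t₀ (opBound d t₀ |M| Cs (max p.2.2.2 0)) (max 1 p.1) (max p.2.2.1 0) + 1

/-- The prefactor of the source term in the energy estimate. -/
def sourceFactor (p : ℝ × ℝ × ℝ × ℝ) : ℝ :=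
  4 * opBound d t₀ |M| Cs (max p.2.2.2 0) * max 1 p.1 ^ 2 *
    Real.exp (growthRate d t₀ M Cs p * max p.2.1 0)

variable {d t₀ M Cs}

theorem monotone_initialFactor : Monotone (initialFactor d t₀) := by
  intro p q ⟨h1, h2⟩
  have := weightNorm_nonneg (d := d) t₀
  unfold initialFactor
  gcongr

theorem initialFactor_pos (p : ℝ × ℝ) : 0 < initialFactor d t₀ p := by
  have h1 := weightNorm_nonneg (d := d) t₀
  have h2 : 0 ≤ max p.2 0 := le_max_right _ _
  have h3 : 0 < max 1 p.1 := zero_lt_one.trans_le (le_max_left _ _)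
  unfold initialFactor
  positivity

theorem growthRate_pos (hCs : 0 ≤ Cs) (p : ℝ × ℝ × ℝ × ℝ) : 0 < growthRate d t₀ M Cs p := by
  have h1 := one_le_opBound (d := d) (t₀ := t₀) (abs_nonneg M) hCs (le_max_right p.2.2.2 0)
  have h2 := energyRate_nonneg (d := d) (t₀ := t₀) (zero_le_one.trans h1)
    (zero_le_one.trans (le_max_left 1 p.1)) (le_max_right p.2.2.1 0)
  unfold growthRate
  linarith

theorem monotone_growthRate (hCs : 0 ≤ Cs) : Monotone (growthRate d t₀ M Cs) := by
  rintro p q ⟨h1, -, h3, h4⟩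
  have e1 := one_le_opBound (d := d) (t₀ := t₀) (abs_nonneg M) hCs (le_max_right p.2.2.2 0)
  unfold growthRate
  gcongr
  exact energyRate_le (zero_le_one.trans e1) (zero_le_one.trans (le_max_left 1 p.1))
    (le_max_right _ _) (opBound_le (abs_nonneg M) hCs (max_le_max_right 0 h4))
    (max_le_max_left 1 h1) (max_le_max_right 0 h3)

theorem sourceFactor_pos (hCs : 0 ≤ Cs) (p : ℝ × ℝ × ℝ × ℝ) : 0 < sourceFactor d t₀ M Cs p := by
  have h1 := one_le_opBound (d := d) (t₀ := t₀) (abs_nonneg M) hCs (le_max_right p.2.2.2 0)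
  have h3 : 0 < max 1 p.1 := zero_lt_one.trans_le (le_max_left _ _)
  unfold sourceFactor
  positivity

theorem monotone_sourceFactor (hCs : 0 ≤ Cs) : Monotone (sourceFactor d t₀ M Cs) := by
  intro p q h
  have hg := monotone_growthRate (d := d) (t₀ := t₀) (M := M) hCs h
  obtain ⟨h1, h2, h3, h4⟩ := h
  have e1 := one_le_opBound (d := d) (t₀ := t₀) (abs_nonneg M) hCs (le_max_right p.2.2.2 0)
  have e2 := opBound_le (d := d) (t₀ := t₀) (abs_nonneg M) hCs (max_le_max_right 0 h4)
  have e3 := (growthRate_pos (d := d) (t₀ := t₀) (M := M) hCs q).le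
  have e4 : 0 ≤ opBound d t₀ |M| Cs (max q.2.2.2 0) := by linarith
  have e5 : (0 : ℝ) ≤ max 1 p.1 := zero_le_one.trans (le_max_left 1 p.1)
  have e6 : (0 : ℝ) ≤ max p.2.1 0 := le_max_right _ _
  unfold sourceFactor
  gcongr

end Functions

end WhithamBoussinesq

end

/-! ### Assembly of the estimate -/

theorem proposition1p1 (d : ℕ) (hd : d = 1 ∨ d = 2) (t₀ : ℝ) (ht₀ : (d : ℝ) / 2 < t₀) (M : ℝ) :
    -- `κ₀ = κ (1/h_min, |Ū(0)|_{X^{t₀}})`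
    ∃ κ : ℝ × ℝ → ℝ, Monotone κ ∧ (∀ p, 0 < κ p) ∧
    ∀ s : ℝ, 0 ≤ s →
    -- `λ_s`, `ν_s` as functions of
    -- `(1/h_min, T, |Ū|_{W^{1,∞}_t X^{t₀}}, |Ū|_{L^∞_t X^{max(t₀+1,s)}})`
    ∃ lam nu : ℝ × ℝ × ℝ × ℝ → ℝ, Monotone lam ∧ Monotone nu ∧
      (∀ p, 0 < lam p) ∧ (∀ p, 0 < nu p) ∧
    ∀ G₁ G₂ : WhithamBoussinesq.Space d → ℝ, WhithamBoussinesq.IsAdmissible G₁ G₂ →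
      WhithamBoussinesq.SymbolBound G₁ M → WhithamBoussinesq.SymbolBound G₂ M →
    ∀ ε : ℝ, 0 < ε → ε ≤ 1 → ∀ T : ℝ, 0 < T →
    ∀ Ubar dUbar : ℝ → WhithamBoussinesq.State d,
      WhithamBoussinesq.MemW1infX G₁ t₀ (T / ε) Ubar dUbar →
      WhithamBoussinesq.MemLinfX G₁ (max (t₀ + 1) s) (T / ε) Ubar →
      (∀ t ∈ Set.Icc 0 (T / ε), WhithamBoussinesq.HasRealCoefficients G₂ (Ubar t)) →
    ∀ hmin : ℝ, 0 < hmin →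
      (∀ t ∈ Set.Icc 0 (T / ε), WhithamBoussinesq.NonCavitation ε hmin (Ubar t)) →
    ∀ U dU R : ℝ → WhithamBoussinesq.State d,
      WhithamBoussinesq.MemW1infX G₁ s (T / ε) U dU →
      WhithamBoussinesq.MemLinfX G₁ (s + 1) (T / ε) U →
      WhithamBoussinesq.MemLinfX G₁ s (T / ε) R →
      WhithamBoussinesq.SolvesLinearized ε G₁ G₂ (T / ε) Ubar U dU R →
    ∀ t ∈ Set.Icc 0 (T / ε),
      WhithamBoussinesq.normX G₁ s (U t) ≤
        κ (1 / hmin, WhithamBoussinesq.normX G₁ t₀ (Ubar 0))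
          * Real.exp (ε * lam (1 / hmin, T,
              WhithamBoussinesq.normW1infX G₁ t₀ (T / ε) Ubar dUbar,
              WhithamBoussinesq.normLinfX G₁ (max (t₀ + 1) s) (T / ε) Ubar) * t)
          * WhithamBoussinesq.normX G₁ s (U 0)
        + ε * nu (1 / hmin, T,
              WhithamBoussinesq.normW1infX G₁ t₀ (T / ε) Ubar dUbar,
              WhithamBoussinesq.normLinfX G₁ (max (t₀ + 1) s) (T / ε) Ubar)
          * ∫ r in (0 : ℝ)..t, WhithamBoussinesq.normX G₁ s (R r) := by
  refine ⟨WhithamBoussinesq.initialFactor d t₀, WhithamBoussinesq.monotone_initialFactor,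
    WhithamBoussinesq.initialFactor_pos, fun s hs ↦ ?_⟩
  obtain ⟨Cs', hk'⟩ := WhithamBoussinesq.exists_kerBound_bracketKer d t₀ hs
  -- Without a direction `j` the kernel bound would say nothing about the sign of `Cs'`.
  have hd0 : 0 < d := by omega
  have hCs : 0 ≤ Cs' := (hk' ⟨0, hd0⟩).nonneg
  refine ⟨WhithamBoussinesq.growthRate d t₀ M Cs', WhithamBoussinesq.sourceFactor d t₀ M Cs',
    WhithamBoussinesq.monotone_growthRate hCs, WhithamBoussinesq.monotone_sourceFactor hCs,
    WhithamBoussinesq.growthRate_pos hCs, WhithamBoussinesq.sourceFactor_pos hCs, ?_⟩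
  intro G₁ G₂ hG h₁ h₂ ε hε hε1 T hT Ubar dUbar hbar hbar' hreal h hh hnc U dU R hU hU1 hR heq t ht
  have hM : |M| = M := abs_of_nonneg h₁.nonneg
  set N₁ := WhithamBoussinesq.normW1infX G₁ t₀ (T / ε) Ubar dUbar with hN₁
  set N₂ := WhithamBoussinesq.normLinfX G₁ (max (t₀ + 1) s) (T / ε) Ubar with hN₂
  have hN₁0 : 0 ≤ N₁ := add_nonneg ENNReal.toReal_nonneg ENNReal.toReal_nonneg
  have hN₂0 : 0 ≤ N₂ := ENNReal.toReal_nonneg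
  have ha : WhithamBoussinesq.normLinfX G₁ t₀ (T / ε) dUbar ≤ N₁ :=
    le_add_of_nonneg_left ENNReal.toReal_nonneg
  have main := WhithamBoussinesq.energy_estimate ht₀ hs hG h₁ h₂ hCs hk' hε hε1 hbar hbar' hreal hh
    hnc hU hU1 hR heq rfl rfl ha ht
  rw [← hN₂] at main
  set B := WhithamBoussinesq.opBound d t₀ M Cs' N₂ with hB
  set c : ℝ := max 1 (1 / h) with hc
  set L := WhithamBoussinesq.energyRate d t₀ B c N₁ with hL
  have hB1 : 1 ≤ B := WhithamBoussinesq.one_le_opBound h₁.nonneg hCs hN₂0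
  have hc1 : 1 ≤ c := le_max_left _ _
  have hL0 : 0 ≤ L := WhithamBoussinesq.energyRate_nonneg (by linarith) (by linarith) hN₁0
  have hg : WhithamBoussinesq.growthRate d t₀ M Cs' (1 / h, T, N₁, N₂) = L + 1 := by
    simp only [WhithamBoussinesq.growthRate, hM, max_eq_left hN₁0, max_eq_left hN₂0]
    rfl
  have hn : WhithamBoussinesq.sourceFactor d t₀ M Cs' (1 / h, T, N₁, N₂) =
      4 * B * c ^ 2 * Real.exp ((L + 1) * T) := by
    simp only [WhithamBoussinesq.sourceFactor, hg, hM, max_eq_left hN₂0, max_eq_left hT.le]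
    rfl
  have hq := WhithamBoussinesq.normX_nonneg G₁ t₀ (Ubar 0)
  have hw := WhithamBoussinesq.weightNorm_nonneg (d := d) t₀
  have hi : 0 ≤ ∫ r in (0 : ℝ)..t, WhithamBoussinesq.normX G₁ s (R r) :=
    intervalIntegral.integral_nonneg ht.1 fun r _ ↦ WhithamBoussinesq.normX_nonneg _ _ _
  rw [hg, hn, WhithamBoussinesq.initialFactor, max_eq_left hq]
  -- The norm of `X^s` is a sum of two norms while the energy controls the sum of their squares; the
  -- loss is the factor 2 in `initialFactor`, and contributes to the 4 in `sourceFactor`.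
  have hnorm : WhithamBoussinesq.normX G₁ s (U t) ≤
      2 * √(‖WhithamBoussinesq.lift (fun _ ↦ 1) s (U t).1‖ ^ 2 +
        ‖WhithamBoussinesq.lift G₁ s (U t).2‖ ^ 2) := by
    rw [WhithamBoussinesq.normX, two_mul]
    exact add_le_add (Real.le_sqrt_of_sq_le (le_add_of_nonneg_right (sq_nonneg _)))
      (Real.le_sqrt_of_sq_le (le_add_of_nonneg_left (sq_nonneg _)))
  have hinit : √((1 + 2 * WhithamBoussinesq.weightNorm d t₀ *
      ‖WhithamBoussinesq.lift (fun _ ↦ 1) t₀ (Ubar 0).1‖) *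
      (‖WhithamBoussinesq.lift (fun _ ↦ 1) s (U 0).1‖ ^ 2 +
        ‖WhithamBoussinesq.lift G₁ s (U 0).2‖ ^ 2)) ≤
      √(1 + 2 * WhithamBoussinesq.weightNorm d t₀ * WhithamBoussinesq.normX G₁ t₀ (Ubar 0)) *
        WhithamBoussinesq.normX G₁ s (U 0) := by
    rw [Real.sqrt_mul (by positivity)]
    have e1 : ‖WhithamBoussinesq.lift (fun _ ↦ 1) t₀ (Ubar 0).1‖ ≤
        WhithamBoussinesq.normX G₁ t₀ (Ubar 0) := le_add_of_nonneg_right (norm_nonneg _)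
    refine mul_le_mul (Real.sqrt_le_sqrt (by gcongr)) ?_ (Real.sqrt_nonneg _) (Real.sqrt_nonneg _)
    refine Real.sqrt_le_iff.2 ⟨WhithamBoussinesq.normX_nonneg _ _ _, ?_⟩
    rw [WhithamBoussinesq.normX, add_sq]
    nlinarith [mul_nonneg (norm_nonneg (WhithamBoussinesq.lift (fun _ ↦ 1) s (U 0).1))
      (norm_nonneg (WhithamBoussinesq.lift G₁ s (U 0).2))]
  have hεt : ε * t ≤ T := by
    rw [mul_comm, ← le_div_iff₀ hε]
    exact ht.2
  have hexp₁ : Real.exp (ε * L * t) ≤ Real.exp (ε * (L + 1) * t) := by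
    have := ht.1
    gcongr
    linarith
  -- On the time interval `ε t ≤ T`, so the exponential in front of the source becomes a constant
  -- depending on `T`; the one in front of the initial data is kept.
  have hexp₂ : Real.exp (ε * L * t) ≤ Real.exp ((L + 1) * T) := by
    refine Real.exp_le_exp.2 ?_
    nlinarith [mul_nonneg hε.le ht.1]
  set κ₁ := √(1 + 2 * WhithamBoussinesq.weightNorm d t₀ * WhithamBoussinesq.normX G₁ t₀ (Ubar 0))
  set I := ∫ r in (0 : ℝ)..t, WhithamBoussinesq.normX G₁ s (R r)
  have hU0 := WhithamBoussinesq.normX_nonneg G₁ s (U 0)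
  have hB0 : 0 ≤ B := by linarith
  have hc0 : 0 ≤ c := by linarith
  calc WhithamBoussinesq.normX G₁ s (U t)
      ≤ 2 * (c * (Real.exp (ε * L * t) *
        (κ₁ * WhithamBoussinesq.normX G₁ s (U 0) + ε * (2 * B * c) * I))) := by
        refine hnorm.trans (mul_le_mul_of_nonneg_left (main.trans ?_) zero_le_two)
        gcongr
    _ = 2 * c * κ₁ * Real.exp (ε * L * t) * WhithamBoussinesq.normX G₁ s (U 0) +
        ε * (4 * B * c ^ 2 * Real.exp (ε * L * t)) * I := by ring
    _ ≤ 2 * c * κ₁ * Real.exp (ε * (L + 1) * t) * WhithamBoussinesq.normX G₁ s (U 0) +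
        ε * (4 * B * c ^ 2 * Real.exp ((L + 1) * T)) * I := by gcongr
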